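/- **Setting.** Fix $d,M,N_1\ge 1$, $T>0$, $\gamma_1\in[1/2,1]$, $\gamma_2\in(1/2,1)$, $\varphi\in\mathbb R$, a bounded activation function $\sigma\in C^\infty(\mathbb R)$ and a data set $(x^{(i)},y^{(i)})_{i=1}^M$ in $\mathbb R^d\times\mathbb R$ with empirical law $\pi=\frac1M\sum_{i=1}^M\delta_{(x^{(i)},y^{(i)})}$; $xx'$ denotes the inner product in $\mathbb R^d$. The two-layer network with parameters $C^i,W^{2,j,i}\in\mathbb R$, $W^{1,j}\in\mathbb R^d$ ($i\le N_2$, $j\le N_1$) is $$g(x)=\frac1{N_2^{\gamma_2}}\sum_{i=1}^{N_2}C^i\sigma\big(Z^{2,i}(x)\big),\qquad Z^{2,i}(x)=\frac1{N_1^{\gamma_1}}\sum_{j=1}^{N_1}W^{2,j,i}\sigma(W^{1,j}x).$$ It is trained by stochastic gradient descent along samples $(x_k,y_k)$, $k\ge0$: writing $g_k,Z_k^{2,i}$ for the functions given by the parameters after $k$ steps, $$C^i_{k+1}=C^i_k+\tfrac{\alpha_C}{N_2^{\gamma_2}}(y_k-g_k(x_k))\sigma(Z^{2,i}_k(x_k)),$$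 $$W^{2,j,i}_{k+1}=W^{2,j,i}_k+\tfrac{\alpha_{W,2}}{N_1^{\gamma_1}N_2^{\gamma_2}}(y_k-g_k(x_k))\,C^i_k\sigma'(Z^{2,i}_k(x_k))\sigma(W^{1,j}_kx_k),$$ $$W^{1,j}_{k+1}=W^{1,j}_k+\tfrac{\alpha_{W,1}}{N_1^{\gamma_1}}(y_k-g_k(x_k))\Big(\tfrac1{N_2^{\gamma_2}}\sum_{i=1}^{N_2}C^i_k\sigma'(Z^{2,i}_k(x_k))W^{2,j,i}_k\Big)\sigma'(W^{1,j}_kx_k)\,x_k,$$ with $\alpha_C=N_2^{-(2-2\gamma_2)}$, $\alpha_{W,1}=N_1^{-(1-2\gamma_1)}N_2^{-(3-2\gamma_2)}$, $\alpha_{W,2}=N_1^{-(1-2\gamma_1)}N_2^{-(2-2\gamma_2)}$. The samples $(x_k,y_k)$ are i.i.d. with law $\pi$; the $C^i_0$ are i.i.d. with law $\mu_C$ and the $W^{2,j,i}_0$ i.i.d. with law $\mu_{W^2}$, both laws having mean zero and compact support; the vector $W^1_0=(W^{1,j}_0)_{j\le N_1}$ has an arbitrary compactly supported law (for instance i.i.d.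 mean-zero coordinates $W_0^{1,j}$, or a deterministic vector); these four families are independent of each other. Let $h^{N_1,N_2}_t$ be the function $g_k$ for $k=\lfloor N_2t\rfloor$. For $w=(w^{1,j})_{j\le N_1}$ and $\theta=(c,w^2,w^1)\in\mathbb R^{1+N_1(1+d)}$ put $\gamma_0^{N_1}=\mu_C\otimes\mu_{W^2}^{\otimes N_1}\otimes\delta_w$, $\langle f,\gamma\rangle=\int f\,d\gamma$, $Z(x)=N_1^{-\gamma_1}\sum_jw^{2,j}\sigma(w^{1,j}x)$, and $$B^1_{x,x'}=\sigma(Z(x'))\sigma(Z(x)),\quad B^{2,j}_{x,x'}=c^2\sigma'(Z(x'))\sigma'(Z(x))\sigma(w^{1,j}x')\sigma(w^{1,j}x),\quad B^{3,j}_x=c\,w^{2,j}\sigma'(w^{1,j}x)\sigma'(Z(x)),$$ $$A^{N_1}_{x,x'}=\langle B^1_{x,x'},\gamma_0^{N_1}\rangle+\frac1{N_1}\sum_{j=1}^{N_1}\Big[\langle B^{2,j}_{x,x'},\gamma_0^{N_1}\rangle+xx'\langle B^{3,j}_x,\gamma_0^{N_1}\rangle\langle B^{3,j}_{x'},\gamma_0^{N_1}\rangle\Big],$$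 $$C^f_{x'}=\partial_cf\,\sigma(Z(x'))+\frac1{N_1^{1-\gamma_1}}\sum_{j=1}^{N_1}\Big[c\,\sigma'(Z(x'))\sigma(w^{1,j}x')\,\partial_{w^{2,j}}f+\langle c\,\sigma'(Z(x'))\sigma'(w^{1,j}x')w^{2,j},\gamma_0^{N_1}\rangle\,\nabla_{w^{1,j}}f\cdot x'\Big].$$ Let $h^{N_1}$ be the solution of $h^{N_1}_t(x)=\int_0^t\int(y-h^{N_1}_s(x'))A^{N_1}_{x,x'}\,\pi(dx',dy)\,ds$, let $l^{N_1}_t(f)=\int_0^t\int(y-h^{N_1}_s(x'))\langle C^f_{x'},\gamma^{N_1}_0\rangle\,\pi(dx',dy)\,ds$, and let $\mathcal G^{N_1}$ be a centred Gaussian vector, indexed by the data points, with covariance $\langle c^2\sigma(Z(x))\sigma(Z(x')),\gamma^{N_1}_0\rangle$. All these objects are functions of $w$ and are taken at $w=W^1_0$. In particular, when $W_0^1$ is random, $\mathcal G^{N_1}$ is Gaussian with this covariance conditionally on $W_0^1$. **Theorem.** Let $K^{N_1,N_2}_t=N_2^{\varphi}(h^{N_1,N_2}_t-h^{N_1}_t)$,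 regarded as an $\mathbb R^M$-valued process by evaluation at the data points. As $N_2\to\infty$, $\{K^{N_1,N_2}_t,\,t\in[0,T]\}$ converges in distribution in the Skorokhod space $D_{\mathbb R^M}([0,T])$ to a process $K^{N_1}$ which satisfies, for all $t\in[0,T]$ and all data points $x$: *Case 1.* If $\gamma_2\in(\frac12,\frac34)$ and $\varphi\le\gamma_2-\frac12$, or if $\gamma_2\in[\frac34,1)$ and $\varphi<1-\gamma_2$, then $$K^{N_1}_t(x)=K^{N_1}_0(x)-\int_0^t\int K^{N_1}_s(x')A^{N_1}_{x,x'}\,\pi(dx',dy)\,ds,$$ where $K^{N_1}_0=\mathcal G^{N_1}$ if $\varphi=\gamma_2-\frac12$ and $K^{N_1}_0=0$ if $\varphi<\gamma_2-\frac12$. *Case 2.* If $\gamma_2\in[\frac34,1)$ and $\varphi=1-\gamma_2$, then $$\begin{aligned}K^{N_1}_t(x)=K^{N_1}_0(x)&+\int_0^t\int(y-h^{N_1}_s(x'))\Big[l^{N_1}_s(B^1_{x,x'})+\frac1{N_1}\sum_{j=1}^{N_1}l^{N_1}_s(B^{2,j}_{x,x'})\Big]\pi(dx',dy)\,ds\\&+\frac1{N_1}\sum_{j=1}^{N_1}\int_0^t\int(y-h^{N_1}_s(x'))\,xx'\,l^{N_1}_s(B^{3,j}_x)\,\langle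 B^{3,j}_{x'},\gamma^{N_1}_0\rangle\,\pi(dx',dy)\,ds\\&+\frac1{N_1}\sum_{j=1}^{N_1}\int_0^t\int(y-h^{N_1}_s(x'))\,xx'\,\langle B^{3,j}_x,\gamma^{N_1}_0\rangle\,l^{N_1}_s(B^{3,j}_{x'})\,\pi(dx',dy)\,ds\\&-\int_0^t\int K^{N_1}_s(x')A^{N_1}_{x,x'}\,\pi(dx',dy)\,ds,\end{aligned}$$ where $K^{N_1}_0=\mathcal G^{N_1}$ if $\gamma_2=\frac34$ and $K^{N_1}_0=0$ if $\gamma_2\in(\frac34,1)$. -/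

import Mathlib

open MeasureTheory ProbabilityTheory Filter Topology Set

noncomputable section

/-! ### The Skorokhod space of right-continuous paths with left limits on `[0,T]` -/

/-- The space `D_E([0,T])`: functions `[0,T] → E` that are right-continuous and have left limits. -/
structure SkorokhodSpace (T : ℝ) (E : Type*) [TopologicalSpace E] where
  toFun : Icc (0 : ℝ) T → E
  right_cont : ∀ t, ContinuousWithinAt toFun (Ici t) t
  left_lim : ∀ t, ∃ l, Tendsto toFun (𝓝[<] t) (𝓝 l)

namespace SkorokhodSpace

instance (T : ℝ) (E : Type*) [TopologicalSpace E] :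
    CoeFun (SkorokhodSpace T E) (fun _ => Icc (0 : ℝ) T → E) := ⟨SkorokhodSpace.toFun⟩

/-- Skorokhod's metric: the infimum, over all increasing bijective time changes `τ` of `[0,T]`, of
the larger of `sup |τ t - t|` and `sup |f t - g (τ t)|`. -/
instance (T : ℝ) (E : Type*) [PseudoEMetricSpace E] : EDist (SkorokhodSpace T E) :=
  ⟨fun f g => ⨅ τ : Icc (0 : ℝ) T ≃o Icc (0 : ℝ) T,
    max (⨆ t, edist (τ t) t) (⨆ t, edist (f t) (g (τ t)))⟩

theorem edist_def {T : ℝ} {E : Type*} [PseudoEMetricSpace E] (f g : SkorokhodSpace T E) :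
    edist f g = ⨅ τ : Icc (0 : ℝ) T ≃o Icc (0 : ℝ) T,
      max (⨆ t, edist (τ t) t) (⨆ t, edist (f t) (g (τ t))) := rfl

theorem edist_comm_le {T : ℝ} {E : Type*} [PseudoEMetricSpace E] (f g : SkorokhodSpace T E) :
    edist g f ≤ edist f g := by
  rw [edist_def f g]
  refine le_iInf fun τ => ?_
  rw [edist_def g f]
  refine (iInf_le _ τ.symm).trans (max_le_max ?_ ?_)
  · refine iSup_le fun t => ?_
    refine le_trans ?_ (le_iSup (fun s => edist (τ s) s) (τ.symm t))
    simp [edist_comm]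
  · refine iSup_le fun t => ?_
    refine le_trans ?_ (le_iSup (fun s => edist (f s) (g (τ s))) (τ.symm t))
    simp [edist_comm]

instance (T : ℝ) (E : Type*) [PseudoEMetricSpace E] : PseudoEMetricSpace (SkorokhodSpace T E) where
  edist_self f := by
    refine le_antisymm ?_ bot_le
    rw [edist_def]
    refine (iInf_le _ (OrderIso.refl _)).trans ?_
    simp
  edist_comm f g := le_antisymm (edist_comm_le g f) (edist_comm_le f g)
  edist_triangle f g h := by
    rw [edist_def f g, edist_def g h]
    refine ENNReal.le_iInf_add_iInf fun τ ρ => ?_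
    rw [edist_def f h]
    refine (iInf_le _ (τ.trans ρ)).trans (max_le ?_ ?_)
    · refine iSup_le fun t => ?_
      refine (edist_triangle _ (τ t) _).trans ?_
      rw [add_comm]
      refine add_le_add ?_ ?_
      · exact (le_iSup (fun s => edist (τ s) s) t).trans (le_max_left _ _)
      · exact (le_iSup (fun s => edist (ρ s) s) (τ t)).trans (le_max_left _ _)
    · refine iSup_le fun t => ?_
      refine (edist_triangle _ (g (τ t)) _).trans ?_
      refine add_le_add ?_ ?_
      · exact (le_iSup (fun s => edist (f s) (g (τ s))) t).trans (le_max_right _ _)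
      · exact (le_iSup (fun s => edist (g s) (h (ρ s))) (τ t)).trans (le_max_right _ _)

/-- The Borel sigma-algebra of the Skorokhod topology. -/
instance (T : ℝ) (E : Type*) [PseudoEMetricSpace E] : MeasurableSpace (SkorokhodSpace T E) :=
  borel _

instance (T : ℝ) (E : Type*) [PseudoEMetricSpace E] : BorelSpace (SkorokhodSpace T E) := ⟨rfl⟩

end SkorokhodSpace

/-- On the right of a time `t ≥ 0`, the step index `⌊N s⌋` stays constant for a while. -/
theorem floor_eventually_right (T : ℝ) (N : ℕ) (t : Icc (0 : ℝ) T) :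
    ∀ᶠ s : Icc (0 : ℝ) T in 𝓝[≥] t, ⌊(N : ℝ) * (s : ℝ)⌋₊ = ⌊(N : ℝ) * (t : ℝ)⌋₊ := by
  have hc : Continuous fun s : Icc (0 : ℝ) T => (N : ℝ) * (s : ℝ) := by fun_prop
  have h1 : ∀ᶠ s : Icc (0 : ℝ) T in 𝓝 t, (N : ℝ) * (s : ℝ) < ⌊(N : ℝ) * (t : ℝ)⌋₊ + 1 :=
    hc.continuousAt.eventually (gt_mem_nhds (Nat.lt_floor_add_one _))
  filter_upwards [self_mem_nhdsWithin, mem_nhdsWithin_of_mem_nhds h1] with s hs hs1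
  have hst : (t : ℝ) ≤ s := hs
  have h0 : 0 ≤ (N : ℝ) * (s : ℝ) := mul_nonneg (Nat.cast_nonneg _) s.2.1
  rw [Nat.floor_eq_iff h0]
  refine ⟨(Nat.floor_le (mul_nonneg (Nat.cast_nonneg _) t.2.1)).trans ?_, hs1⟩
  exact mul_le_mul_of_nonneg_left hst (Nat.cast_nonneg _)

/-- On the left of a time `t`, the step index `⌊N s⌋` is eventually constant. -/
theorem floor_eventually_left (T : ℝ) (N : ℕ) (t : Icc (0 : ℝ) T) :
    ∃ n : ℕ, ∀ᶠ s : Icc (0 : ℝ) T in 𝓝[<] t, ⌊(N : ℝ) * (s : ℝ)⌋₊ = n := by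
  have hc : Continuous fun s : Icc (0 : ℝ) T => (N : ℝ) * (s : ℝ) := by fun_prop
  rcases Nat.eq_zero_or_pos N with hN | hN
  · exact ⟨0, Eventually.of_forall fun s => by simp [hN]⟩
  have hN' : (0 : ℝ) < N := by exact_mod_cast hN
  rcases Nat.eq_zero_or_pos ⌈(N : ℝ) * (t : ℝ)⌉₊ with h | h
  · refine ⟨0, ?_⟩
    rw [Nat.ceil_eq_zero] at h
    filter_upwards [self_mem_nhdsWithin] with s hs
    have hst : (s : ℝ) < t := hs
    rw [Nat.floor_eq_zero]
    nlinarith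
  · refine ⟨⌈(N : ℝ) * (t : ℝ)⌉₊ - 1, ?_⟩
    have hlt : ((⌈(N : ℝ) * (t : ℝ)⌉₊ - 1 : ℕ) : ℝ) < (N : ℝ) * (t : ℝ) := by
      rw [← Nat.lt_ceil]; omega
    have h1 : ∀ᶠ s : Icc (0 : ℝ) T in 𝓝 t, ((⌈(N : ℝ) * (t : ℝ)⌉₊ - 1 : ℕ) : ℝ) < (N : ℝ) * (s : ℝ) :=
      hc.continuousAt.eventually (lt_mem_nhds hlt)
    filter_upwards [self_mem_nhdsWithin, mem_nhdsWithin_of_mem_nhds h1] with s hs hs1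
    have hst : (s : ℝ) < t := hs
    have h0 : 0 ≤ (N : ℝ) * (s : ℝ) := mul_nonneg (Nat.cast_nonneg _) s.2.1
    rw [Nat.floor_eq_iff h0]
    refine ⟨hs1.le, ?_⟩
    have h2 : (N : ℝ) * (s : ℝ) < (N : ℝ) * (t : ℝ) := mul_lt_mul_of_pos_left hst hN'
    have h3 := Nat.le_ceil ((N : ℝ) * (t : ℝ))
    have h4 : ((⌈(N : ℝ) * (t : ℝ)⌉₊ - 1 : ℕ) : ℝ) + 1 = ⌈(N : ℝ) * (t : ℝ)⌉₊ := by
      exact_mod_cast Nat.sub_add_cancel h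
    linarith

/-! ### The network and its stochastic gradient descent -/

/-- The data of the problem: activation function, the two scaling exponents, the data set
`(x i, y i)`, `i < M`, and the laws of the initial outer weights `C` and of the initial
second-layer weights `W²`. -/
structure Setting (d M N₁ : ℕ) where
  σ : ℝ → ℝ
  γ₁ : ℝ
  γ₂ : ℝ
  x : Fin M → EuclideanSpace ℝ (Fin d)
  y : Fin M → ℝ
  μC : Measure ℝ
  μW : Measure ℝ

/-- First-layer weights `w¹ = (w^{1,1}, …, w^{1,N₁})`. -/
abbrev FirstLayer (d N₁ : ℕ) : Type := Fin N₁ → EuclideanSpace ℝ (Fin d)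

/-- One particle `θ = (c, w², w¹)`. -/
abbrev Particle (d N₁ : ℕ) : Type := ℝ × (Fin N₁ → ℝ) × FirstLayer d N₁

/-- All parameters of the network with `N₂` units in the second layer; `W2 i j` is `W^{2,j,i}`. -/
structure Params (d N₁ N₂ : ℕ) where
  C : Fin N₂ → ℝ
  W2 : Fin N₂ → Fin N₁ → ℝ
  W1 : FirstLayer d N₁

/-- The particle `θⁱ = (Cⁱ, W^{2,·,i}, W^{1,·})`. -/
def Params.particle {d N₁ N₂ : ℕ} (p : Params d N₁ N₂) (i : Fin N₂) : Particle d N₁ :=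
  (p.C i, p.W2 i, p.W1)

/-- The learning rate `α_C`. -/
def rateC (γ₂ : ℝ) (N₂ : ℕ) : ℝ := 1 / (N₂ : ℝ) ^ (2 - 2 * γ₂)

/-- The learning rate `α_{W,1}`. -/
def rateW1 (γ₁ γ₂ : ℝ) (N₁ N₂ : ℕ) : ℝ :=
  1 / ((N₁ : ℝ) ^ (1 - 2 * γ₁) * (N₂ : ℝ) ^ (3 - 2 * γ₂))

/-- The learning rate `α_{W,2}`. -/
def rateW2 (γ₁ γ₂ : ℝ) (N₁ N₂ : ℕ) : ℝ :=
  1 / ((N₁ : ℝ) ^ (1 - 2 * γ₁) * (N₂ : ℝ) ^ (2 - 2 * γ₂))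

namespace Setting

variable {d M N₁ : ℕ} (S : Setting d M N₁)

/-- The pre-activation `Z²(x) = N₁^{-γ₁} ∑ⱼ w^{2,j} σ(w^{1,j} · x)` of a particle. -/
def Z (θ : Particle d N₁) (x : EuclideanSpace ℝ (Fin d)) : ℝ :=
  1 / (N₁ : ℝ) ^ S.γ₁ * ∑ j, θ.2.1 j * S.σ (inner ℝ (θ.2.2 j) x)

/-- The network output `g_θ(x) = N₂^{-γ₂} ∑ᵢ Cⁱ σ(Z^{2,i}(x))`. -/
def network {N₂ : ℕ} (p : Params d N₁ N₂) (x : EuclideanSpace ℝ (Fin d)) : ℝ :=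
  1 / (N₂ : ℝ) ^ S.γ₂ * ∑ i, p.C i * S.σ (S.Z (p.particle i) x)

/-- One step of stochastic gradient descent for the squared error, at the sample `(x, y) = z`. -/
def sgdStep {N₂ : ℕ} (p : Params d N₁ N₂) (z : EuclideanSpace ℝ (Fin d) × ℝ) :
    Params d N₁ N₂ where
  C i := p.C i +
    rateC S.γ₂ N₂ / (N₂ : ℝ) ^ S.γ₂ * (z.2 - S.network p z.1) * S.σ (S.Z (p.particle i) z.1)
  W2 i j := p.W2 i j +
    rateW2 S.γ₁ S.γ₂ N₁ N₂ / ((N₁ : ℝ) ^ S.γ₁ * (N₂ : ℝ) ^ S.γ₂) * (z.2 - S.network p z.1) *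
      p.C i * deriv S.σ (S.Z (p.particle i) z.1) * S.σ (inner ℝ (p.W1 j) z.1)
  W1 j := p.W1 j +
    (rateW1 S.γ₁ S.γ₂ N₁ N₂ / (N₁ : ℝ) ^ S.γ₁ * (z.2 - S.network p z.1) *
      (1 / (N₂ : ℝ) ^ S.γ₂ *
        ∑ i, p.C i * deriv S.σ (S.Z (p.particle i) z.1) * p.W2 i j) *
      deriv S.σ (inner ℝ (p.W1 j) z.1)) • z.1

/-- The parameters after `k` steps, along the samples `z 0, z 1, …`. -/
def sgd {N₂ : ℕ} (p : Params d N₁ N₂) (z : ℕ → EuclideanSpace ℝ (Fin d) × ℝ) : ℕ → Params d N₁ N₂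
  | 0 => p
  | k + 1 => S.sgdStep (sgd p z k) (z k)

/-- The parameters at initialization of the network with `N₂` units in the second layer. -/
def initParams (N₂ : ℕ) (w : FirstLayer d N₁) (c : ℕ → ℝ) (w2 : ℕ → Fin N₁ → ℝ) :
    Params d N₁ N₂ where
  C i := c i
  W2 i j := w2 i j
  W1 := w

/-- The empirical law `π = M⁻¹ ∑ᵢ δ_{(xᵢ,yᵢ)}` of the data set. -/
def dataLaw : Measure (EuclideanSpace ℝ (Fin d) × ℝ) :=
  (M : ENNReal)⁻¹ • ∑ i, Measure.dirac (S.x i, S.y i)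

/-- The vector of outputs on the data set after `k` steps. -/
def outputs (N₂ : ℕ) (w : FirstLayer d N₁) (c : ℕ → ℝ) (w2 : ℕ → Fin N₁ → ℝ)
    (z : ℕ → EuclideanSpace ℝ (Fin d) × ℝ) (k : ℕ) : EuclideanSpace ℝ (Fin M) :=
  WithLp.toLp 2 fun i => S.network (S.sgd (initParams N₂ w c w2) z k) (S.x i)

/-! ### The limiting objects, given the first-layer weights `w` at initialization -/

/-- The limiting law of the particles, `γ₀ = μ_C ⊗ μ_{W²}^{⊗ N₁} ⊗ δ_w`. -/
def γ₀ (w : FirstLayer d N₁) : Measure (Particle d N₁) :=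
  S.μC.prod ((Measure.pi fun _ : Fin N₁ => S.μW).prod (Measure.dirac w))

/-- The function `B¹_{x,x'}`. -/
def B1 (x x' : EuclideanSpace ℝ (Fin d)) (θ : Particle d N₁) : ℝ :=
  S.σ (S.Z θ x') * S.σ (S.Z θ x)

/-- The function `B^{2,j}_{x,x'}`. -/
def B2 (j : Fin N₁) (x x' : EuclideanSpace ℝ (Fin d)) (θ : Particle d N₁) : ℝ :=
  θ.1 ^ 2 * deriv S.σ (S.Z θ x') * deriv S.σ (S.Z θ x) *
    S.σ (inner ℝ (θ.2.2 j) x') * S.σ (inner ℝ (θ.2.2 j) x)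

/-- The function `B^{3,j}_x`. -/
def B3 (j : Fin N₁) (x : EuclideanSpace ℝ (Fin d)) (θ : Particle d N₁) : ℝ :=
  θ.1 * θ.2.1 j * deriv S.σ (inner ℝ (θ.2.2 j) x) * deriv S.σ (S.Z θ x)

/-- The kernel `A_{x,x'}`. -/
def A (w : FirstLayer d N₁) (x x' : EuclideanSpace ℝ (Fin d)) : ℝ :=
  (∫ θ, S.B1 x x' θ ∂S.γ₀ w) +
    1 / (N₁ : ℝ) * ∑ j, ((∫ θ, S.B2 j x x' θ ∂S.γ₀ w) +
      inner ℝ x x' * (∫ θ, S.B3 j x θ ∂S.γ₀ w) * (∫ θ, S.B3 j x' θ ∂S.γ₀ w))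

/-- The covariance matrix `⟨c² σ(Z²(x)) σ(Z²(x')), γ₀⟩` of the Gaussian vector `𝒢`. -/
def gaussCov (w : FirstLayer d N₁) : Matrix (Fin M) (Fin M) ℝ :=
  Matrix.of fun i m =>
    ∫ θ, (θ.1 * S.σ (S.Z θ (S.x i))) * (θ.1 * S.σ (S.Z θ (S.x m))) ∂S.γ₀ w

/-- The operator `v ↦ (M⁻¹ ∑ₘ A_{xᵢ,xₘ} vₘ)ᵢ = (∫ A_{xᵢ,x'} v(x') π(dx',dy))ᵢ` on `ℝ^M`. -/
def dataOp (w : FirstLayer d N₁) : EuclideanSpace ℝ (Fin M) →L[ℝ] EuclideanSpace ℝ (Fin M) :=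
  (M : ℝ)⁻¹ • Matrix.toEuclideanCLM (n := Fin M) (𝕜 := ℝ)
    (Matrix.of fun i m => S.A w (S.x i) (S.x m))

/-- The limit `h_t` of the network outputs on the data set. This is the solution of
`h_t(x) = ∫₀ᵗ ∫ (y - h_s(x')) A_{x,x'} π(dx',dy) ds`, written out as
`Y - exp(-t A/M) Y`; see `limitOutput_eq`, and `limitOutput_unique` for uniqueness. -/
def limitOutput (w : FirstLayer d N₁) (t : ℝ) : EuclideanSpace ℝ (Fin M) :=
  WithLp.toLp 2 S.y - NormedSpace.exp (t • -S.dataOp w) (WithLp.toLp 2 S.y)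

theorem dataOp_apply (w : FirstLayer d N₁) (v : EuclideanSpace ℝ (Fin M)) (i : Fin M) :
    S.dataOp w v i = (M : ℝ)⁻¹ * ∑ m, v m * S.A w (S.x i) (S.x m) := by
  simp [dataOp, Matrix.mulVec, dotProduct, mul_comm]

theorem hasDerivAt_limitOutput (w : FirstLayer d N₁) (t : ℝ) :
    HasDerivAt (S.limitOutput w) (S.dataOp w (WithLp.toLp 2 S.y - S.limitOutput w t)) t := by
  have h := hasDerivAt_exp_smul_const' (𝕂 := ℝ) (-S.dataOp w) t
  have h2 := (h.clm_apply (hasDerivAt_const t (WithLp.toLp 2 S.y))).const_sub (WithLp.toLp 2 S.y)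
  refine h2.congr_deriv ?_
  simp [limitOutput]

theorem continuous_limitOutput (w : FirstLayer d N₁) : Continuous (S.limitOutput w) :=
  continuous_iff_continuousAt.2 fun t => (S.hasDerivAt_limitOutput w t).continuousAt

/-- The evolution equation of `h`. -/
theorem limitOutput_eq (w : FirstLayer d N₁) (t : ℝ) (i : Fin M) :
    S.limitOutput w t i = ∫ s in (0 : ℝ)..t,
      (M : ℝ)⁻¹ * ∑ m, (S.y m - S.limitOutput w s m) * S.A w (S.x i) (S.x m) := by
  have hd : ∀ s, HasDerivAt (fun r => S.limitOutput w r i)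
      ((M : ℝ)⁻¹ * ∑ m, (S.y m - S.limitOutput w s m) * S.A w (S.x i) (S.x m)) s := by
    intro s
    have h := (EuclideanSpace.proj (𝕜 := ℝ) i).hasFDerivAt.comp_hasDerivAt s
      (S.hasDerivAt_limitOutput w s)
    refine h.congr_deriv ?_
    change S.dataOp w (WithLp.toLp 2 S.y - S.limitOutput w s) i = _
    rw [dataOp_apply]
    simp
  have hc := S.continuous_limitOutput w
  have hi : Continuous fun s =>
      (M : ℝ)⁻¹ * ∑ m, (S.y m - S.limitOutput w s m) * S.A w (S.x i) (S.x m) := by fun_prop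
  rw [intervalIntegral.integral_eq_sub_of_hasDerivAt (fun s _ => hd s) (hi.intervalIntegrable _ _)]
  simp [limitOutput]

/-- The evolution equation of `h` has only one continuous solution. -/
theorem limitOutput_unique (w : FirstLayer d N₁) (T : ℝ) (v : ℝ → EuclideanSpace ℝ (Fin M))
    (hv : Continuous v)
    (h : ∀ t ∈ Icc 0 T, ∀ i, v t i = ∫ s in (0 : ℝ)..t,
      (M : ℝ)⁻¹ * ∑ m, (S.y m - v s m) * S.A w (S.x i) (S.x m)) :
    ∀ t ∈ Icc 0 T, v t = S.limitOutput w t := by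
  set R : ℝ → EuclideanSpace ℝ (Fin M) :=
    fun t => ∫ s in (0 : ℝ)..t, S.dataOp w (WithLp.toLp 2 S.y - v s) with hR
  have hc : Continuous fun s => S.dataOp w (WithLp.toLp 2 S.y - v s) := by fun_prop
  have hd : ∀ t, HasDerivAt R (S.dataOp w (WithLp.toLp 2 S.y - v t)) t := fun t =>
    intervalIntegral.integral_hasDerivAt_right (hc.intervalIntegrable _ _)
      (hc.stronglyMeasurableAtFilter _ _) hc.continuousAt
  have hvR : ∀ t ∈ Icc 0 T, v t = R t := by
    intro t ht
    ext i
    rw [h t ht i]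
    have := (EuclideanSpace.proj (𝕜 := ℝ) i).intervalIntegral_comp_comm
      (hc.intervalIntegrable (μ := volume) 0 t)
    refine Eq.trans ?_ this
    refine intervalIntegral.integral_congr fun s _ => ?_
    change _ = S.dataOp w (WithLp.toLp 2 S.y - v s) i
    rw [dataOp_apply]
    simp
  have key : EqOn R (S.limitOutput w) (Icc 0 T) := by
    refine ODE_solution_unique (v := fun _ u => S.dataOp w (WithLp.toLp 2 S.y - u))
      (K := ‖S.dataOp w‖₊) (fun t => ?_)
      (fun t _ => (hd t).continuousAt.continuousWithinAt) (fun t ht => ?_)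
      (S.continuous_limitOutput w).continuousOn
      (fun t _ => (S.hasDerivAt_limitOutput w t).hasDerivWithinAt) ?_
    · refine LipschitzWith.of_dist_le_mul fun a b => ?_
      rw [dist_eq_norm, dist_eq_norm, ← map_sub, sub_sub_sub_cancel_left, norm_sub_rev a b]
      exact (S.dataOp w).le_opNorm _
    · rw [← hvR t (Ico_subset_Icc_self ht)]
      exact (hd t).hasDerivWithinAt
    · simp [hR, limitOutput]
  exact fun t ht => (hvR t ht).trans (key ht)

/-- The fluctuation path `K_t = N₂^φ (h^{N₁,N₂}_t - h_t)`, `0 ≤ t ≤ T`, on the data set, where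
`h^{N₁,N₂}_t` is the output after `⌊N₂ t⌋` steps. -/
def fluctuation (T φ : ℝ) (N₂ : ℕ) (w : FirstLayer d N₁) (c : ℕ → ℝ) (w2 : ℕ → Fin N₁ → ℝ)
    (z : ℕ → EuclideanSpace ℝ (Fin d) × ℝ) : SkorokhodSpace T (EuclideanSpace ℝ (Fin M)) where
  toFun t := (N₂ : ℝ) ^ φ •
    (S.outputs N₂ w c w2 z ⌊(N₂ : ℝ) * (t : ℝ)⌋₊ - S.limitOutput w t)
  right_cont t := by
    have h1 : ContinuousWithinAt (fun s : Icc (0 : ℝ) T =>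
        S.outputs N₂ w c w2 z ⌊(N₂ : ℝ) * (s : ℝ)⌋₊) (Ici t) t :=
      tendsto_const_nhds.congr'
        ((floor_eventually_right T N₂ t).mono fun s hs => by simp only [hs])
    have h2 : ContinuousWithinAt (fun s : Icc (0 : ℝ) T => S.limitOutput w s) (Ici t) t :=
      ((S.continuous_limitOutput w).comp continuous_subtype_val).continuousWithinAt
    exact (h1.sub h2).const_smul ((N₂ : ℝ) ^ φ)
  left_lim t := by
    obtain ⟨n, hn⟩ := floor_eventually_left T N₂ t
    refine ⟨(N₂ : ℝ) ^ φ • (S.outputs N₂ w c w2 z n - S.limitOutput w t), ?_⟩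
    have h1 : Tendsto (fun s : Icc (0 : ℝ) T =>
        S.outputs N₂ w c w2 z ⌊(N₂ : ℝ) * (s : ℝ)⌋₊) (𝓝[<] t) (𝓝 (S.outputs N₂ w c w2 z n)) :=
      tendsto_const_nhds.congr' (hn.mono fun s hs => by simp only [hs])
    exact (h1.sub (((S.continuous_limitOutput w).comp continuous_subtype_val).tendsto t |>.mono_left
      nhdsWithin_le_nhds)).const_smul _

/-- The function `C^f_{x'}`. The partial derivative in `c` and those in `w^{2,j}`, and the
directional derivative `∇_{w^{1,j}} f · x'`, are values of the Fréchet derivative of `f`. -/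
def Cfun (w : FirstLayer d N₁) (f : Particle d N₁ → ℝ) (x' : EuclideanSpace ℝ (Fin d))
    (θ : Particle d N₁) : ℝ :=
  fderiv ℝ f θ (1, 0, 0) * S.σ (S.Z θ x') +
  1 / (N₁ : ℝ) ^ (1 - S.γ₁) * ∑ j,
    θ.1 * deriv S.σ (S.Z θ x') * S.σ (inner ℝ (θ.2.2 j) x') *
      fderiv ℝ f θ (0, Pi.single j 1, 0) +
  1 / (N₁ : ℝ) ^ (1 - S.γ₁) * ∑ j,
    (∫ θ', θ'.1 * deriv S.σ (S.Z θ' x') * deriv S.σ (inner ℝ (θ'.2.2 j) x') * θ'.2.1 j ∂S.γ₀ w) *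
      fderiv ℝ f θ (0, 0, Pi.single j x')

/-- The limit `l_t(f) = ∫₀ᵗ ∫ (y - h_s(x')) ⟨C^f_{x'}, γ₀⟩ π(dx',dy) ds`. -/
def l (w : FirstLayer d N₁) (t : ℝ) (f : Particle d N₁ → ℝ) : ℝ :=
  ∫ s in (0 : ℝ)..t, (M : ℝ)⁻¹ * ∑ m, (S.y m - S.limitOutput w s m) *
    ∫ θ, S.Cfun w f (S.x m) θ ∂S.γ₀ w

/-- The time integrand, at time `s` and at the data point `x i`, of the forcing terms that contain
`l`; integrals against `π` are averages over the data set. -/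
def forcing (w : FirstLayer d N₁) (s : ℝ) (i : Fin M) : ℝ :=
  (M : ℝ)⁻¹ * (∑ m, (S.y m - S.limitOutput w s m) *
    (S.l w s (S.B1 (S.x i) (S.x m)) + 1 / (N₁ : ℝ) * ∑ j, S.l w s (S.B2 j (S.x i) (S.x m)))) +
  1 / (N₁ : ℝ) * (∑ j, (M : ℝ)⁻¹ * ∑ m, (S.y m - S.limitOutput w s m) * inner ℝ (S.x i) (S.x m) *
    S.l w s (S.B3 j (S.x i)) * ∫ θ, S.B3 j (S.x m) θ ∂S.γ₀ w) +
  1 / (N₁ : ℝ) * (∑ j, (M : ℝ)⁻¹ * ∑ m, (S.y m - S.limitOutput w s m) * inner ℝ (S.x i) (S.x m) *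
    (∫ θ, S.B3 j (S.x i) θ ∂S.γ₀ w) * S.l w s (S.B3 j (S.x m)))

/-- The path `K` solves on `[0,T]`, at every data point `x i`, the linear integral equation
`K_t(x) = k₀(x) + ∫₀ᵗ F_s(x) ds - ∫₀ᵗ ∫ K_s(x') A_{x,x'} π(dx',dy) ds`. -/
def SolvesLinear {T : ℝ} (hT : 0 ≤ T) (w : FirstLayer d N₁) (F : ℝ → Fin M → ℝ)
    (k₀ : EuclideanSpace ℝ (Fin M)) (K : SkorokhodSpace T (EuclideanSpace ℝ (Fin M))) : Prop :=
  ∀ (t : Icc (0 : ℝ) T) (i : Fin M),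
    K t i = k₀ i + (∫ s in (0 : ℝ)..t, F s i) -
      ∫ s in (0 : ℝ)..t, (M : ℝ)⁻¹ * ∑ m, IccExtend hT K s m * S.A w (S.x i) (S.x m)

end Setting

end

/-! Fix the first layer `w` and write N for the width of the second layer, q = N^(γ₂-1). In the form
of `particle_sgdStep`, one gradient step moves every particle by q/N times the residual times a
bounded direction, while by `network_eq_mean` the output is q⁻¹ times an empirical mean over
particles. So during the NT steps particles move by O(q), outputs move by O(1), and empirical means
of smooth functions change by O(q).

The outer weight is centred and independent of the other weights, hence ⟨B³,γ₀⟩ = 0 (`integral_B3`).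
The first layer moves with coefficients that are empirical means of B³, and this motion acts on the
output through further empirical means of B³. Its effect is therefore quadratic in a small quantity
and disappears in the limit; in the limiting equations all terms with B³ vanish too. There remain
the kernel `kern`, whose mean is A (`A_eq`), and its derivative along the motion of c and w²
(`transport`), whose time integral is `kernRate`.

Taylor expansion makes an output increment equal to N⁻¹ times the residual times the empirical mean
of `kern`, and that mean equals A + q `kernRate` up to small errors (`exists_mean_kern_sub_le`).
This says that the outputs follow `prediction`, namely h plus the solution of the limiting linear
equation started at the actual initial output and forced with strength q. Random samples are
replaced by their average through summation by parts, since the residuals vary by O(1/N) per step. A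
discrete Gronwall argument (`exists_deviation_le`) bounds the distance to the prediction by a
multiple of ε(p + q) with p = N^(-1/4). Up to here the argument is deterministic, for runs
satisfying `GoodRun`; Hoeffding's inequality and a union bound show that for each fixed ε such runs
have probability tending to one.

The constraints φ ≤ γ₂ - 1/2 and φ ≤ 1 - γ₂ add up to φ ≤ 1/4, so N^φ ε(p + q) is O(ε). By linearity
the rescaled prediction error is `limitTrajectory` evaluated at the initial value N^φ g₀ and the
forcing strength N^(φ+γ₂-1). The initial value is N^(φ+1/2-γ₂) times a normalised sum of i.i.d.
vectors, to which the central limit theorem applies; the two powers of N tend to 0 or 1, and this is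
the case distinction of the theorem. Since `limitTrajectory` is continuous into the Skorokhod space,
Slutsky's theorem gives the limit for fixed `w`, and dominated convergence integrates it over the
law of the first layer. -/

noncomputable section

/-! ### One gradient step in terms of particles, and the tangent kernel -/

/-- The empirical average of `f` over the particles of a network. -/
def Params.mean {d N₁ N₂ : ℕ} (p : Params d N₁ N₂) (f : Particle d N₁ → ℝ) : ℝ :=
  (N₂ : ℝ)⁻¹ * ∑ i, f (p.particle i)

namespace Setting

variable {d M N₁ : ℕ} (S : Setting d M N₁)

/-- The contribution `c σ(Z(x))` of one particle to the output of the network. -/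
def unit (x : EuclideanSpace ℝ (Fin d)) (θ : Particle d N₁) : ℝ := θ.1 * S.σ (S.Z θ x)

/-- The kernel `B¹ + N₁⁻¹ ∑ⱼ B^{2,j}`. -/
def kern (x x' : EuclideanSpace ℝ (Fin d)) (θ : Particle d N₁) : ℝ :=
  S.B1 x x' θ + 1 / (N₁ : ℝ) * ∑ j, S.B2 j x x' θ

/-- The direction in which the weights `c` and `w²` of a particle move at a sample `x'`. -/
def drift (x' : EuclideanSpace ℝ (Fin d)) (θ : Particle d N₁) : Particle d N₁ :=
  (S.σ (S.Z θ x'),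
    (1 / (N₁ : ℝ) ^ (1 - S.γ₁)) •
      fun j => θ.1 * deriv S.σ (S.Z θ x') * S.σ (inner ℝ (θ.2.2 j) x'),
    0)

/-- The derivative of `f` along `drift`. -/
def transport (f : Particle d N₁ → ℝ) (x' : EuclideanSpace ℝ (Fin d)) (θ : Particle d N₁) : ℝ :=
  fderiv ℝ f θ (S.drift x' θ)

/-- The direction in which the first layer moves at a sample `x'`, with coefficients `ρ`. -/
def shift (ρ : Fin N₁ → ℝ) (x' : EuclideanSpace ℝ (Fin d)) : Particle d N₁ :=
  (0, 0, fun j => (1 / (N₁ : ℝ) ^ (1 - S.γ₁) * ρ j) • x')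

theorem contDiff_deriv_σ (hσ : ContDiff ℝ (⊤ : ℕ∞) S.σ) : ContDiff ℝ (⊤ : ℕ∞) (deriv S.σ) :=
  (contDiff_infty_iff_deriv.1 hσ).2

theorem contDiff_inner_firstLayer (j : Fin N₁) (x : EuclideanSpace ℝ (Fin d)) :
    ContDiff ℝ (⊤ : ℕ∞) fun θ : Particle d N₁ => (inner ℝ (θ.2.2 j) x : ℝ) :=
  ContDiff.inner ℝ (by fun_prop) contDiff_const

theorem contDiff_Z (hσ : ContDiff ℝ (⊤ : ℕ∞) S.σ)
    (x : EuclideanSpace ℝ (Fin d)) :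
    ContDiff ℝ (⊤ : ℕ∞) fun θ : Particle d N₁ => S.Z θ x := by
  have := fun j => contDiff_inner_firstLayer (N₁ := N₁) j x
  unfold Z
  fun_prop

theorem contDiff_unit (hσ : ContDiff ℝ (⊤ : ℕ∞) S.σ)
    (x : EuclideanSpace ℝ (Fin d)) : ContDiff ℝ (⊤ : ℕ∞) (S.unit x) := by
  have := S.contDiff_Z hσ x
  unfold unit
  fun_prop

theorem contDiff_B1 (hσ : ContDiff ℝ (⊤ : ℕ∞) S.σ)
    (x x' : EuclideanSpace ℝ (Fin d)) : ContDiff ℝ (⊤ : ℕ∞) (S.B1 x x') := by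
  have := S.contDiff_Z hσ x
  have := S.contDiff_Z hσ x'
  unfold B1
  fun_prop

theorem contDiff_B2 (hσ : ContDiff ℝ (⊤ : ℕ∞) S.σ)
    (j : Fin N₁) (x x' : EuclideanSpace ℝ (Fin d)) :
    ContDiff ℝ (⊤ : ℕ∞) (S.B2 j x x') := by
  have := S.contDiff_Z hσ x
  have := S.contDiff_Z hσ x'
  have := S.contDiff_deriv_σ hσ
  have := contDiff_inner_firstLayer j x
  have := contDiff_inner_firstLayer j x'
  unfold B2
  fun_prop

theorem contDiff_B3 (hσ : ContDiff ℝ (⊤ : ℕ∞) S.σ)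
    (j : Fin N₁) (x : EuclideanSpace ℝ (Fin d)) :
    ContDiff ℝ (⊤ : ℕ∞) (S.B3 j x) := by
  have := S.contDiff_Z hσ x
  have := S.contDiff_deriv_σ hσ
  have := contDiff_inner_firstLayer j x
  unfold B3
  fun_prop

theorem contDiff_kern (hσ : ContDiff ℝ (⊤ : ℕ∞) S.σ)
    (x x' : EuclideanSpace ℝ (Fin d)) : ContDiff ℝ (⊤ : ℕ∞) (S.kern x x') := by
  have := S.contDiff_B1 hσ x x'
  have := fun j => S.contDiff_B2 hσ j x x'
  unfold kern
  fun_prop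

theorem contDiff_drift (hσ : ContDiff ℝ (⊤ : ℕ∞) S.σ)
    (x : EuclideanSpace ℝ (Fin d)) : ContDiff ℝ (⊤ : ℕ∞) (S.drift x) := by
  have := S.contDiff_Z hσ x
  have := S.contDiff_deriv_σ hσ
  unfold drift
  refine ContDiff.prodMk (by fun_prop) (ContDiff.prodMk ?_ contDiff_const)
  refine ContDiff.const_smul _ ?_
  rw [contDiff_pi]
  intro j
  have := contDiff_inner_firstLayer j x
  fun_prop

theorem contDiff_transport (hσ : ContDiff ℝ (⊤ : ℕ∞) S.σ)
    {f : Particle d N₁ → ℝ} (hf : ContDiff ℝ (⊤ : ℕ∞) f)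
    (x : EuclideanSpace ℝ (Fin d)) : ContDiff ℝ (⊤ : ℕ∞) (S.transport f x) := by
  unfold transport
  exact (hf.fderiv_right (m := (⊤ : ℕ∞)) le_rfl).clm_apply (S.contDiff_drift hσ x)

/-- Restricting to the line t ↦ θ + t v turns the derivative into the product and chain rules in one
variable. -/
theorem fderiv_unit (hσ : ContDiff ℝ (⊤ : ℕ∞) S.σ)
    (x : EuclideanSpace ℝ (Fin d)) (θ v : Particle d N₁) :
    fderiv ℝ (S.unit x) θ v = v.1 * S.σ (S.Z θ x) + θ.1 * (deriv S.σ (S.Z θ x) *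
      (1 / (N₁ : ℝ) ^ S.γ₁ * ∑ j, (v.2.1 j * S.σ (inner ℝ (θ.2.2 j) x) +
        θ.2.1 j * (deriv S.σ (inner ℝ (θ.2.2 j) x) * inner ℝ (v.2.2 j) x)))) := by
  have hd : Differentiable ℝ (S.unit x) := (S.contDiff_unit hσ x).differentiable (by simp)
  have hl : HasDerivAt (fun t : ℝ => θ + t • v) v 0 := by
    simpa using ((hasDerivAt_id (0 : ℝ)).smul_const v).const_add θ
  have h1 := HasFDerivAt.comp_hasDerivAt_of_eq (0 : ℝ) (hd θ).hasFDerivAt hl (by simp)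
  refine h1.unique ?_
  have hσd : ∀ u, HasDerivAt S.σ (deriv S.σ u) u := fun u =>
    ((hσ.differentiable (by simp)) u).hasDerivAt
  have hin : ∀ j, HasDerivAt (fun t : ℝ => (inner ℝ ((θ + t • v).2.2 j) x : ℝ))
      (inner ℝ (v.2.2 j) x) 0 := by
    intro j
    have : (fun t : ℝ => (inner ℝ ((θ + t • v).2.2 j) x : ℝ)) =
        fun t => inner ℝ (θ.2.2 j) x + t * inner ℝ (v.2.2 j) x := by
      ext t; simp [inner_add_left, inner_smul_left]
    rw [this]
    simpa using ((hasDerivAt_id (0 : ℝ)).mul_const (inner ℝ (v.2.2 j) x)).const_add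
      (inner ℝ (θ.2.2 j) x)
  have hc : HasDerivAt (fun t : ℝ => (θ + t • v).1) v.1 0 := by
    simpa using ((hasDerivAt_id (0 : ℝ)).mul_const v.1).const_add θ.1
  have hw : ∀ j, HasDerivAt (fun t : ℝ => (θ + t • v).2.1 j) (v.2.1 j) 0 := by
    intro j
    simpa using ((hasDerivAt_id (0 : ℝ)).mul_const (v.2.1 j)).const_add (θ.2.1 j)
  have hZ : HasDerivAt (fun t : ℝ => S.Z (θ + t • v) x)
      (1 / (N₁ : ℝ) ^ S.γ₁ * ∑ j, (v.2.1 j * S.σ (inner ℝ (θ.2.2 j) x) +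
        θ.2.1 j * (deriv S.σ (inner ℝ (θ.2.2 j) x) * inner ℝ (v.2.2 j) x))) 0 := by
    unfold Z
    refine HasDerivAt.const_mul _ (HasDerivAt.fun_sum fun j _ => ?_)
    have h2 := (hw j).fun_mul ((hσd _).comp_of_eq (0 : ℝ) (hin j) rfl)
    simpa using h2
  have h3 := hc.fun_mul ((hσd _).comp_of_eq (0 : ℝ) hZ rfl)
  simpa [unit, Function.comp_def] using h3

/-- Moving c produces B¹ and moving w² produces the B^{2,j}; the powers N₁^(-γ₁) and N₁^(-(1-γ₁))
multiply to 1/N₁. This is where the kernel of the limiting dynamics comes from. -/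
theorem fderiv_unit_drift (hσ : ContDiff ℝ (⊤ : ℕ∞) S.σ)
    (hN₁ : 0 < N₁) (x x' : EuclideanSpace ℝ (Fin d)) (θ : Particle d N₁) :
    fderiv ℝ (S.unit x) θ (S.drift x' θ) = S.kern x x' θ := by
  have hN : (0 : ℝ) < N₁ := by exact_mod_cast hN₁
  have e : (1 : ℝ) / N₁ = 1 / (N₁ : ℝ) ^ S.γ₁ * (1 / (N₁ : ℝ) ^ (1 - S.γ₁)) := by
    rw [one_div_mul_one_div, ← Real.rpow_add hN]; simp
  rw [S.fderiv_unit hσ, kern, e, drift, B1]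
  simp only [Pi.smul_apply, smul_eq_mul, Pi.zero_apply, inner_zero_left, mul_zero, add_zero, B2]
  rw [← mul_assoc, ← mul_assoc, Finset.mul_sum, Finset.mul_sum]
  congr 1
  exact Finset.sum_congr rfl fun j _ => by ring

/-- A displacement of w¹ acts on the output through B³. When the coefficients ρ are themselves
empirical means of B³, averaging over the particles makes the effect quadratic in these means. -/
theorem fderiv_unit_shift (hσ : ContDiff ℝ (⊤ : ℕ∞) S.σ)
    (hN₁ : 0 < N₁) (x x' : EuclideanSpace ℝ (Fin d)) (θ : Particle d N₁)
    (ρ : Fin N₁ → ℝ) :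
    fderiv ℝ (S.unit x) θ (S.shift ρ x') =
      1 / (N₁ : ℝ) * inner ℝ x' x * ∑ j, ρ j * S.B3 j x θ := by
  have hN : (0 : ℝ) < N₁ := by exact_mod_cast hN₁
  have e : (1 : ℝ) / N₁ = 1 / (N₁ : ℝ) ^ S.γ₁ * (1 / (N₁ : ℝ) ^ (1 - S.γ₁)) := by
    rw [one_div_mul_one_div, ← Real.rpow_add hN]; simp
  rw [S.fderiv_unit hσ, e, shift]
  simp only [Pi.zero_apply, zero_mul, zero_add, inner_smul_left, B3]
  rw [← mul_assoc, ← mul_assoc, Finset.mul_sum, Finset.mul_sum]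
  exact Finset.sum_congr rfl fun j _ => by simp; ring

/-- The prefactor is q⁻¹ with q = N₂^(γ₂-1); it compensates the displacements of order q of the
particles. -/
theorem network_eq_mean {N₂ : ℕ} (hN : 0 < N₂) (p : Params d N₁ N₂)
    (x : EuclideanSpace ℝ (Fin d)) :
    S.network p x = ((N₂ : ℝ) ^ (S.γ₂ - 1))⁻¹ * p.mean (S.unit x) := by
  have hN : (0 : ℝ) < N₂ := by exact_mod_cast hN
  rw [network, Params.mean, ← mul_assoc]
  congr 1
  rw [one_div, ← mul_inv, Real.rpow_sub hN, Real.rpow_one]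
  field_simp

/-- The three learning rates are tuned so that all layers move with the same prefactor q/N₂, and the
powers of N₁ that remain are those built into `drift` and `shift`. -/
theorem particle_sgdStep {N₂ : ℕ} (hN₁ : 0 < N₁) (hN : 0 < N₂) (p : Params d N₁ N₂)
    (z : EuclideanSpace ℝ (Fin d) × ℝ) (i : Fin N₂) :
    (S.sgdStep p z).particle i = p.particle i +
      ((N₂ : ℝ) ^ (S.γ₂ - 1) / N₂ * (z.2 - S.network p z.1)) •
        (S.drift z.1 (p.particle i) + S.shift (fun j => p.mean (S.B3 j z.1)) z.1) := by
  have hN : (0 : ℝ) < N₂ := by exact_mod_cast hN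
  have hN₁ : (0 : ℝ) < N₁ := by exact_mod_cast hN₁
  have e1 : rateC S.γ₂ N₂ / (N₂ : ℝ) ^ S.γ₂ = (N₂ : ℝ) ^ (S.γ₂ - 1) / N₂ := by
    rw [rateC, div_div, ← Real.rpow_add hN, one_div, ← Real.rpow_neg hN.le,
      show -(2 - 2 * S.γ₂ + S.γ₂) = S.γ₂ - 1 - 1 by ring, Real.rpow_sub hN _ 1, Real.rpow_one]
  have e0 : (1 : ℝ) / ((N₁ : ℝ) ^ (1 - 2 * S.γ₁) * (N₁ : ℝ) ^ S.γ₁) =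
      1 / (N₁ : ℝ) ^ (1 - S.γ₁) := by
    rw [← Real.rpow_add hN₁]; ring_nf
  have e2 : rateW2 S.γ₁ S.γ₂ N₁ N₂ / ((N₁ : ℝ) ^ S.γ₁ * (N₂ : ℝ) ^ S.γ₂) =
      (N₂ : ℝ) ^ (S.γ₂ - 1) / N₂ * (1 / (N₁ : ℝ) ^ (1 - S.γ₁)) := by
    rw [← e1, ← e0, rateW2, rateC]
    field_simp
  -- The exponent 3 - 2γ₂ exceeds that of the other rates by one; the additional 1/N₂ turns the
  -- backpropagated sum over units into an empirical mean.
  have e3 : rateW1 S.γ₁ S.γ₂ N₁ N₂ / (N₁ : ℝ) ^ S.γ₁ * (1 / (N₂ : ℝ) ^ S.γ₂) =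
      (N₂ : ℝ) ^ (S.γ₂ - 1) / N₂ * (1 / (N₁ : ℝ) ^ (1 - S.γ₁)) * (N₂ : ℝ)⁻¹ := by
    rw [← e1, ← e0, rateW1, rateC]
    rw [show (3 : ℝ) - 2 * S.γ₂ = 1 + (2 - 2 * S.γ₂) by ring, Real.rpow_add hN, Real.rpow_one]
    field_simp
  refine Prod.ext ?_ (Prod.ext ?_ ?_)
  · simp [Params.particle, sgdStep, drift, shift, e1]
  · ext j
    simp only [Params.particle, sgdStep, drift, shift, e2, Prod.snd_add, Prod.smul_snd,
      Prod.fst_add, Prod.smul_fst, Pi.add_apply, Pi.smul_apply, smul_eq_mul, add_zero]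
    ring
  · funext j
    simp only [Params.particle, sgdStep, drift, shift, Prod.snd_add, Prod.smul_snd, Pi.add_apply,
      Pi.smul_apply, zero_add, smul_smul]
    congr 2
    have : p.mean (S.B3 j z.1) = (N₂ : ℝ)⁻¹ * ((∑ i, p.C i * deriv S.σ (S.Z (p.particle i) z.1) *
        p.W2 i j) * deriv S.σ (inner ℝ (p.W1 j) z.1)) := by
      rw [Params.mean, Finset.sum_mul]
      congr 1
      exact Finset.sum_congr rfl fun i _ => by simp only [B3, Params.particle]; ring
    rw [this]
    calc _ = rateW1 S.γ₁ S.γ₂ N₁ N₂ / (N₁ : ℝ) ^ S.γ₁ * (1 / (N₂ : ℝ) ^ S.γ₂) *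
          (z.2 - S.network p z.1) * ((∑ i, p.C i * deriv S.σ (S.Z (p.particle i) z.1) *
        p.W2 i j) * deriv S.σ (inner ℝ (p.W1 j) z.1)) := by simp only [Params.particle]; ring
      _ = _ := by rw [e3]; simp only [Params.particle]; ring

end Setting
end

/-! ### The limiting objects: cancellations, continuity in the first layer, variation of constants
-/

noncomputable section
namespace Setting

variable {d M N₁ : ℕ} (S : Setting d M N₁)

/-- The standing assumptions on the activation function, the exponent and the initial laws. -/
structure Regular : Prop where
  pos : 0 < N₁
  γ₂_mem : S.γ₂ ∈ Ioo (1 / 2 : ℝ) 1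
  smooth : ContDiff ℝ (⊤ : ℕ∞) S.σ
  C_bdd : ∃ r, ∀ᵐ c ∂S.μC, |c| ≤ r
  W_bdd : ∃ r, ∀ᵐ v ∂S.μW, |v| ≤ r
  C_mean : ∫ c, c ∂S.μC = 0

/-- The law of the initial weights `(c, w²)` of one particle. -/
def weightLaw : Measure (ℝ × (Fin N₁ → ℝ)) := S.μC.prod (Measure.pi fun _ => S.μW)

instance [IsProbabilityMeasure S.μC] [IsProbabilityMeasure S.μW] :
    IsProbabilityMeasure S.weightLaw := by unfold weightLaw; infer_instance

/-- The particle with weights `p = (c, w²)` and first layer `w`. -/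
def mkParticle (w : FirstLayer d N₁) (p : ℝ × (Fin N₁ → ℝ)) : Particle d N₁ := (p.1, p.2, w)

theorem continuous_mkParticle :
    Continuous fun q : FirstLayer d N₁ × (ℝ × (Fin N₁ → ℝ)) => mkParticle q.1 q.2 := by
  unfold mkParticle; fun_prop

/-- Pulling integrals back to `weightLaw`, which does not involve `w`, moves the dependence on the
first layer into the integrand. -/
theorem γ₀_eq_map [IsProbabilityMeasure S.μC] [IsProbabilityMeasure S.μW] (w : FirstLayer d N₁) :
    S.γ₀ w = S.weightLaw.map (mkParticle w) := by
  rw [γ₀, weightLaw, Measure.prod_dirac]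
  nth_rewrite 1 [← Measure.map_id (μ := S.μC)]
  rw [Measure.map_prod_map _ _ measurable_id (by fun_prop)]
  rfl

theorem ae_weightLaw_bdd {S : Setting d M N₁} [IsProbabilityMeasure S.μC] [IsProbabilityMeasure S.μW]
    (hS : S.Regular) : ∃ r, ∀ᵐ p ∂S.weightLaw, ‖p‖ ≤ r := by
  obtain ⟨r, hr⟩ := hS.C_bdd
  obtain ⟨r', hr'⟩ := hS.W_bdd
  refine ⟨max r (max r' 0), ?_⟩
  have h1 : ∀ᵐ p ∂S.weightLaw, |p.1| ≤ r := Measure.quasiMeasurePreserving_fst.ae hr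
  have h2 : ∀ᵐ p ∂S.weightLaw, ∀ j, |p.2 j| ≤ r' := by
    rw [ae_all_iff]
    intro j
    have : ∀ᵐ v ∂(Measure.pi fun _ : Fin N₁ => S.μW), |v j| ≤ r' :=
      (Measure.quasiMeasurePreserving_eval (μ := fun _ : Fin N₁ => S.μW) j).ae hr'
    exact Measure.quasiMeasurePreserving_snd.ae this
  filter_upwards [h1, h2] with p hp1 hp2
  rw [Prod.norm_def]
  refine max_le_max hp1 ((pi_norm_le_iff_of_nonneg (le_max_right _ _)).2 fun j => ?_)
  exact (hp2 j).trans (le_max_left _ _)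

theorem drift_eq (x' : EuclideanSpace ℝ (Fin d)) (θ : Particle d N₁) :
    S.drift x' θ = S.σ (S.Z θ x') • ((1, 0, 0) : Particle d N₁) +
      (1 / (N₁ : ℝ) ^ (1 - S.γ₁)) • ∑ j, (θ.1 * deriv S.σ (S.Z θ x') *
        S.σ (inner ℝ (θ.2.2 j) x')) • ((0, Pi.single j 1, 0) : Particle d N₁) := by
  refine Prod.ext ?_ (Prod.ext ?_ ?_)
  · simp [drift, Prod.fst_sum]
  · ext k
    simp [drift, Prod.fst_sum, Prod.snd_sum, Finset.sum_apply, Pi.single_apply]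
  · simp [drift, Prod.snd_sum]

/-- The propagator `exp(-t A/M)` of the limiting dynamics. -/
def propagator (w : FirstLayer d N₁) (t : ℝ) :
    EuclideanSpace ℝ (Fin M) →L[ℝ] EuclideanSpace ℝ (Fin M) :=
  NormedSpace.exp (t • -S.dataOp w)

theorem hasDerivAt_propagator (w : FirstLayer d N₁) (t : ℝ) :
    HasDerivAt (S.propagator w) (-S.dataOp w * S.propagator w t) t :=
  hasDerivAt_exp_smul_const' (𝕂 := ℝ) (-S.dataOp w) t

theorem propagator_zero (w : FirstLayer d N₁) : S.propagator w 0 = 1 := by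
  simp [propagator]

/-- Multiples of one operator commute, so their exponentials multiply by adding the exponents. -/
theorem propagator_apply_neg (w : FirstLayer d N₁) (t : ℝ) (v : EuclideanSpace ℝ (Fin M)) :
    S.propagator w t (S.propagator w (-t) v) = v := by
  let : NormedAlgebra ℚ (EuclideanSpace ℝ (Fin M) →L[ℝ] EuclideanSpace ℝ (Fin M)) :=
    NormedAlgebra.restrictScalars ℚ ℝ _
  have h : S.propagator w t * S.propagator w (-t) = 1 := by
    rw [propagator, propagator, ← NormedSpace.exp_add_of_commute]
    · simp
    · refine ContinuousLinearMap.ext fun u => ?_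
      simp only [mul_apply_eq_comp, _root_.smul_apply, map_smul]
      rw [smul_comm]
  exact congrArg (fun L : EuclideanSpace ℝ (Fin M) →L[ℝ] EuclideanSpace ℝ (Fin M) => L v) h

theorem limitOutput_eq_propagator (w : FirstLayer d N₁) (t : ℝ) :
    S.limitOutput w t = WithLp.toLp 2 S.y - S.propagator w t (WithLp.toLp 2 S.y) := rfl

/-- The integral `∫₀ᵗ exp(s A/M) F_s ds`. -/
def forcingIntegral (w : FirstLayer d N₁) (t : ℝ) :
    EuclideanSpace ℝ (Fin M) :=
  ∫ s in (0 : ℝ)..t, S.propagator w (-s) (WithLp.toLp 2 (S.forcing w s))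

/-- The solution `K` of the limiting equation with initial value `k₀` and forcing `b F`. -/
def limitPath (w : FirstLayer d N₁) (k₀ : EuclideanSpace ℝ (Fin M)) (b t : ℝ) :
    EuclideanSpace ℝ (Fin M) :=
  S.propagator w t (k₀ + b • S.forcingIntegral w t)

theorem limitPath_zero (w : FirstLayer d N₁) (k₀ : EuclideanSpace ℝ (Fin M)) (b : ℝ) :
    S.limitPath w k₀ b 0 = k₀ := by
  simp [limitPath, forcingIntegral, propagator_zero]

section

variable {S} [IsProbabilityMeasure S.μC] [IsProbabilityMeasure S.μW]

theorem integral_γ₀ (w : FirstLayer d N₁) {f : Particle d N₁ → ℝ} (hf : Continuous f) :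
    ∫ θ, f θ ∂S.γ₀ w = ∫ p, f (mkParticle w p) ∂S.weightLaw := by
  rw [γ₀_eq_map, integral_map _ hf.aestronglyMeasurable]
  exact (continuous_mkParticle.comp (Continuous.prodMk_right w)).aemeasurable

theorem exists_bound_mkParticle (hS : S.Regular) {f : Particle d N₁ → ℝ} (hf : Continuous f)
    (R : ℝ) :
    ∃ B, ∀ᵐ p ∂S.weightLaw, ∀ w : FirstLayer d N₁, ‖w‖ ≤ R → ‖f (mkParticle w p)‖ ≤ B := by
  obtain ⟨r, hr⟩ := ae_weightLaw_bdd hS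
  obtain ⟨B, hB⟩ := ((isCompact_closedBall (0 : FirstLayer d N₁) R).prod
    (isCompact_closedBall (0 : ℝ × (Fin N₁ → ℝ)) r)).exists_bound_of_continuousOn
    (hf.comp continuous_mkParticle).continuousOn
  refine ⟨B, ?_⟩
  filter_upwards [hr] with p hp w hw
  exact hB (w, p) ⟨by simpa using hw, by simpa using hp⟩

theorem integrable_mkParticle (hS : S.Regular) {f : Particle d N₁ → ℝ} (hf : Continuous f)
    (w : FirstLayer d N₁) : Integrable (fun p => f (mkParticle w p)) S.weightLaw := by
  obtain ⟨B, hB⟩ := exists_bound_mkParticle hS hf ‖w‖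
  refine Integrable.of_bound (C := B)
    (hf.comp (continuous_mkParticle.comp (Continuous.prodMk_right w))).aestronglyMeasurable ?_
  filter_upwards [hB] with p hp using hp w le_rfl

theorem integrable_γ₀ (hS : S.Regular) {f : Particle d N₁ → ℝ} (hf : Continuous f)
    (w : FirstLayer d N₁) : Integrable f (S.γ₀ w) := by
  have hm : Continuous (mkParticle w) := continuous_mkParticle.comp (Continuous.prodMk_right w)
  rw [γ₀_eq_map, integrable_map_measure hf.aestronglyMeasurable hm.aemeasurable]
  exact integrable_mkParticle hS hf w

/-- Dominated convergence: the weights are almost surely bounded, so near a given first layer the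
integrand is bounded by a constant. -/
theorem continuous_integral_γ₀ (hS : S.Regular) {f : Particle d N₁ → ℝ} (hf : Continuous f) :
    Continuous fun w => ∫ θ, f θ ∂S.γ₀ w := by
  simp_rw [integral_γ₀ _ hf]
  rw [continuous_iff_continuousAt]
  intro w₀
  -- The margin 1 covers the unit ball around `w₀`, which suffices for continuity at `w₀`.
  obtain ⟨B, hB⟩ := exists_bound_mkParticle hS hf (‖w₀‖ + 1)
  refine continuousAt_of_dominated (bound := fun _ => B) (Eventually.of_forall fun w =>
    (hf.comp (continuous_mkParticle.comp (Continuous.prodMk_right w))).aestronglyMeasurable) ?_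
    (integrable_const B) (ae_of_all _ fun p =>
    (hf.comp (continuous_mkParticle.comp (Continuous.prodMk_left p))).continuousAt)
  filter_upwards [Metric.ball_mem_nhds w₀ one_pos] with w hw
  filter_upwards [hB] with p hp
  refine hp w ?_
  have := norm_le_norm_add_norm_sub w₀ w
  rw [← dist_eq_norm, dist_comm] at this
  have h2 := Metric.mem_ball.1 hw
  linarith

/-- B³ is the outer weight c times a function of the remaining weights; c is independent of these
and centred. All simplifications of the limiting equations rest on this. -/
theorem integral_B3 (hS : S.Regular) (w : FirstLayer d N₁) (j : Fin N₁)
    (x : EuclideanSpace ℝ (Fin d)) : ∫ θ, S.B3 j x θ ∂S.γ₀ w = 0 := by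
  rw [integral_γ₀ w (S.contDiff_B3 hS.smooth j x).continuous]
  have : (fun p => S.B3 j x (mkParticle w p)) = fun p : ℝ × (Fin N₁ → ℝ) =>
      p.1 * (p.2 j * deriv S.σ (inner ℝ (w j) x) * deriv S.σ (S.Z (0, p.2, w) x)) := by
    ext p; simp only [B3, mkParticle, Z]; ring
  rw [this, weightLaw, integral_prod_mul (fun c : ℝ => c)
    (fun v : Fin N₁ → ℝ => v j * deriv S.σ (inner ℝ (w j) x) * deriv S.σ (S.Z (0, v, w) x)),
    hS.C_mean, zero_mul]

/-- The products of means of B³ in the definition of A are zero. -/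
theorem A_eq (hS : S.Regular) (w : FirstLayer d N₁) (x x' : EuclideanSpace ℝ (Fin d)) :
    S.A w x x' = ∫ θ, S.kern x x' θ ∂S.γ₀ w := by
  have h2 := fun j => integrable_γ₀ hS (S.contDiff_B2 hS.smooth j x x').continuous w
  simp only [A, integral_B3 hS, kern, mul_zero, add_zero]
  rw [integral_add (integrable_γ₀ hS (S.contDiff_B1 hS.smooth x x').continuous w)
    ((integrable_finsetSum _ fun j _ => h2 j).const_mul _), integral_const_mul,
    integral_finsetSum _ fun j _ => h2 j]

/-- The coefficients of the derivatives in w¹ are means of B³, hence zero; what is left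
differentiates `f` along `drift`. -/
theorem Cfun_eq_transport (hS : S.Regular) (w : FirstLayer d N₁) (f : Particle d N₁ → ℝ)
    (x' : EuclideanSpace ℝ (Fin d)) : S.Cfun w f x' = S.transport f x' := by
  ext θ
  have h0 : ∀ j, ∫ θ', θ'.1 * deriv S.σ (S.Z θ' x') * deriv S.σ (inner ℝ (θ'.2.2 j) x') *
      θ'.2.1 j ∂S.γ₀ w = 0 := by
    intro j
    rw [← integral_B3 hS w j x']
    refine integral_congr_ae (ae_of_all _ fun θ => ?_)
    simp only [B3]; ring
  rw [transport, drift_eq, Cfun]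
  simp only [h0, zero_mul, Finset.sum_const_zero, mul_zero, add_zero, map_add, map_smul, map_sum,
    smul_eq_mul]
  ring

/-- The rate of change `l_s` of the kernel between the points `x` and `x'`. -/
def kernRate (S : Setting d M N₁) (w : FirstLayer d N₁) (s : ℝ)
    (x x' : EuclideanSpace ℝ (Fin d)) : ℝ :=
  ∫ r in (0 : ℝ)..s, (M : ℝ)⁻¹ * ∑ m', (S.y m' - S.limitOutput w r m') *
    ∫ θ, S.transport (S.kern x x') (S.x m') θ ∂S.γ₀ w

theorem integral_transport_kern (hS : S.Regular) (w : FirstLayer d N₁)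
    (x x' x'' : EuclideanSpace ℝ (Fin d)) :
    ∫ θ, S.transport (S.kern x x') x'' θ ∂S.γ₀ w =
      (∫ θ, S.transport (S.B1 x x') x'' θ ∂S.γ₀ w) +
        1 / (N₁ : ℝ) * ∑ j, ∫ θ, S.transport (S.B2 j x x') x'' θ ∂S.γ₀ w := by
  have hc1 := S.contDiff_B1 hS.smooth x x'
  have hc2 := fun j => S.contDiff_B2 hS.smooth j x x'
  have hi1 := integrable_γ₀ hS (S.contDiff_transport hS.smooth hc1 x'').continuous w
  have hi2 := fun j => integrable_γ₀ hS (S.contDiff_transport hS.smooth (hc2 j) x'').continuous w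
  rw [← integral_finsetSum _ fun j _ => hi2 j, ← integral_const_mul, ← integral_add hi1
    ((integrable_finsetSum _ fun j _ => hi2 j).const_mul _)]
  refine integral_congr_ae (ae_of_all _ fun θ => ?_)
  have hd1 := (hc1.differentiable (by simp)) θ
  have hd2 := fun j => ((hc2 j).differentiable (by simp)) θ
  have : HasFDerivAt (S.kern x x') (fderiv ℝ (S.B1 x x') θ +
      (1 / (N₁ : ℝ)) • ∑ j, fderiv ℝ (S.B2 j x x') θ) θ :=
    hd1.hasFDerivAt.add ((HasFDerivAt.fun_sum fun j _ => (hd2 j).hasFDerivAt).const_mul _)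
  simp [transport, this.fderiv]

/-- Two of the three forcing terms carry a factor ⟨B³,γ₀⟩ = 0. In the first one, the contributions
of B¹ and B^{2,j} combine by linearity into the rate of change of `kern`. -/
theorem forcing_eq (hS : S.Regular) (w : FirstLayer d N₁) (s : ℝ) (i : Fin M) :
    S.forcing w s i =
      (M : ℝ)⁻¹ * ∑ m, (S.y m - S.limitOutput w s m) * S.kernRate w s (S.x i) (S.x m) := by
  have hc := S.continuous_limitOutput w
  simp only [forcing, integral_B3 hS, mul_zero, zero_mul, Finset.sum_const_zero, add_zero]
  congr 1
  refine Finset.sum_congr rfl fun m _ => ?_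
  congr 1
  simp only [l, kernRate, Cfun_eq_transport hS, integral_transport_kern hS]
  rw [← intervalIntegral.integral_finsetSum, ← intervalIntegral.integral_const_mul,
    ← intervalIntegral.integral_add]
  · refine intervalIntegral.integral_congr fun r _ => ?_
    simp only [mul_add, Finset.sum_add_distrib, Finset.mul_sum]
    congr 1
    rw [Finset.sum_comm]
    refine Finset.sum_congr rfl fun _ _ => Finset.sum_congr rfl fun _ _ => by ring
  · exact Continuous.intervalIntegrable (by fun_prop) _ _
  · exact Continuous.intervalIntegrable (by fun_prop) _ _
  · exact fun j _ => Continuous.intervalIntegrable (by fun_prop) _ _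

theorem continuous_dataOp (hS : S.Regular) : Continuous S.dataOp := by
  have h1 : Continuous fun B : Matrix (Fin M) (Fin M) ℝ =>
      Matrix.toEuclideanCLM (n := Fin M) (𝕜 := ℝ) B :=
    LinearMap.continuous_of_finiteDimensional
      ((Matrix.toEuclideanCLM (n := Fin M) (𝕜 := ℝ)).toAlgEquiv.toLinearMap)
  have h2 : Continuous fun w => (Matrix.of fun i m => S.A w (S.x i) (S.x m) :
      Matrix (Fin M) (Fin M) ℝ) := by
    refine continuous_matrix fun i m => ?_
    simp only [Matrix.of_apply, A_eq hS]
    exact continuous_integral_γ₀ hS (S.contDiff_kern hS.smooth _ _).continuous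
  have h3 := (h1.comp h2).const_smul (M : ℝ)⁻¹
  exact h3

theorem continuous_A (hS : S.Regular) (x x' : EuclideanSpace ℝ (Fin d)) :
    Continuous fun w => S.A w x x' := by
  simp only [A_eq hS]
  exact continuous_integral_γ₀ hS (S.contDiff_kern hS.smooth _ _).continuous

theorem continuous_propagator (hS : S.Regular) :
    Continuous fun q : FirstLayer d N₁ × ℝ => S.propagator q.1 q.2 := by
  have := continuous_dataOp hS
  let : NormedAlgebra ℚ (EuclideanSpace ℝ (Fin M) →L[ℝ] EuclideanSpace ℝ (Fin M)) :=
    NormedAlgebra.restrictScalars ℚ ℝ _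
  have h1 : Continuous fun q : FirstLayer d N₁ × ℝ => q.2 • -S.dataOp q.1 := by fun_prop
  exact NormedSpace.exp_continuous.comp h1

attribute [irreducible] propagator

theorem continuous_limitOutput_uncurry (hS : S.Regular) :
    Continuous fun q : FirstLayer d N₁ × ℝ => S.limitOutput q.1 q.2 := by
  simp only [limitOutput_eq_propagator]
  exact continuous_const.sub ((continuous_propagator hS).clm_apply continuous_const)

theorem continuous_integral_transport (hS : S.Regular) (x x' x'' : EuclideanSpace ℝ (Fin d)) :
    Continuous fun w => ∫ θ, S.transport (S.kern x x') x'' θ ∂S.γ₀ w :=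
  continuous_integral_γ₀ hS
    (S.contDiff_transport hS.smooth (S.contDiff_kern hS.smooth _ _) _).continuous

theorem continuous_kernRate (hS : S.Regular) (x x' : EuclideanSpace ℝ (Fin d)) :
    Continuous fun q : FirstLayer d N₁ × ℝ => S.kernRate q.1 q.2 x x' := by
  have h1 := continuous_limitOutput_uncurry hS
  have h2 := fun x x' x'' => continuous_integral_transport hS x x' x''
  have h3 : Continuous fun q : (FirstLayer d N₁ × ℝ) × ℝ => S.limitOutput q.1.1 q.2 :=
    h1.comp (by fun_prop : Continuous fun q : (FirstLayer d N₁ × ℝ) × ℝ => (q.1.1, q.2))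
  have h5 : ∀ x x' x'', Continuous fun q : (FirstLayer d N₁ × ℝ) × ℝ =>
      ∫ θ, S.transport (S.kern x x') x'' θ ∂S.γ₀ q.1.1 := fun x x' x'' =>
    (h2 x x' x'').comp (by fun_prop : Continuous fun q : (FirstLayer d N₁ × ℝ) × ℝ => q.1.1)
  have h4 : Continuous fun q : (FirstLayer d N₁ × ℝ) × ℝ =>
      (M : ℝ)⁻¹ * ∑ m', (S.y m' - S.limitOutput q.1.1 q.2 m') *
        ∫ θ, S.transport (S.kern x x') (S.x m') θ ∂S.γ₀ q.1.1 :=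
    continuous_const.mul (continuous_finsetSum _ fun m' _ => Continuous.mul (by fun_prop) (h5 _ _ _))
  unfold kernRate
  exact intervalIntegral.continuous_parametric_intervalIntegral_of_continuous (a₀ := 0) h4
    continuous_snd

theorem continuous_forcing (hS : S.Regular) (i : Fin M) :
    Continuous fun q : FirstLayer d N₁ × ℝ => S.forcing q.1 q.2 i := by
  have h1 := continuous_limitOutput_uncurry hS
  have h2 := fun m => continuous_kernRate hS (S.x i) (S.x m)
  simp only [forcing_eq hS]
  fun_prop

theorem continuous_forcing_toLp (hS : S.Regular) :
    Continuous fun q : FirstLayer d N₁ × ℝ =>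
      (WithLp.toLp 2 (S.forcing q.1 q.2) : EuclideanSpace ℝ (Fin M)) :=
  (PiLp.continuous_toLp 2 _).comp (continuous_pi fun i => continuous_forcing hS i)

theorem continuous_forcingIntegrand (hS : S.Regular) :
    Continuous fun q : FirstLayer d N₁ × ℝ =>
      S.propagator q.1 (-q.2) (WithLp.toLp 2 (S.forcing q.1 q.2)) := by
  have h1 : Continuous fun q : FirstLayer d N₁ × ℝ => S.propagator q.1 (-q.2) :=
    (continuous_propagator hS).comp
      (by fun_prop : Continuous fun q : FirstLayer d N₁ × ℝ => (q.1, -q.2))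
  exact h1.clm_apply (continuous_forcing_toLp hS)

theorem continuous_forcingIntegral (hS : S.Regular) :
    Continuous fun q : FirstLayer d N₁ × ℝ => S.forcingIntegral q.1 q.2 := by
  have h1 : Continuous fun q : (FirstLayer d N₁ × ℝ) × ℝ =>
      S.propagator q.1.1 (-q.2) (WithLp.toLp 2 (S.forcing q.1.1 q.2)) :=
    (continuous_forcingIntegrand hS).comp
      (by fun_prop : Continuous fun q : (FirstLayer d N₁ × ℝ) × ℝ => (q.1.1, q.2))
  unfold forcingIntegral
  exact intervalIntegral.continuous_parametric_intervalIntegral_of_continuous (a₀ := 0) h1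
    continuous_snd

theorem hasDerivAt_forcingIntegral (hS : S.Regular) (w : FirstLayer d N₁) (t : ℝ) :
    HasDerivAt (S.forcingIntegral w) (S.propagator w (-t) (WithLp.toLp 2 (S.forcing w t))) t := by
  have hc : Continuous fun s : ℝ => S.propagator w (-s) (WithLp.toLp 2 (S.forcing w s)) :=
    (continuous_forcingIntegrand hS).comp (by fun_prop : Continuous fun s : ℝ => (w, s))
  exact intervalIntegral.integral_hasDerivAt_right (hc.intervalIntegrable _ _)
    (hc.stronglyMeasurableAtFilter _ _) hc.continuousAt

theorem continuous_limitPath (hS : S.Regular) :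
    Continuous fun q : (FirstLayer d N₁ × EuclideanSpace ℝ (Fin M) × ℝ) × ℝ =>
      S.limitPath q.1.1 q.1.2.1 q.1.2.2 q.2 := by
  have h0 : Continuous fun q : (FirstLayer d N₁ × EuclideanSpace ℝ (Fin M) × ℝ) × ℝ =>
      (q.1.1, q.2) := by fun_prop
  have h1 : Continuous fun q : (FirstLayer d N₁ × EuclideanSpace ℝ (Fin M) × ℝ) × ℝ =>
      S.propagator q.1.1 q.2 := (continuous_propagator hS).comp h0
  have h2 : Continuous fun q : (FirstLayer d N₁ × EuclideanSpace ℝ (Fin M) × ℝ) × ℝ =>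
      S.forcingIntegral q.1.1 q.2 := (continuous_forcingIntegral hS).comp h0
  exact h1.clm_apply (by fun_prop)

/-- Variation of constants: differentiating the outer propagator gives the linear term, and the
inner integral contributes `propagator w t` applied to `propagator w (-t)` of the forcing, where the
two cancel. -/
theorem hasDerivAt_limitPath (hS : S.Regular) (w : FirstLayer d N₁)
    (k₀ : EuclideanSpace ℝ (Fin M)) (b t : ℝ) :
    HasDerivAt (S.limitPath w k₀ b)
      (b • WithLp.toLp 2 (S.forcing w t) - S.dataOp w (S.limitPath w k₀ b t)) t := by
  have h3 := (hasDerivAt_propagator S w t).clm_apply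
    (((hasDerivAt_forcingIntegral hS w t).const_smul b).const_add k₀)
  refine h3.congr_deriv ?_
  rw [map_smul, propagator_apply_neg, mul_apply_eq_comp, neg_apply, sub_eq_neg_add]
  rfl

theorem hasDerivAt_limitPath_apply (hS : S.Regular) (w : FirstLayer d N₁)
    (k₀ : EuclideanSpace ℝ (Fin M)) (b t : ℝ) (i : Fin M) :
    HasDerivAt (fun t => S.limitPath w k₀ b t i)
      (b * S.forcing w t i -
        (M : ℝ)⁻¹ * ∑ m, S.limitPath w k₀ b t m * S.A w (S.x i) (S.x m)) t := by
  have h := (EuclideanSpace.proj (𝕜 := ℝ) i).hasFDerivAt.comp_hasDerivAt t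
    (hasDerivAt_limitPath hS w k₀ b t)
  refine h.congr_deriv ?_
  rw [← dataOp_apply]
  simp

theorem limitPath_eq_integral (hS : S.Regular) (w : FirstLayer d N₁)
    (k₀ : EuclideanSpace ℝ (Fin M)) (b t : ℝ) (i : Fin M) :
    S.limitPath w k₀ b t i = k₀ i + (∫ s in (0 : ℝ)..t, b * S.forcing w s i) -
      ∫ s in (0 : ℝ)..t, (M : ℝ)⁻¹ * ∑ m, S.limitPath w k₀ b s m * S.A w (S.x i) (S.x m) := by
  have hc0 := (continuous_forcing hS i).comp (Continuous.prodMk_right w)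
  have hc1 : Continuous fun s => S.forcing w s i := hc0
  have hc2 : Continuous (S.limitPath w k₀ b) :=
    continuous_iff_continuousAt.2 fun t => (hasDerivAt_limitPath hS w k₀ b t).continuousAt
  have hc3 : Continuous fun s =>
      (M : ℝ)⁻¹ * ∑ m, S.limitPath w k₀ b s m * S.A w (S.x i) (S.x m) := by fun_prop
  have hc4 : Continuous fun s => b * S.forcing w s i := hc1.const_mul b
  have hc5 : Continuous fun s => b * S.forcing w s i -
      (M : ℝ)⁻¹ * ∑ m, S.limitPath w k₀ b s m * S.A w (S.x i) (S.x m) := hc4.sub hc3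
  have h : ∫ s in (0 : ℝ)..t, (b * S.forcing w s i -
      (M : ℝ)⁻¹ * ∑ m, S.limitPath w k₀ b s m * S.A w (S.x i) (S.x m)) =
      S.limitPath w k₀ b t i - S.limitPath w k₀ b 0 i :=
    intervalIntegral.integral_eq_sub_of_hasDerivAt (f := fun t => S.limitPath w k₀ b t i)
      (fun s _ => hasDerivAt_limitPath_apply hS w k₀ b s i) (hc5.intervalIntegrable 0 t)
  rw [limitPath_zero, intervalIntegral.integral_sub (hc4.intervalIntegrable _ _)
    (hc3.intervalIntegrable _ _)] at h
  linarith

end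

end Setting
end

noncomputable section

/-! ### Elementary estimates -/

theorem abs_average_le {n : ℕ} (hn : 0 < n) {a : Fin n → ℝ} {B : ℝ} (h : ∀ i, |a i| ≤ B) :
    |(n : ℝ)⁻¹ * ∑ i, a i| ≤ B := by
  have hn' : (0 : ℝ) < n := by exact_mod_cast hn
  rw [abs_mul, abs_of_pos (inv_pos.2 hn'), inv_mul_le_iff₀ hn']
  calc |∑ i, a i| ≤ ∑ i, |a i| := Finset.abs_sum_le_sum_abs _ _
    _ ≤ ∑ _i : Fin n, B := Finset.sum_le_sum fun i _ => h i
    _ = n * B := by simp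

theorem abs_sum_range_le {k : ℕ} {a : ℕ → ℝ} {B : ℝ} (h : ∀ l < k, |a l| ≤ B) :
    |∑ l ∈ Finset.range k, a l| ≤ k * B := by
  calc |∑ l ∈ Finset.range k, a l| ≤ ∑ l ∈ Finset.range k, |a l| := Finset.abs_sum_le_sum_abs _ _
    _ ≤ ∑ _l ∈ Finset.range k, B := Finset.sum_le_sum fun l hl => h l (Finset.mem_range.1 hl)
    _ = k * B := by simp

/-- Quantitative regularity of `f` on the ball of radius `R`, with constant `L`. -/
def TaylorOn {V W : Type*} [NormedAddCommGroup V] [NormedSpace ℝ V] [NormedAddCommGroup W]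
    [NormedSpace ℝ W] (f : V → W) (R L : ℝ) : Prop :=
  ∀ θ θ', ‖θ‖ ≤ R → ‖θ'‖ ≤ R → ‖f θ‖ ≤ L ∧ ‖fderiv ℝ f θ‖ ≤ L ∧ ‖f θ' - f θ‖ ≤ L * ‖θ' - θ‖ ∧
    ‖f θ' - f θ - fderiv ℝ f θ (θ' - θ)‖ ≤ L * ‖θ' - θ‖ ^ 2

/-- On a compact ball f and its derivative are bounded and the derivative is Lipschitz; the ball is
convex, so mean value inequalities apply. The bound is claimed for all large L so that finitely many
such bounds can share one constant. -/
theorem ContDiff.eventually_taylorOn {V W : Type*} [NormedAddCommGroup V] [NormedSpace ℝ V]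
    [FiniteDimensional ℝ V] [NormedAddCommGroup W] [NormedSpace ℝ W] {f : V → W}
    (hf : ContDiff ℝ (⊤ : ℕ∞) f) (R : ℝ) : ∀ᶠ L in atTop, TaylorOn f R L := by
  have hf1 : ContDiff ℝ (⊤ : ℕ∞) (fderiv ℝ f) := hf.fderiv_right le_rfl
  have hd : Differentiable ℝ f := hf.differentiable (by simp)
  have : ProperSpace V := FiniteDimensional.proper ℝ V
  have hK := isCompact_closedBall (0 : V) R
  obtain ⟨L0, h0⟩ := hK.exists_bound_of_continuousOn hf.continuous.continuousOn
  obtain ⟨L1, h1⟩ := hK.exists_bound_of_continuousOn hf1.continuous.continuousOn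
  obtain ⟨L2, h2⟩ := ((hf1.of_le (by simp)).locallyLipschitz.locallyLipschitzOn
    (s := Metric.closedBall (0 : V) R)).exists_lipschitzOnWith_of_compact hK
  have hconv := convex_closedBall (0 : V) R
  filter_upwards [eventually_ge_atTop L0, eventually_ge_atTop L1, eventually_ge_atTop (L2 : ℝ),
    eventually_ge_atTop 0] with L hL0 hL1 hL2 hL
  intro θ θ' hθ hθ'
  have m : θ ∈ Metric.closedBall (0 : V) R := by simpa using hθ
  have m' : θ' ∈ Metric.closedBall (0 : V) R := by simpa using hθ'
  refine ⟨(h0 θ m).trans hL0, (h1 θ m).trans hL1, ?_, ?_⟩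
  · exact hconv.norm_image_sub_le_of_norm_fderiv_le (fun x _ => hd x)
      (fun x hx => (h1 x hx).trans hL1) m m'
  · have hs : segment ℝ θ θ' ⊆ Metric.closedBall (0 : V) R := hconv.segment_subset m m'
    -- On the segment the derivative stays this close to its value at θ, and the mean value
    -- inequality for f minus its linearisation gives the quadratic remainder.
    have hb : ∀ x ∈ segment ℝ θ θ', ‖fderiv ℝ f x - fderiv ℝ f θ‖ ≤ L * ‖θ' - θ‖ := by
      intro x hx
      refine (h2.norm_sub_le (hs hx) m).trans ?_
      exact mul_le_mul hL2 (norm_sub_le_of_mem_segment hx) (norm_nonneg _) hL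
    refine ((convex_segment θ θ').norm_image_sub_le_of_norm_fderiv_le' (fun x _ => hd x) hb
      (left_mem_segment ℝ θ θ') (right_mem_segment ℝ θ θ')).trans (le_of_eq (by ring))

/-- On a mesh interval of length 1/N the derivative differs from its value at the left end by at
most C/N. Each interval thus costs C/N², and there are at most N T of them. -/
theorem abs_sub_riemannSum_le {F G : ℝ → ℝ} {T C : ℝ} (hF : ∀ t, HasDerivAt F (G t) t)
    (hG : ∀ s ∈ Icc 0 T, ∀ t ∈ Icc 0 T, |G s - G t| ≤ C * |s - t|) {N k : ℕ} (hN : 0 < N)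
    (hk : (k : ℝ) ≤ N * T) (hC : 0 ≤ C) :
    |F (k / N) - F 0 - (N : ℝ)⁻¹ * ∑ l ∈ Finset.range k, G (l / N)| ≤ C * T * (1 / N) := by
  have hN' : (0 : ℝ) < N := by exact_mod_cast hN
  have hstep : ∀ l < k, |F ((l + 1 : ℕ) / N) - F (l / N) - (N : ℝ)⁻¹ * G (l / N)| ≤
      C * (1 / N) * (1 / N) := by
    intro l hl
    have hl' : ((l + 1 : ℕ) : ℝ) ≤ k := by exact_mod_cast hl
    have e : ((l + 1 : ℕ) : ℝ) / N - l / N = 1 / N := by push_cast; ring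
    have hle : (l : ℝ) / N ≤ (l + 1 : ℕ) / N := by
      have : (0 : ℝ) < 1 / N := by positivity
      linarith
    have h0 : (0 : ℝ) ≤ l / N := by positivity
    have h1 : ((l + 1 : ℕ) : ℝ) / N ≤ T := by
      rw [div_le_iff₀ hN']; linarith
    -- Subtracting t G(l/N) leaves a function whose derivative is G minus its left-end value.
    have := (convex_Icc ((l : ℝ) / N) ((l + 1 : ℕ) / N)).norm_image_sub_le_of_norm_hasDerivWithin_le
      (f := fun t => F t - t * G (l / N)) (f' := fun t => G t - 1 * G (l / N)) (C := C * (1 / N))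
      (fun x _ => ((hF x).sub ((hasDerivAt_id x).mul_const _)).hasDerivWithinAt) ?_
      (left_mem_Icc.2 hle) (right_mem_Icc.2 hle)
    · simp only [Real.norm_eq_abs] at this
      rw [e, abs_of_nonneg (by positivity : (0 : ℝ) ≤ 1 / N)] at this
      refine le_trans (le_of_eq ?_) this
      congr 1
      rw [← sub_eq_zero]
      push_cast
      ring
    · intro x hx
      rw [one_mul, Real.norm_eq_abs]
      refine (hG x ⟨h0.trans hx.1, hx.2.trans h1⟩ _ ⟨h0, hle.trans h1⟩).trans ?_
      refine mul_le_mul_of_nonneg_left ?_ hC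
      rw [abs_of_nonneg (by linarith [hx.1])]
      linarith [hx.2]
  have hsum : F (k / N) - F 0 - (N : ℝ)⁻¹ * ∑ l ∈ Finset.range k, G (l / N) =
      ∑ l ∈ Finset.range k, (F ((l + 1 : ℕ) / N) - F (l / N) - (N : ℝ)⁻¹ * G (l / N)) := by
    rw [Finset.sum_sub_distrib, Finset.sum_range_sub (fun l => F ((l : ℝ) / N)), Finset.mul_sum]
    simp
  rw [hsum]
  refine (abs_sum_range_le hstep).trans ?_
  calc (k : ℝ) * (C * (1 / N) * (1 / N)) ≤ N * T * (C * (1 / N) * (1 / N)) := by gcongr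
    _ = C * T * (1 / N) := by field_simp

theorem discrete_gronwall_sum {e : ℕ → ℝ} {a b T : ℝ} {N K : ℕ} (hN : 0 < N) (hK : (K : ℝ) ≤ N * T)
    (ha : 0 ≤ a) (hb : 0 ≤ b)
    (h : ∀ k ≤ K, e k ≤ a + b / N * ∑ l ∈ Finset.range k, e l) :
    ∀ k ≤ K, e k ≤ a * Real.exp (b * T) := by
  have hN' : (0 : ℝ) < N := by exact_mod_cast hN
  -- The induction runs on the majorant rather than on `e`, so no sign of `e` is needed.
  have key : ∀ k ≤ K, a + b / N * ∑ l ∈ Finset.range k, e l ≤ a * (1 + b / N) ^ k := by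
    intro k
    induction k with
    | zero => simp
    | succ k ih =>
      intro hk
      have h1 := ih (by omega)
      have h2 := h k (by omega)
      rw [Finset.sum_range_succ, pow_succ]
      have h3 : b / N * e k ≤ b / N * (a * (1 + b / N) ^ k) :=
        mul_le_mul_of_nonneg_left (h2.trans h1) (by positivity)
      calc _ = (a + b / N * ∑ l ∈ Finset.range k, e l) + b / N * e k := by ring
        _ ≤ a * (1 + b / N) ^ k + b / N * (a * (1 + b / N) ^ k) := add_le_add h1 h3
        _ = _ := by ring
  intro k hk
  refine ((h k hk).trans (key k hk)).trans (mul_le_mul_of_nonneg_left ?_ ha)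
  have hk' : (k : ℝ) ≤ K := by exact_mod_cast hk
  calc (1 + b / N) ^ k ≤ Real.exp (b / N) ^ k := by
        gcongr
        linarith [Real.add_one_le_exp (b / N)]
    _ = Real.exp (k * (b / N)) := by rw [← Real.exp_nat_mul]
    _ ≤ Real.exp (b * T) := by
        rw [Real.exp_le_exp]
        calc (k : ℝ) * (b / N) ≤ N * T * (b / N) := by
              have : (0 : ℝ) ≤ b / N := by positivity
              gcongr
              exact hk'.trans hK
          _ = b * T := by field_simp

/-- Summation by parts: a sum against a noise with small partial sums is small if the weights
vary slowly. -/
theorem abs_sum_mul_le_of_partialSums {ξ a : ℕ → ℝ} {δ B : ℝ} {k : ℕ}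
    (hδ : ∀ j ≤ k, |∑ l ∈ Finset.range j, ξ l| ≤ δ) (hB : ∀ l ≤ k, |a l| ≤ B)
    {c : ℝ} (hc : ∀ l < k, |a (l + 1) - a l| ≤ c) :
    |∑ l ∈ Finset.range k, ξ l * a l| ≤ δ * (B + k * c) := by
  have hsum : ∀ j, ∑ l ∈ Finset.range j, ξ l * a l = (∑ l ∈ Finset.range j, ξ l) * a j -
      ∑ l ∈ Finset.range j, (∑ i ∈ Finset.range (l + 1), ξ i) * (a (l + 1) - a l) := by
    intro j
    induction j with
    | zero => simp
    | succ j ih =>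
      rw [Finset.sum_range_succ, ih, Finset.sum_range_succ (fun l => (∑ i ∈ Finset.range (l + 1),
        ξ i) * (a (l + 1) - a l)), Finset.sum_range_succ ξ]
      ring
  have hδ0 : 0 ≤ δ := (abs_nonneg _).trans (hδ 0 (Nat.zero_le _))
  rw [hsum k]
  refine (abs_sub _ _).trans ?_
  rw [mul_add]
  refine add_le_add ?_ ?_
  · rw [abs_mul]
    exact mul_le_mul (hδ k le_rfl) (hB k le_rfl) (abs_nonneg _) hδ0
  · refine (abs_sum_range_le (B := δ * c) fun l hl => ?_).trans (le_of_eq (by ring))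
    rw [abs_mul]
    exact mul_le_mul (hδ (l + 1) hl) (hc l hl) (abs_nonneg _) hδ0

/-! ### Uniform bounds on bounded sets of parameters -/

namespace Setting

variable {d M N₁ : ℕ} (S : Setting d M N₁)

/-- Bounds, with constant `L`, for all the functions in the dynamics on the ball of radius `R` and
for the limiting objects on `[0,T]`. -/
structure Bound (T R L : ℝ) : Prop where
  one_le : 1 ≤ L
  y : ∀ m, |S.y m| ≤ L
  gram : ∀ i m, |(inner ℝ (S.x i) (S.x m) : ℝ)| ≤ L
  shift : ∀ m, |1 / (N₁ : ℝ) ^ (1 - S.γ₁)| * ‖S.x m‖ ≤ L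
  unit : ∀ i, TaylorOn (S.unit (N₁ := N₁) (S.x i)) R L
  kern : ∀ i m, TaylorOn (S.kern (N₁ := N₁) (S.x i) (S.x m)) R L
  B3 : ∀ j m, TaylorOn (S.B3 j (S.x m)) R L
  drift : ∀ m, TaylorOn (S.drift (N₁ := N₁) (S.x m)) R L
  A : ∀ w, ‖w‖ ≤ R → ∀ i m, |S.A w (S.x i) (S.x m)| ≤ L
  integral_transport : ∀ w, ‖w‖ ≤ R → ∀ i m m',
    |∫ θ, S.transport (S.kern (S.x i) (S.x m)) (S.x m') θ ∂S.γ₀ w| ≤ L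
  output : ∀ w, ‖w‖ ≤ R → ∀ t ∈ Icc 0 T, ∀ i, |S.limitOutput w t i| ≤ L
  rate : ∀ w, ‖w‖ ≤ R → ∀ t ∈ Icc 0 T, ∀ i m, |S.kernRate w t (S.x i) (S.x m)| ≤ L
  path : ∀ w, ‖w‖ ≤ R → ∀ t ∈ Icc 0 T, ∀ k₀ b i, |S.limitPath w k₀ b t i| ≤ L * (‖k₀‖ + |b|)

theorem eventually_bound_of_continuous {X : Type*} [TopologicalSpace X] {K : Set X}
    (hK : IsCompact K) {f : X → ℝ} (hf : Continuous f) : ∀ᶠ L in atTop, ∀ x ∈ K, |f x| ≤ L := by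
  obtain ⟨B, hB⟩ := hK.exists_bound_of_continuousOn hf.continuousOn
  filter_upwards [eventually_ge_atTop B] with L hL x hx using (hB x hx).trans hL

variable {S} [IsProbabilityMeasure S.μC] [IsProbabilityMeasure S.μW]

theorem abs_apply_le_norm {n : ℕ} (v : EuclideanSpace ℝ (Fin n)) (i : Fin n) : |v i| ≤ ‖v‖ :=
  PiLp.norm_apply_le v i

/-- Each bound holds for all large L, by continuity and compactness; as there are finitely many, one
L satisfies all. -/
theorem exists_bound (hS : S.Regular) (T R : ℝ) : ∃ L, S.Bound T R L := by
  have hW := isCompact_closedBall (0 : FirstLayer d N₁) R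
  have hWT := hW.prod (isCompact_Icc (a := (0 : ℝ)) (b := T))
  have hmem : ∀ {w : FirstLayer d N₁}, ‖w‖ ≤ R → w ∈ Metric.closedBall 0 R := by
    intro w hw; simpa using hw
  have hker := fun i m => S.contDiff_kern (N₁ := N₁) hS.smooth (S.x i) (S.x m)
  have e1 : ∀ᶠ L in atTop, ∀ m, |S.y m| ≤ L := eventually_all.2 fun m => eventually_ge_atTop _
  have e2 : ∀ᶠ L in atTop, ∀ i m, |(inner ℝ (S.x i) (S.x m) : ℝ)| ≤ L :=
    eventually_all.2 fun i => eventually_all.2 fun m => eventually_ge_atTop _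
  have e3 : ∀ᶠ L in atTop, ∀ m, |1 / (N₁ : ℝ) ^ (1 - S.γ₁)| * ‖S.x m‖ ≤ L :=
    eventually_all.2 fun m => eventually_ge_atTop _
  have e4 : ∀ᶠ L in atTop, ∀ i, TaylorOn (S.unit (N₁ := N₁) (S.x i)) R L :=
    eventually_all.2 fun i => (S.contDiff_unit hS.smooth _).eventually_taylorOn R
  have e5 : ∀ᶠ L in atTop, ∀ i m, TaylorOn (S.kern (N₁ := N₁) (S.x i) (S.x m)) R L :=
    eventually_all.2 fun i => eventually_all.2 fun m => (hker i m).eventually_taylorOn R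
  have e6 : ∀ᶠ L in atTop, ∀ j m, TaylorOn (S.B3 j (S.x m)) R L :=
    eventually_all.2 fun j => eventually_all.2 fun m =>
      (S.contDiff_B3 hS.smooth _ _).eventually_taylorOn R
  have e7 : ∀ᶠ L in atTop, ∀ m, TaylorOn (S.drift (N₁ := N₁) (S.x m)) R L :=
    eventually_all.2 fun m => (S.contDiff_drift hS.smooth _).eventually_taylorOn R
  have e8 : ∀ᶠ L in atTop, ∀ i m, ∀ w ∈ Metric.closedBall (0 : FirstLayer d N₁) R,
      |S.A w (S.x i) (S.x m)| ≤ L :=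
    eventually_all.2 fun i => eventually_all.2 fun m =>
      eventually_bound_of_continuous hW (continuous_A hS _ _)
  have e9 : ∀ᶠ L in atTop, ∀ i m m', ∀ w ∈ Metric.closedBall (0 : FirstLayer d N₁) R,
      |∫ θ, S.transport (S.kern (S.x i) (S.x m)) (S.x m') θ ∂S.γ₀ w| ≤ L :=
    eventually_all.2 fun i => eventually_all.2 fun m => eventually_all.2 fun m' =>
      eventually_bound_of_continuous hW (continuous_integral_transport hS _ _ _)
  have e10 : ∀ᶠ L in atTop, ∀ i, ∀ q ∈ Metric.closedBall (0 : FirstLayer d N₁) R ×ˢ Icc 0 T,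
      |S.limitOutput q.1 q.2 i| ≤ L :=
    eventually_all.2 fun i => eventually_bound_of_continuous hWT
      (by have := continuous_limitOutput_uncurry hS; fun_prop)
  have e11 : ∀ᶠ L in atTop, ∀ i m, ∀ q ∈ Metric.closedBall (0 : FirstLayer d N₁) R ×ˢ Icc 0 T,
      |S.kernRate q.1 q.2 (S.x i) (S.x m)| ≤ L :=
    eventually_all.2 fun i => eventually_all.2 fun m => eventually_bound_of_continuous hWT
      (continuous_kernRate hS _ _)
  -- The bound on the limit path has a part P in the initial value and a part P Q in the forcing
  -- strength; L has to dominate both.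
  obtain ⟨P, hP⟩ := hWT.exists_bound_of_continuousOn (continuous_propagator hS).continuousOn
  obtain ⟨Q, hQ⟩ := hWT.exists_bound_of_continuousOn (continuous_forcingIntegral hS).continuousOn
  have hc := (eventually_ge_atTop (1 : ℝ)).and <| e1.and <| e2.and <| e3.and <| e4.and <|
    e5.and <| e6.and <| e7.and <| e8.and <| e9.and <| e10.and <| e11.and <|
    (eventually_ge_atTop P).and (eventually_ge_atTop (P * Q))
  obtain ⟨L, h0, h1, h2, h3, h4, h5, h6, h7, h9, h10, h11, h12, h13, h14⟩ := hc.exists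
  refine ⟨L, h0, h1, h2, h3, h4, h5, h6, h7, fun w hw i m => h9 i m w (hmem hw),
    fun w hw i m m' => h10 i m m' w (hmem hw), fun w hw t ht i => h11 i (w, t) ⟨hmem hw, ht⟩,
    fun w hw t ht i m => h12 i m (w, t) ⟨hmem hw, ht⟩, fun w hw t ht k₀ b i => ?_⟩
  have hp := hP (w, t) ⟨hmem hw, ht⟩
  have hq := hQ (w, t) ⟨hmem hw, ht⟩
  have hP0 := (norm_nonneg _).trans hp
  refine (abs_apply_le_norm _ i).trans (((S.propagator w t).le_opNorm _).trans ?_)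
  calc _ ≤ P * (‖k₀‖ + |b| * Q) := by
        refine mul_le_mul hp ((norm_add_le _ _).trans ?_) (norm_nonneg _) hP0
        rw [norm_smul, Real.norm_eq_abs]
        gcongr
    _ = P * ‖k₀‖ + P * Q * |b| := by ring
    _ ≤ L * ‖k₀‖ + L * |b| := by gcongr
    _ = _ := by ring

end Setting
end

/-! ### Good runs and a priori bounds along them -/

noncomputable section

namespace Setting

variable {d M N₁ : ℕ} {S : Setting d M N₁}

/-- Conditions on the initial parameters and on the samples under which the training dynamics
follows its limit with precision of order `ε (p + N₂^(γ₂-1))`. -/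
structure GoodRun (S : Setting d M N₁) (T R : ℝ) {N : ℕ} (P : Params d N₁ N)
    (z : ℕ → EuclideanSpace ℝ (Fin d) × ℝ) (ω : ℕ → Fin M → ℝ) (ε p : ℝ) : Prop where
  N_pos : 0 < N
  ε_nonneg : 0 ≤ ε
  ε_le : ε ≤ 1
  p_nonneg : 0 ≤ p
  p_le : p ≤ 1
  inv_le : 1 / (N : ℝ) ≤ ε * p
  q_le : (N : ℝ) ^ (S.γ₂ - 1) ≤ ε
  start : ∀ i, ‖P.particle i‖ ≤ R
  sample : ∀ k, ∃ m, z k = (S.x m, S.y m)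
  rep : ∀ l (ψ : EuclideanSpace ℝ (Fin d) × ℝ → ℝ), ∑ m, ω l m * ψ (S.x m, S.y m) = ψ (z l)
  noise : ∀ m, ∀ k : ℕ, (k : ℝ) ≤ N * T →
    |∑ l ∈ Finset.range k, (ω l m - (M : ℝ)⁻¹)| ≤ ε * p * N
  output : ∀ i, |S.network P (S.x i)| ≤ ε
  kern : ∀ i m, |P.mean (S.kern (S.x i) (S.x m)) - ∫ θ, S.kern (S.x i) (S.x m) θ ∂S.γ₀ P.W1| ≤
    ε * p
  transport : ∀ i m m', |P.mean (S.transport (S.kern (S.x i) (S.x m)) (S.x m')) -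
    ∫ θ, S.transport (S.kern (S.x i) (S.x m)) (S.x m') θ ∂S.γ₀ P.W1| ≤ ε * p
  B3 : ∀ j m, |P.mean (S.B3 j (S.x m))| ≤ ε * p

theorem norm_shift_le (ρ : Fin N₁ → ℝ) (x : EuclideanSpace ℝ (Fin d)) {δ : ℝ} (hδ : 0 ≤ δ)
    (hρ : ∀ j, |ρ j| ≤ δ) : ‖S.shift ρ x‖ ≤ |1 / (N₁ : ℝ) ^ (1 - S.γ₁)| * ‖x‖ * δ := by
  have h0 : 0 ≤ |1 / (N₁ : ℝ) ^ (1 - S.γ₁)| * ‖x‖ * δ := by positivity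
  simp only [shift, Prod.norm_def, norm_zero]
  refine max_le h0 (max_le h0 ((pi_norm_le_iff_of_nonneg h0).2 fun j => ?_))
  rw [norm_smul, Real.norm_eq_abs, abs_mul]
  calc _ = |1 / (N₁ : ℝ) ^ (1 - S.γ₁)| * ‖x‖ * |ρ j| := by ring
    _ ≤ _ := by gcongr; exact hρ j

theorem abs_mean_le {N : ℕ} (hN : 0 < N) {P : Params d N₁ N} {f : Particle d N₁ → ℝ} {R L : ℝ}
    (hf : TaylorOn f R L) (hP : ∀ i, ‖P.particle i‖ ≤ R) : |P.mean f| ≤ L :=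
  abs_average_le hN fun i => (hf _ _ (hP i) (hP i)).1

theorem abs_mean_sub_le {N : ℕ} (hN : 0 < N) {P P' : Params d N₁ N} {f : Particle d N₁ → ℝ}
    {R L δ : ℝ} (hL : 0 ≤ L) (hf : TaylorOn f R L) (hP : ∀ i, ‖P.particle i‖ ≤ R)
    (hP' : ∀ i, ‖P'.particle i‖ ≤ R) (hδ : ∀ i, ‖P'.particle i - P.particle i‖ ≤ δ) :
    |P'.mean f - P.mean f| ≤ L * δ := by
  rw [Params.mean, Params.mean, ← mul_sub, ← Finset.sum_sub_distrib]
  exact abs_average_le hN fun i => ((hf _ _ (hP i) (hP' i)).2.2.1).trans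
    (mul_le_mul_of_nonneg_left (hδ i) hL)

/-- The drift is at most L and the shift at most L², and L + L² ≤ 2L² because L ≥ 1. -/
theorem norm_particle_sgdStep_sub_le {T R L : ℝ} (hN₁ : 0 < N₁) (hB : S.Bound T R L) {N : ℕ}
    (hN : 0 < N) {P : Params d N₁ N} (hP : ∀ i, ‖P.particle i‖ ≤ R) (m : Fin M) (i : Fin N) :
    ‖(S.sgdStep P (S.x m, S.y m)).particle i - P.particle i‖ ≤
      2 * L ^ 2 * ((N : ℝ) ^ (S.γ₂ - 1) / N * |S.y m - S.network P (S.x m)|) := by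
  have hL := hB.one_le
  rw [particle_sgdStep S hN₁ hN, add_sub_cancel_left, norm_smul, mul_comm, Real.norm_eq_abs,
    abs_mul, abs_of_nonneg (by positivity : (0 : ℝ) ≤ (N : ℝ) ^ (S.γ₂ - 1) / N)]
  refine mul_le_mul_of_nonneg_right ?_ (by positivity)
  refine (norm_add_le _ _).trans ?_
  have h1 := (hB.drift m _ _ (hP i) (hP i)).1
  have h2 := norm_shift_le (S := S) (fun j => P.mean (S.B3 j (S.x m))) (S.x m)
    (by linarith : 0 ≤ L) (fun j => abs_mean_le hN (hB.B3 j m) hP)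
  have h3 : |1 / (N₁ : ℝ) ^ (1 - S.γ₁)| * ‖S.x m‖ * L ≤ L * L :=
    mul_le_mul_of_nonneg_right (hB.shift m) (by linarith)
  nlinarith

/-- The factor q in the displacement cancels the prefactor q⁻¹ of the output. -/
theorem abs_network_sub_le {N : ℕ} (hN : 0 < N) {P P' : Params d N₁ N} {R L δ : ℝ} (hL : 0 ≤ L)
    {x : EuclideanSpace ℝ (Fin d)} (hf : TaylorOn (S.unit x) R L) (hP : ∀ i, ‖P.particle i‖ ≤ R)
    (hP' : ∀ i, ‖P'.particle i‖ ≤ R)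
    (hδ : ∀ i, ‖P'.particle i - P.particle i‖ ≤ (N : ℝ) ^ (S.γ₂ - 1) * δ) :
    |S.network P' x - S.network P x| ≤ L * δ := by
  have hq : (0 : ℝ) < (N : ℝ) ^ (S.γ₂ - 1) := Real.rpow_pos_of_pos (by exact_mod_cast hN) _
  rw [network_eq_mean S hN, network_eq_mean S hN, ← mul_sub, abs_mul, abs_inv, abs_of_pos hq,
    inv_mul_le_iff₀ hq]
  refine (abs_mean_sub_le hN hL hf hP hP' hδ).trans (le_of_eq (by ring))

/-- A run along which parameters and outputs stay bounded, with constant `C`. -/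
structure StableRun (S : Setting d M N₁) (T R C : ℝ) {N : ℕ} (P : Params d N₁ N)
    (z : ℕ → EuclideanSpace ℝ (Fin d) × ℝ) : Prop where
  norm_le : ∀ k : ℕ, (k : ℝ) ≤ N * T → ∀ i, ‖(S.sgd P z k).particle i‖ ≤ R
  norm_sub_le : ∀ k : ℕ, (k : ℝ) ≤ N * T → ∀ i,
    ‖(S.sgd P z k).particle i - P.particle i‖ ≤ C * (N : ℝ) ^ (S.γ₂ - 1)
  abs_residual_le : ∀ k : ℕ, (k : ℝ) ≤ N * T → ∀ m,
    |S.y m - S.network (S.sgd P z k) (S.x m)| ≤ C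
  norm_step_le : ∀ k : ℕ, ((k + 1 : ℕ) : ℝ) ≤ N * T → ∀ i,
    ‖(S.sgd P z (k + 1)).particle i - (S.sgd P z k).particle i‖ ≤ C * ((N : ℝ) ^ (S.γ₂ - 1) / N)
  abs_network_step_le : ∀ k : ℕ, ((k + 1 : ℕ) : ℝ) ≤ N * T → ∀ i,
    |S.network (S.sgd P z (k + 1)) (S.x i) - S.network (S.sgd P z k) (S.x i)| ≤ C * (1 / N)

/-- The bounds with constant L are available only while the particles stay in the ball of radius R +
1, and staying there needs a bound on the residuals. Both are propagated together: a step changes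
each output by at most O(1/N) times the residual, so outputs grow at most exponentially in time, and
the total displacement is O(q), which is less than 1 for small ε. -/
theorem exists_stableRun (hN₁ : 0 < N₁) {T R L : ℝ} (hT : 0 ≤ T) (hB : S.Bound T (R + 1) L) :
    ∃ C ε₀ : ℝ, 1 ≤ C ∧ 0 < ε₀ ∧ ∀ {N : ℕ} {P : Params d N₁ N} {z} {ω} {ε p : ℝ},
      S.GoodRun T R P z ω ε p → ε ≤ ε₀ → S.StableRun T (R + 1) C P z := by
  have hL := hB.one_le
  have hL0 : 0 ≤ L := by linarith
  -- The displacement bound contributes 2L² and the Lipschitz constant of `unit` another L, so that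
  -- one step changes an output by at most b/N times the residual.
  set b : ℝ := 2 * L ^ 3 with hb
  have hb0 : 0 ≤ b := by positivity
  set G : ℝ := (L + 1) * Real.exp (b * T) with hG
  have hG1 : 1 ≤ G := by
    have : 1 ≤ Real.exp (b * T) := Real.one_le_exp (by positivity)
    nlinarith
  have hG0 : 0 ≤ G := by linarith
  set C : ℝ := 2 * L ^ 3 * G * (T + 1) with hC
  have hL2 : 1 ≤ L ^ 2 := one_le_pow₀ hL
  have hL3 : L ^ 2 ≤ L ^ 3 := pow_le_pow_right₀ hL (by norm_num)
  have hGC : 2 * L ^ 3 * G ≤ C := le_mul_of_one_le_right (by positivity) (by linarith)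
  have hGC2 : 2 * L ^ 2 * G ≤ 2 * L ^ 3 * G := by gcongr
  have hGC3 : G ≤ 2 * L ^ 2 * G := by nlinarith
  have hCT : 2 * L ^ 2 * G * T ≤ C := by
    calc 2 * L ^ 2 * G * T ≤ 2 * L ^ 3 * G * (T + 1) := by gcongr; linarith
      _ = C := rfl
  have hC1 : 1 ≤ C := by linarith
  -- Since q ≤ ε on a good run, ε ≤ C⁻¹ gives C q ≤ 1: particles never leave the enlarged ball.
  refine ⟨C, C⁻¹, hC1, by positivity, ?_⟩
  intro N P z ω ε p h hε
  have hN := h.N_pos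
  have hN' : (0 : ℝ) < N := by exact_mod_cast hN
  set q : ℝ := (N : ℝ) ^ (S.γ₂ - 1) with hq
  have hq0 : 0 < q := Real.rpow_pos_of_pos hN' _
  have hCq : C * q ≤ 1 := by
    calc C * q ≤ C * C⁻¹ := by gcongr; exact h.q_le.trans hε
      _ = 1 := mul_inv_cancel₀ (by positivity)
  have hpow : ∀ k : ℕ, (k : ℝ) ≤ N * T → (L + 1) * (1 + b / N) ^ k ≤ G := by
    intro k hk
    refine mul_le_mul_of_nonneg_left ?_ (by linarith)
    calc (1 + b / N) ^ k ≤ Real.exp (b / N) ^ k := by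
          gcongr
          linarith [Real.add_one_le_exp (b / N)]
      _ = Real.exp (k * (b / N)) := by rw [← Real.exp_nat_mul]
      _ ≤ Real.exp (b * T) := by
          rw [Real.exp_le_exp]
          calc (k : ℝ) * (b / N) ≤ N * T * (b / N) := by gcongr
            _ = b * T := by field_simp
  -- The displacement bound uses the final constant `G`, while the output bound keeps the sharper
  -- factor (1 + b/N)^k that the induction needs. Adding L to the output makes the same quantity
  -- bound the residual.
  have main : ∀ k : ℕ, (k : ℝ) ≤ N * T →
      (∀ i, ‖(S.sgd P z k).particle i - P.particle i‖ ≤ k * (2 * L ^ 2 * G * (q / N))) ∧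
      ∀ i, L + |S.network (S.sgd P z k) (S.x i)| ≤ (L + 1) * (1 + b / N) ^ k := by
    have hball : ∀ k : ℕ, (k : ℝ) ≤ N * T →
        (∀ i, ‖(S.sgd P z k).particle i - P.particle i‖ ≤ k * (2 * L ^ 2 * G * (q / N))) →
        ∀ i, ‖(S.sgd P z k).particle i‖ ≤ R + 1 := by
      intro k hk hd i
      have h1 : (k : ℝ) * (2 * L ^ 2 * G * (q / N)) ≤ 1 := by
        calc (k : ℝ) * (2 * L ^ 2 * G * (q / N)) ≤ N * T * (2 * L ^ 2 * G * (q / N)) := by gcongr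
          _ = 2 * L ^ 2 * G * T * q := by field_simp
          _ ≤ C * q := by gcongr
          _ ≤ 1 := hCq
      have h2 := norm_le_norm_add_norm_sub (P.particle i) ((S.sgd P z k).particle i)
      rw [norm_sub_rev] at h2
      linarith [hd i, h.start i]
    intro k
    induction k with
    | zero =>
      intro _
      refine ⟨fun i => by simp [sgd], fun i => ?_⟩
      simp only [sgd, pow_zero, mul_one]
      linarith [h.output i, h.ε_le]
    | succ k ih =>
      intro hk
      have hk' : (k : ℝ) ≤ N * T := le_trans (by push_cast; linarith) hk
      obtain ⟨ih1, ih2⟩ := ih hk'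
      obtain ⟨m, hm⟩ := h.sample k
      have hin := hball k hk' ih1
      have hr : |S.y m - S.network (S.sgd P z k) (S.x m)| ≤ (L + 1) * (1 + b / N) ^ k :=
        (abs_sub _ _).trans ((add_le_add_left (hB.y m) _).trans (ih2 m))
      have hs : ∀ i, ‖(S.sgd P z (k + 1)).particle i - (S.sgd P z k).particle i‖ ≤
          q * (2 * L ^ 2 * ((L + 1) * (1 + b / N) ^ k) / N) := by
        intro i
        have := norm_particle_sgdStep_sub_le hN₁ hB hN hin m i
        rw [sgd, hm]
        refine this.trans ?_
        calc _ ≤ 2 * L ^ 2 * (q / N * ((L + 1) * (1 + b / N) ^ k)) := by gcongr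
          _ = _ := by ring
      have h1 : ∀ i, ‖(S.sgd P z (k + 1)).particle i - P.particle i‖ ≤
          ((k + 1 : ℕ) : ℝ) * (2 * L ^ 2 * G * (q / N)) := by
        intro i
        have e1 := norm_sub_le_norm_sub_add_norm_sub ((S.sgd P z (k + 1)).particle i)
          ((S.sgd P z k).particle i) (P.particle i)
        have e2 : q * (2 * L ^ 2 * ((L + 1) * (1 + b / N) ^ k) / N) ≤
            2 * L ^ 2 * G * (q / N) := by
          calc _ ≤ q * (2 * L ^ 2 * G / N) := by gcongr; exact hpow k hk'
            _ = _ := by ring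
        push_cast
        linarith [hs i, ih1 i]
      refine ⟨h1, fun i => ?_⟩
      have h2 := abs_network_sub_le (S := S) hN hL0 (hB.unit i) hin (hball (k + 1) hk h1) hs
      have h3 : |S.network (S.sgd P z (k + 1)) (S.x i)| ≤ |S.network (S.sgd P z k) (S.x i)| +
          |S.network (S.sgd P z (k + 1)) (S.x i) - S.network (S.sgd P z k) (S.x i)| := by
        have := abs_add_le (S.network (S.sgd P z k) (S.x i))
          (S.network (S.sgd P z (k + 1)) (S.x i) - S.network (S.sgd P z k) (S.x i))
        rwa [add_sub_cancel] at this
      have h4 : L * (2 * L ^ 2 * ((L + 1) * (1 + b / N) ^ k) / N) =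
          b / N * ((L + 1) * (1 + b / N) ^ k) := by rw [hb]; ring
      rw [h4] at h2
      have h5 : (L + 1) * (1 + b / N) ^ (k + 1) = (L + 1) * (1 + b / N) ^ k +
          b / N * ((L + 1) * (1 + b / N) ^ k) := by rw [pow_succ]; ring
      rw [h5]
      linarith [ih2 i]
  have hCsub : ∀ k : ℕ, (k : ℝ) ≤ N * T → ∀ i,
      ‖(S.sgd P z k).particle i - P.particle i‖ ≤ C * q := by
    intro k hk i
    refine ((main k hk).1 i).trans ?_
    calc (k : ℝ) * (2 * L ^ 2 * G * (q / N)) ≤ N * T * (2 * L ^ 2 * G * (q / N)) := by gcongr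
      _ = 2 * L ^ 2 * G * T * q := by field_simp
      _ ≤ C * q := by gcongr
  have hball : ∀ k : ℕ, (k : ℝ) ≤ N * T → ∀ i, ‖(S.sgd P z k).particle i‖ ≤ R + 1 := by
    intro k hk i
    have h2 := norm_le_norm_add_norm_sub (P.particle i) ((S.sgd P z k).particle i)
    rw [norm_sub_rev] at h2
    linarith [hCsub k hk i, h.start i]
  have hres : ∀ k : ℕ, (k : ℝ) ≤ N * T → ∀ m,
      |S.y m - S.network (S.sgd P z k) (S.x m)| ≤ G := fun k hk m =>
    (abs_sub _ _).trans ((add_le_add_left (hB.y m) _).trans (((main k hk).2 m).trans (hpow k hk)))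
  have hstep : ∀ k : ℕ, ((k + 1 : ℕ) : ℝ) ≤ N * T → ∀ i,
      ‖(S.sgd P z (k + 1)).particle i - (S.sgd P z k).particle i‖ ≤
        q * (2 * L ^ 2 * G * (1 / N)) := by
    intro k hk i
    have hk' : (k : ℝ) ≤ N * T := le_trans (by push_cast; linarith) hk
    obtain ⟨m, hm⟩ := h.sample k
    rw [sgd, hm]
    refine (norm_particle_sgdStep_sub_le hN₁ hB hN (hball k hk') m i).trans ?_
    calc _ ≤ 2 * L ^ 2 * (q / N * G) := by gcongr; exact hres k hk' m
      _ = _ := by ring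
  refine ⟨hball, hCsub, fun k hk m => (hres k hk m).trans (by linarith), fun k hk i => ?_,
    fun k hk i => ?_⟩
  · refine (hstep k hk i).trans ?_
    calc _ = 2 * L ^ 2 * G * (q / N) := by ring
      _ ≤ C * (q / N) := by gcongr; linarith
  · have hk' : (k : ℝ) ≤ N * T := le_trans (by push_cast; linarith) hk
    refine (abs_network_sub_le (S := S) hN hL0 (hB.unit i) (hball k hk') (hball (k + 1) hk)
      (hstep k hk)).trans ?_
    calc _ = 2 * L ^ 3 * G * (1 / N) := by ring
      _ ≤ C * (1 / N) := by gcongr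

end Setting
end

/-! ### First-order expansions along a run, and the predicted outputs -/

noncomputable section

namespace Setting

variable {d M N₁ : ℕ} {S : Setting d M N₁}

theorem GoodRun.step_pos {T R : ℝ} {N : ℕ} {P : Params d N₁ N} {z} {ω} {ε p : ℝ}
    (h : S.GoodRun T R P z ω ε p) : (0 : ℝ) < (N : ℝ) ^ (S.γ₂ - 1) :=
  Real.rpow_pos_of_pos (by exact_mod_cast h.N_pos) _

theorem GoodRun.residual_sample {T R C : ℝ} {N : ℕ} {P : Params d N₁ N} {z} {ω} {ε p : ℝ}
    {R' : ℝ} (h : S.GoodRun T R' P z ω ε p) (hs : S.StableRun T R C P z) {k : ℕ}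
    (hk : (k : ℝ) ≤ N * T) : |(z k).2 - S.network (S.sgd P z k) (z k).1| ≤ C := by
  obtain ⟨m, hm⟩ := h.sample k
  rw [hm]
  exact hs.abs_residual_le k hk m

/-- The mean starts at most ε p away from its limit 0, and particles displaced by C q change it by
at most L C q. -/
theorem abs_mean_B3_le {T R L C : ℝ} (hC : 1 ≤ C) (hB : S.Bound T R L) {R' : ℝ} {N : ℕ}
    {P : Params d N₁ N} {z} {ω} {ε p : ℝ} (h : S.GoodRun T R' P z ω ε p)
    (hs : S.StableRun T R C P z) (hT : 0 ≤ T) {k : ℕ} (hk : (k : ℝ) ≤ N * T) (j : Fin N₁)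
    (m : Fin M) :
    |(S.sgd P z k).mean (S.B3 j (S.x m))| ≤ L * C * (ε * p + (N : ℝ) ^ (S.γ₂ - 1)) := by
  have hL := hB.one_le
  have h0 : ∀ i, ‖P.particle i‖ ≤ R := hs.norm_le 0 (by simp; positivity)
  have h1 := abs_mean_sub_le h.N_pos (by linarith) (hB.B3 j m) h0 (hs.norm_le k hk)
    (hs.norm_sub_le k hk)
  have h2 := h.B3 j m
  have h3 : |(S.sgd P z k).mean (S.B3 j (S.x m))| ≤ |P.mean (S.B3 j (S.x m))| +
      |(S.sgd P z k).mean (S.B3 j (S.x m)) - P.mean (S.B3 j (S.x m))| := by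
    have := abs_add_le (P.mean (S.B3 j (S.x m)))
      ((S.sgd P z k).mean (S.B3 j (S.x m)) - P.mean (S.B3 j (S.x m)))
    rwa [add_sub_cancel] at this
  have h4 : ε * p ≤ L * C * (ε * p) :=
    le_mul_of_one_le_left (mul_nonneg h.ε_nonneg h.p_nonneg) (one_le_mul_of_one_le_of_one_le hL hC)
  rw [mul_add, mul_assoc L C ((N : ℝ) ^ (S.γ₂ - 1))]
  linarith

theorem abs_mean_B3_le' {T R L C : ℝ} (hC : 1 ≤ C) (hB : S.Bound T R L) {R' : ℝ} {N : ℕ}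
    {P : Params d N₁ N} {z} {ω} {ε p : ℝ} (h : S.GoodRun T R' P z ω ε p)
    (hs : S.StableRun T R C P z) (hT : 0 ≤ T) {k : ℕ} (hk : (k : ℝ) ≤ N * T) (j : Fin N₁)
    (m : Fin M) : |(S.sgd P z k).mean (S.B3 j (S.x m))| ≤ 2 * L * C * ε := by
  have hL := hB.one_le
  refine (abs_mean_B3_le hC hB h hs hT hk j m).trans ?_
  have : ε * p ≤ ε := mul_le_of_le_one_right h.ε_nonneg h.p_le
  calc _ ≤ L * C * (ε + ε) := by gcongr; exact h.q_le
    _ = _ := by ring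

/-- The displacement of a particle, up to errors of higher order, is the accumulated drift at its
initial position. -/
theorem norm_displacement_sub_le (hN₁ : 0 < N₁) {T R L C : ℝ} (hC : 1 ≤ C) (hB : S.Bound T R L)
    {R' : ℝ} {N : ℕ} {P : Params d N₁ N} {z} {ω} {ε p : ℝ} (h : S.GoodRun T R' P z ω ε p)
    (hs : S.StableRun T R C P z) (hT : 0 ≤ T) {k : ℕ} (hk : (k : ℝ) ≤ N * T) (i : Fin N) :
    ‖(S.sgd P z k).particle i - P.particle i - ∑ l ∈ Finset.range k,
      ((N : ℝ) ^ (S.γ₂ - 1) / N * ((z l).2 - S.network (S.sgd P z l) (z l).1)) •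
        S.drift (z l).1 (P.particle i)‖ ≤ 3 * T * C ^ 2 * L ^ 2 * ((N : ℝ) ^ (S.γ₂ - 1) * ε) := by
  have hL := hB.one_le
  have hN := h.N_pos
  have hN' : (0 : ℝ) < N := by exact_mod_cast hN
  have hq0 := h.step_pos
  have hε := h.ε_nonneg
  set q : ℝ := (N : ℝ) ^ (S.γ₂ - 1) with hq
  have h0 : ∀ i, ‖P.particle i‖ ≤ R := hs.norm_le 0 (by simp; positivity)
  have htel : (S.sgd P z k).particle i - P.particle i = ∑ l ∈ Finset.range k,
      ((S.sgd P z (l + 1)).particle i - (S.sgd P z l).particle i) := by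
    rw [Finset.sum_range_sub (fun l => (S.sgd P z l).particle i)]
    rfl
  rw [htel, ← Finset.sum_sub_distrib]
  -- Evaluating the drift at the initial instead of the current position costs L C ε, and dropping
  -- the first-layer motion costs 2 L² C ε, because its coefficients are means of B³.
  have hterm : ∀ l ∈ Finset.range k, ‖(S.sgd P z (l + 1)).particle i - (S.sgd P z l).particle i -
      (q / N * ((z l).2 - S.network (S.sgd P z l) (z l).1)) • S.drift (z l).1 (P.particle i)‖ ≤
      q / N * C * (3 * C * L ^ 2 * ε) := by
    intro l hl
    have hl' : (l : ℝ) ≤ N * T :=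
      le_trans (by exact_mod_cast (Finset.mem_range.1 hl).le) hk
    obtain ⟨m, hm⟩ := h.sample l
    have hr := h.residual_sample hs hl'
    rw [sgd, particle_sgdStep S hN₁ hN, add_sub_cancel_left, ← smul_sub, norm_smul,
      Real.norm_eq_abs, abs_mul, abs_of_nonneg (by positivity : (0 : ℝ) ≤ q / N)]
    refine mul_le_mul (by gcongr) ?_ (norm_nonneg _) (by positivity)
    rw [add_sub_right_comm, hm]
    refine (norm_add_le _ _).trans ?_
    have h1 := (hB.drift m _ _ (h0 i) (hs.norm_le l hl' i)).2.2.1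
    have h2 := norm_shift_le (S := S) (fun j => (S.sgd P z l).mean (S.B3 j (S.x m))) (S.x m)
      (δ := 2 * L * C * ε) (by positivity) fun j => abs_mean_B3_le' hC hB h hs hT hl' j m
    have h3 : L * ‖(S.sgd P z l).particle i - P.particle i‖ ≤ L * (C * ε) := by
      gcongr
      exact (hs.norm_sub_le l hl' i).trans (mul_le_mul_of_nonneg_left h.q_le (by linarith))
    have h4 : |1 / (N₁ : ℝ) ^ (1 - S.γ₁)| * ‖S.x m‖ * (2 * L * C * ε) ≤ L * (2 * L * C * ε) :=
      mul_le_mul_of_nonneg_right (hB.shift m) (by positivity)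
    have h5 : L * (C * ε) ≤ L * L * (C * ε) := by
      gcongr; exact le_mul_of_one_le_left (by linarith) hL
    calc _ ≤ L * L * (C * ε) + L * (2 * L * C * ε) := by linarith
      _ = 3 * C * L ^ 2 * ε := by ring
  refine (norm_sum_le_of_le _ hterm).trans ?_
  rw [Finset.sum_const, Finset.card_range, nsmul_eq_mul]
  calc (k : ℝ) * (q / N * C * (3 * C * L ^ 2 * ε)) ≤ N * T * (q / N * C * (3 * C * L ^ 2 * ε)) := by
        gcongr
    _ = _ := by field_simp

/-- First-order expansion of the empirical averages along the run. -/
theorem abs_mean_expansion_le (hN₁ : 0 < N₁) {T R L C : ℝ} (hC : 1 ≤ C) (hB : S.Bound T R L)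
    {R' : ℝ} {N : ℕ} {P : Params d N₁ N} {z} {ω} {ε p : ℝ} (h : S.GoodRun T R' P z ω ε p)
    (hs : S.StableRun T R C P z) (hT : 0 ≤ T) {f : Particle d N₁ → ℝ} (hf : TaylorOn f R L)
    {k : ℕ} (hk : (k : ℝ) ≤ N * T) :
    |(S.sgd P z k).mean f - P.mean f - ∑ l ∈ Finset.range k,
      (N : ℝ) ^ (S.γ₂ - 1) / N * ((z l).2 - S.network (S.sgd P z l) (z l).1) *
        P.mean (S.transport f (z l).1)| ≤
      (L * C ^ 2 + L * (3 * T * C ^ 2 * L ^ 2)) * ((N : ℝ) ^ (S.γ₂ - 1) * ε) := by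
  have hL := hB.one_le
  have hN := h.N_pos
  have hq0 := h.step_pos
  have hε := h.ε_nonneg
  set q : ℝ := (N : ℝ) ^ (S.γ₂ - 1) with hq
  have h0 : ∀ i, ‖P.particle i‖ ≤ R := hs.norm_le 0 (by simp; positivity)
  set a : ℕ → ℝ := fun l => q / N * ((z l).2 - S.network (S.sgd P z l) (z l).1) with ha
  have key : ∀ i, |f ((S.sgd P z k).particle i) - f (P.particle i) - ∑ l ∈ Finset.range k,
      a l * S.transport f (z l).1 (P.particle i)| ≤
      (L * C ^ 2 + L * (3 * T * C ^ 2 * L ^ 2)) * (q * ε) := by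
    intro i
    obtain ⟨-, hd, -, ht⟩ := hf _ _ (h0 i) (hs.norm_le k hk i)
    have hdisp := norm_displacement_sub_le hN₁ hC hB h hs hT hk i
    have h1 := ((fderiv ℝ f (P.particle i)).le_opNorm _).trans
      (mul_le_mul hd hdisp (norm_nonneg _) (by linarith))
    have e : fderiv ℝ f (P.particle i) ((S.sgd P z k).particle i - P.particle i -
        ∑ l ∈ Finset.range k, a l • S.drift (z l).1 (P.particle i)) =
        fderiv ℝ f (P.particle i) ((S.sgd P z k).particle i - P.particle i) -
        ∑ l ∈ Finset.range k, a l * S.transport f (z l).1 (P.particle i) := by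
      rw [map_sub, map_sum]
      simp [transport]
    rw [e] at h1
    -- The Taylor remainder is of order q², and one factor q is traded for ε.
    have h2 : L * ‖(S.sgd P z k).particle i - P.particle i‖ ^ 2 ≤ L * C ^ 2 * (q * ε) := by
      calc _ ≤ L * (C * q) ^ 2 := by gcongr; exact hs.norm_sub_le k hk i
        _ = L * C ^ 2 * (q * q) := by ring
        _ ≤ _ := by gcongr; exact h.q_le
    rw [Real.norm_eq_abs] at h1 ht
    have h3 := abs_add_le (f ((S.sgd P z k).particle i) - f (P.particle i) -
      fderiv ℝ f (P.particle i) ((S.sgd P z k).particle i - P.particle i))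
      (fderiv ℝ f (P.particle i) ((S.sgd P z k).particle i - P.particle i) -
        ∑ l ∈ Finset.range k, a l * S.transport f (z l).1 (P.particle i))
    rw [sub_add_sub_cancel] at h3
    calc _ ≤ L * C ^ 2 * (q * ε) + L * (3 * T * C ^ 2 * L ^ 2 * (q * ε)) := by linarith
      _ = _ := by ring
  have := abs_average_le hN key
  rw [Finset.sum_sub_distrib, Finset.sum_sub_distrib, mul_sub, mul_sub, Finset.sum_comm,
    Finset.mul_sum (Finset.range k)] at this
  have e : ∀ l, (N : ℝ)⁻¹ * ∑ i, a l * S.transport f (z l).1 (P.particle i) =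
      a l * P.mean (S.transport f (z l).1) := by
    intro l
    rw [Params.mean, ← Finset.mul_sum]; ring
  simp only [e] at this
  exact this

/-- Replacing the samples by their average, in a sum with slowly varying terms. -/
theorem GoodRun.abs_sum_sample_sub_le {T R : ℝ} {N : ℕ} {P : Params d N₁ N} {z} {ω} {ε p : ℝ}
    (h : S.GoodRun T R P z ω ε p) {a : ℕ → EuclideanSpace ℝ (Fin d) × ℝ → ℝ}
    {B c : ℝ} (hc0 : 0 ≤ c) {k : ℕ} (hk : (k : ℝ) ≤ N * T)
    (ha : ∀ l ≤ k, ∀ m, |a l (S.x m, S.y m)| ≤ B)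
    (hc : ∀ l < k, ∀ m, |a (l + 1) (S.x m, S.y m) - a l (S.x m, S.y m)| ≤ c * (1 / N)) :
    |∑ l ∈ Finset.range k, (a l (z l) - (M : ℝ)⁻¹ * ∑ m, a l (S.x m, S.y m))| ≤
      M * (ε * p * N * (B + T * c)) := by
  have hN' : (0 : ℝ) < N := by exact_mod_cast h.N_pos
  have hε := h.ε_nonneg
  have hp := h.p_nonneg
  -- The weights `ω` write a sample as a combination of data points, so the error becomes, for each
  -- data point, a sum against the centred noise `ω l m - M⁻¹`, whose partial sums are small.
  have e : ∑ l ∈ Finset.range k, (a l (z l) - (M : ℝ)⁻¹ * ∑ m, a l (S.x m, S.y m)) =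
      ∑ m, ∑ l ∈ Finset.range k, (ω l m - (M : ℝ)⁻¹) * a l (S.x m, S.y m) := by
    rw [Finset.sum_comm]
    refine Finset.sum_congr rfl fun l _ => ?_
    rw [← h.rep l (a l), Finset.mul_sum, ← Finset.sum_sub_distrib]
    exact Finset.sum_congr rfl fun m _ => by ring
  rw [e]
  refine (Finset.abs_sum_le_sum_abs _ _).trans ?_
  have : ∀ m ∈ Finset.univ, |∑ l ∈ Finset.range k, (ω l m - (M : ℝ)⁻¹) * a l (S.x m, S.y m)| ≤
      ε * p * N * (B + T * c) := by
    intro m _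
    refine (abs_sum_mul_le_of_partialSums (δ := ε * p * N) (fun j hj => h.noise m j
      (le_trans (by exact_mod_cast hj) hk)) (fun l hl => ha l hl m)
      (fun l hl => hc l hl m)).trans ?_
    have : (k : ℝ) * (c * (1 / N)) ≤ T * c := by
      calc (k : ℝ) * (c * (1 / N)) ≤ N * T * (c * (1 / N)) := by gcongr
        _ = T * c := by field_simp
    gcongr
  refine (Finset.sum_le_sum this).trans (le_of_eq (by simp))

/-- The output `h_t + K_t` predicted by the limiting equations at the data points. -/
def prediction (S : Setting d M N₁) (w : FirstLayer d N₁) (g₀ : EuclideanSpace ℝ (Fin M)) (b t : ℝ) :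
    EuclideanSpace ℝ (Fin M) :=
  S.limitOutput w t + S.limitPath w g₀ b t

/-- The vector of network outputs at the data points. -/
def outputVec (S : Setting d M N₁) {N : ℕ} (P : Params d N₁ N) : EuclideanSpace ℝ (Fin M) :=
  WithLp.toLp 2 fun i => S.network P (S.x i)

theorem norm_le_sum_abs {n : ℕ} (v : EuclideanSpace ℝ (Fin n)) : ‖v‖ ≤ ∑ i, |v i| := by
  rw [EuclideanSpace.norm_eq]
  refine Real.sqrt_le_iff.2 ⟨Finset.sum_nonneg fun _ _ => abs_nonneg _, ?_⟩
  exact Finset.sum_sq_le_sq_sum_of_nonneg (fun i _ => norm_nonneg (v i))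

theorem GoodRun.norm_outputVec_le {T R : ℝ} {N : ℕ} {P : Params d N₁ N} {z} {ω} {ε p : ℝ}
    (h : S.GoodRun T R P z ω ε p) : ‖S.outputVec P‖ ≤ M * ε := by
  refine (norm_le_sum_abs _).trans ((Finset.sum_le_sum fun i _ => h.output i).trans ?_)
  simp

/-- The total deviation, over the data points, of the network outputs after `k` steps from the
prediction. -/
def deviation (S : Setting d M N₁) {N : ℕ} (P : Params d N₁ N)
    (z : ℕ → EuclideanSpace ℝ (Fin d) × ℝ) (k : ℕ) : ℝ :=
  ∑ i, |S.network (S.sgd P z k) (S.x i) -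
    S.prediction P.W1 (S.outputVec P) ((N : ℝ) ^ (S.γ₂ - 1)) (k / N) i|

theorem deviation_nonneg {N : ℕ} (P : Params d N₁ N) (z : ℕ → EuclideanSpace ℝ (Fin d) × ℝ)
    (k : ℕ) : 0 ≤ S.deviation P z k := Finset.sum_nonneg fun _ _ => abs_nonneg _

theorem abs_network_sub_prediction_le {N : ℕ} (P : Params d N₁ N)
    (z : ℕ → EuclideanSpace ℝ (Fin d) × ℝ) (k : ℕ) (i : Fin M) :
    |S.network (S.sgd P z k) (S.x i) -
      S.prediction P.W1 (S.outputVec P) ((N : ℝ) ^ (S.γ₂ - 1)) (k / N) i| ≤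
      S.deviation P z k :=
  Finset.single_le_sum (f := fun i => |S.network (S.sgd P z k) (S.x i) -
    S.prediction P.W1 (S.outputVec P) ((N : ℝ) ^ (S.γ₂ - 1)) (k / N) i|)
    (fun _ _ => abs_nonneg _) (Finset.mem_univ i)

theorem GoodRun.norm_W1_le {T R : ℝ} {N : ℕ} {P : Params d N₁ N} {z} {ω} {ε p : ℝ}
    (h : S.GoodRun T R P z ω ε p) : ‖P.W1‖ ≤ R := by
  have h1 := h.start ⟨0, h.N_pos⟩
  exact ((norm_snd_le (P.particle ⟨0, h.N_pos⟩).2).trans (norm_snd_le _)).trans h1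

theorem div_mem_Icc {T : ℝ} {N k : ℕ} (hN : 0 < N) (hk : (k : ℝ) ≤ N * T) :
    (k : ℝ) / N ∈ Icc 0 T := by
  have hN' : (0 : ℝ) < N := by exact_mod_cast hN
  exact ⟨by positivity, by rwa [div_le_iff₀ hN', mul_comm]⟩

/-- The predicted correction to h is linear in the initial output and in q, and both are O(ε). -/
theorem abs_network_sub_limitOutput_le {T R L : ℝ} (hB : S.Bound T (R + 1) L) {N : ℕ}
    {P : Params d N₁ N} {z} {ω} {ε p : ℝ} (h : S.GoodRun T R P z ω ε p)
    {k : ℕ} (hk : (k : ℝ) ≤ N * T) (i : Fin M) :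
    |S.network (S.sgd P z k) (S.x i) - S.limitOutput P.W1 (k / N) i| ≤
      S.deviation P z k + L * (M + 1) * ε := by
  have h1 := abs_network_sub_prediction_le (S := S) P z k i
  have h2 := hB.path P.W1 (h.norm_W1_le.trans (by linarith)) _ (div_mem_Icc h.N_pos hk)
    (S.outputVec P) ((N : ℝ) ^ (S.γ₂ - 1)) i
  have h3 : L * (‖S.outputVec P‖ + |(N : ℝ) ^ (S.γ₂ - 1)|) ≤ L * (M * ε + ε) := by
    have := hB.one_le
    rw [abs_of_pos h.step_pos]
    gcongr
    · exact h.norm_outputVec_le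
    · exact h.q_le
  have e : S.network (S.sgd P z k) (S.x i) - S.limitOutput P.W1 (k / N) i =
      (S.network (S.sgd P z k) (S.x i) -
        S.prediction P.W1 (S.outputVec P) ((N : ℝ) ^ (S.γ₂ - 1)) (k / N) i) +
      S.limitPath P.W1 (S.outputVec P) ((N : ℝ) ^ (S.γ₂ - 1)) (k / N) i := by
    simp only [prediction, PiLp.add_apply]; ring
  rw [e]
  refine (abs_add_le _ _).trans ?_
  calc _ ≤ S.deviation P z k + L * (M * ε + ε) := by linarith
    _ = _ := by ring

end Setting
end

noncomputable section

theorem abs_sub_le_of_hasDerivAt {F G : ℝ → ℝ} {T C : ℝ} (hF : ∀ t, HasDerivAt F (G t) t)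
    (hG : ∀ t ∈ Icc 0 T, |G t| ≤ C) {s t : ℝ} (hs : s ∈ Icc 0 T) (ht : t ∈ Icc 0 T) :
    |F s - F t| ≤ C * |s - t| :=
  (convex_Icc 0 T).norm_image_sub_le_of_norm_hasDerivWithin_le
    (fun x _ => (hF x).hasDerivWithinAt) hG ht hs

theorem abs_average_sub_average_le {n : ℕ} (hn : 0 < n) {a b : Fin n → ℝ} {B : ℝ}
    (h : ∀ i, |a i - b i| ≤ B) : |(n : ℝ)⁻¹ * ∑ i, a i - (n : ℝ)⁻¹ * ∑ i, b i| ≤ B := by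
  rw [← mul_sub, ← Finset.sum_sub_distrib]
  exact abs_average_le hn h

theorem abs_mul_sub_mul_le {a b a' b' A B δ δ' : ℝ} (ha : |a - a'| ≤ δ) (hb : |b - b'| ≤ δ')
    (hA : |a| ≤ A) (hB : |b'| ≤ B) : |a * b - a' * b'| ≤ A * δ' + δ * B := by
  have e : a * b - a' * b' = a * (b - b') + (a - a') * b' := by ring
  rw [e]
  refine (abs_add_le _ _).trans (add_le_add ?_ ?_)
  · rw [abs_mul]
    exact mul_le_mul hA hb (abs_nonneg _) ((abs_nonneg _).trans hA)
  · rw [abs_mul]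
    exact mul_le_mul ha hB (abs_nonneg _) ((abs_nonneg _).trans ha)

namespace Setting

variable {d M N₁ : ℕ} {S : Setting d M N₁}

/-! ### Regularity in time of the limiting objects -/

theorem Bound.abs_y_sub_output_le {T R L : ℝ} (hB : S.Bound T R L) {w : FirstLayer d N₁}
    (hw : ‖w‖ ≤ R) {t : ℝ} (ht : t ∈ Icc 0 T) (m : Fin M) :
    |S.y m - S.limitOutput w t m| ≤ 2 * L :=
  (abs_sub _ _).trans ((add_le_add (hB.y m) (hB.output w hw t ht m)).trans_eq (by ring))

theorem hasDerivAt_limitOutput_apply (w : FirstLayer d N₁) (t : ℝ) (i : Fin M) :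
    HasDerivAt (fun t => S.limitOutput w t i)
      ((M : ℝ)⁻¹ * ∑ m, (S.y m - S.limitOutput w t m) * S.A w (S.x i) (S.x m)) t := by
  have h := (EuclideanSpace.proj (𝕜 := ℝ) i).hasFDerivAt.comp_hasDerivAt t
    (S.hasDerivAt_limitOutput w t)
  refine h.congr_deriv ?_
  change S.dataOp w (WithLp.toLp 2 S.y - S.limitOutput w t) i = _
  rw [dataOp_apply]
  simp

theorem Bound.abs_limitOutput_sub_le {T R L : ℝ} (hB : S.Bound T R L) {w : FirstLayer d N₁}
    (hw : ‖w‖ ≤ R) {s t : ℝ} (hs : s ∈ Icc 0 T) (ht : t ∈ Icc 0 T) (i : Fin M) :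
    |S.limitOutput w s i - S.limitOutput w t i| ≤ 2 * L ^ 2 * |s - t| := by
  refine abs_sub_le_of_hasDerivAt (fun t => hasDerivAt_limitOutput_apply w t i)
    (fun r hr => abs_average_le i.pos fun m => ?_) hs ht
  rw [abs_mul]
  calc _ ≤ 2 * L * L := by
        have := hB.one_le
        gcongr
        · exact hB.abs_y_sub_output_le hw hr m
        · exact hB.A w hw i m
    _ = _ := by ring

theorem hasDerivAt_kernRate (w : FirstLayer d N₁) (t : ℝ) (x x' : EuclideanSpace ℝ (Fin d)) :
    HasDerivAt (fun t => S.kernRate w t x x') ((M : ℝ)⁻¹ * ∑ m', (S.y m' - S.limitOutput w t m') *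
      ∫ θ, S.transport (S.kern x x') (S.x m') θ ∂S.γ₀ w) t := by
  have h1 := S.continuous_limitOutput w
  have hc : Continuous fun t => (M : ℝ)⁻¹ * ∑ m', (S.y m' - S.limitOutput w t m') *
      ∫ θ, S.transport (S.kern x x') (S.x m') θ ∂S.γ₀ w := by fun_prop
  exact intervalIntegral.integral_hasDerivAt_right (hc.intervalIntegrable _ _)
    (hc.stronglyMeasurableAtFilter _ _) hc.continuousAt

theorem Bound.abs_kernRate_sub_le {T R L : ℝ} (hB : S.Bound T R L) {w : FirstLayer d N₁}
    (hw : ‖w‖ ≤ R) {s t : ℝ} (hs : s ∈ Icc 0 T) (ht : t ∈ Icc 0 T) (i m : Fin M) :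
    |S.kernRate w s (S.x i) (S.x m) - S.kernRate w t (S.x i) (S.x m)| ≤ 2 * L ^ 2 * |s - t| := by
  refine abs_sub_le_of_hasDerivAt (fun t => hasDerivAt_kernRate w t _ _)
    (fun r hr => abs_average_le i.pos fun m' => ?_) hs ht
  rw [abs_mul]
  calc _ ≤ 2 * L * L := by
        have := hB.one_le
        gcongr
        · exact hB.abs_y_sub_output_le hw hr m'
        · exact hB.integral_transport w hw i m m'
    _ = _ := by ring

theorem kernRate_zero (w : FirstLayer d N₁) (x x' : EuclideanSpace ℝ (Fin d)) :
    S.kernRate w 0 x x' = 0 := by simp [kernRate]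

/-- The Riemann sums of `kernRate`. -/
theorem Bound.abs_kernRate_sub_sum_le {T R L : ℝ} (hB : S.Bound T R L) {w : FirstLayer d N₁}
    (hw : ‖w‖ ≤ R) {N k : ℕ} (hN : 0 < N) (hk : (k : ℝ) ≤ N * T) (i m : Fin M) :
    |S.kernRate w (k / N) (S.x i) (S.x m) - (N : ℝ)⁻¹ * ∑ l ∈ Finset.range k,
      (M : ℝ)⁻¹ * ∑ m', (S.y m' - S.limitOutput w (l / N) m') *
        ∫ θ, S.transport (S.kern (S.x i) (S.x m)) (S.x m') θ ∂S.γ₀ w| ≤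
      2 * L ^ 3 * T * (1 / N) := by
  have hL := hB.one_le
  have := abs_sub_riemannSum_le (T := T) (C := 2 * L ^ 3)
    (fun t => hasDerivAt_kernRate (S := S) w t (S.x i) (S.x m)) ?_ hN hk (by positivity)
  · simpa [kernRate_zero] using this
  · intro s hs t ht
    refine abs_average_sub_average_le i.pos fun m' => ?_
    rw [← sub_mul, abs_mul, sub_sub_sub_cancel_left, abs_sub_comm]
    calc _ ≤ 2 * L ^ 2 * |s - t| * L := by
          gcongr
          · exact hB.abs_limitOutput_sub_le hw hs ht m'
          · exact hB.integral_transport w hw i m m'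
      _ = _ := by ring

theorem Bound.abs_y_sub_prediction_le {T R L : ℝ} (hB : S.Bound T R L)
    {w : FirstLayer d N₁} {g₀ : EuclideanSpace ℝ (Fin M)} {b : ℝ} (hw : ‖w‖ ≤ R)
    (hg : ‖g₀‖ ≤ M) (hb : |b| ≤ 1) {t : ℝ} (ht : t ∈ Icc 0 T) (m : Fin M) :
    |S.y m - S.prediction w g₀ b t m| ≤ L * (M + 3) := by
  have hL := hB.one_le
  have h1 := hB.abs_y_sub_output_le hw ht m
  have h2 := hB.path w hw t ht g₀ b m
  have h3 : L * (‖g₀‖ + |b|) ≤ L * (M + 1) := by gcongr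
  have e : S.y m - S.prediction w g₀ b t m =
      (S.y m - S.limitOutput w t m) - S.limitPath w g₀ b t m := by
    simp only [prediction, PiLp.add_apply]; ring
  rw [e]
  refine (abs_sub _ _).trans ?_
  calc _ ≤ 2 * L + L * (M + 1) := by linarith
    _ = _ := by ring

section

variable [IsProbabilityMeasure S.μC] [IsProbabilityMeasure S.μW]

/-- The term (y - h) A of the first equation and -K A of the second combine to (y - h - K) A. The
prediction is thus driven by its own residual against A, with a correction of strength b in which
the residual is that of h alone. -/
theorem hasDerivAt_prediction (hS : S.Regular) (w : FirstLayer d N₁)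
    (g₀ : EuclideanSpace ℝ (Fin M)) (b t : ℝ) (i : Fin M) :
    HasDerivAt (fun t => S.prediction w g₀ b t i)
      ((M : ℝ)⁻¹ * ∑ m, ((S.y m - S.prediction w g₀ b t m) * S.A w (S.x i) (S.x m) +
        b * ((S.y m - S.limitOutput w t m) * S.kernRate w t (S.x i) (S.x m)))) t := by
  have h := (hasDerivAt_limitOutput_apply (S := S) w t i).add
    (hasDerivAt_limitPath_apply hS w g₀ b t i)
  refine h.congr_deriv ?_
  rw [forcing_eq hS]
  simp only [prediction, PiLp.add_apply]
  rw [mul_left_comm, ← mul_sub, ← mul_add, Finset.mul_sum, ← Finset.sum_sub_distrib,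
    ← Finset.sum_add_distrib]
  congr 1
  exact Finset.sum_congr rfl fun m _ => by ring

variable {T R L : ℝ} {w : FirstLayer d N₁} {g₀ : EuclideanSpace ℝ (Fin M)} {b : ℝ}

theorem Bound.abs_prediction_sub_le (hS : S.Regular) (hB : S.Bound T R L)
    (hw : ‖w‖ ≤ R) (hg : ‖g₀‖ ≤ M) (hb : |b| ≤ 1) {s t : ℝ} (hs : s ∈ Icc 0 T) (ht : t ∈ Icc 0 T)
    (i : Fin M) :
    |S.prediction w g₀ b s i - S.prediction w g₀ b t i| ≤ L ^ 2 * (M + 5) * |s - t| := by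
  have hL := hB.one_le
  refine abs_sub_le_of_hasDerivAt (fun t => hasDerivAt_prediction hS w g₀ b t i)
    (fun r hr => abs_average_le i.pos fun m => ?_) hs ht
  refine (abs_add_le _ _).trans ?_
  rw [abs_mul, abs_mul, abs_mul]
  calc _ ≤ L * (M + 3) * L + 1 * (2 * L * L) := by
        gcongr
        · exact hB.abs_y_sub_prediction_le hw hg hb hr m
        · exact hB.A w hw i m
        · exact hB.abs_y_sub_output_le hw hr m
        · exact hB.rate w hw r hr i m
    _ = _ := by ring

/-- The Riemann sums of the derivative of the prediction. -/
theorem Bound.abs_prediction_sub_sum_le (hS : S.Regular) (hB : S.Bound T R L)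
    (hw : ‖w‖ ≤ R) (hg : ‖g₀‖ ≤ M) (hb : |b| ≤ 1) {N k : ℕ} (hN : 0 < N) (hk : (k : ℝ) ≤ N * T)
    (i : Fin M) :
    |S.prediction w g₀ b (k / N) i - g₀ i - (N : ℝ)⁻¹ * ∑ l ∈ Finset.range k,
      (M : ℝ)⁻¹ * ∑ m, ((S.y m - S.prediction w g₀ b (l / N) m) * S.A w (S.x i) (S.x m) +
        b * ((S.y m - S.limitOutput w (l / N) m) * S.kernRate w (l / N) (S.x i) (S.x m)))| ≤
      (L ^ 3 * (M + 11)) * T * (1 / N) := by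
  have hL := hB.one_le
  have := abs_sub_riemannSum_le (T := T) (C := L ^ 3 * (M + 11))
    (fun t => hasDerivAt_prediction hS w g₀ b t i) ?_ hN hk (by positivity)
  · have e : S.prediction w g₀ b 0 i = g₀ i := by
      simp [prediction, limitPath_zero, limitOutput]
    rwa [e] at this
  · intro s hs t ht
    refine abs_average_sub_average_le i.pos fun m => ?_
    have h1 : |(S.y m - S.prediction w g₀ b s m) * S.A w (S.x i) (S.x m) -
        (S.y m - S.prediction w g₀ b t m) * S.A w (S.x i) (S.x m)| ≤
        L ^ 2 * (M + 5) * |s - t| * L := by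
      rw [← sub_mul, abs_mul, sub_sub_sub_cancel_left, abs_sub_comm]
      gcongr
      · exact hB.abs_prediction_sub_le hS hw hg hb hs ht m
      · exact hB.A w hw i m
    have h2 : |(S.y m - S.limitOutput w s m) * S.kernRate w s (S.x i) (S.x m) -
        (S.y m - S.limitOutput w t m) * S.kernRate w t (S.x i) (S.x m)| ≤
        2 * L * (2 * L ^ 2 * |s - t|) + 2 * L ^ 2 * |s - t| * L := by
      refine abs_mul_sub_mul_le ?_ (hB.abs_kernRate_sub_le hw hs ht i m)
        (hB.abs_y_sub_output_le hw hs m) (hB.rate w hw t ht i m)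
      rw [sub_sub_sub_cancel_left, abs_sub_comm]
      exact hB.abs_limitOutput_sub_le hw hs ht m
    rw [add_sub_add_comm, ← mul_sub]
    refine (abs_add_le _ _).trans ?_
    rw [abs_mul b]
    calc _ ≤ L ^ 2 * (M + 5) * |s - t| * L + 1 *
          (2 * L * (2 * L ^ 2 * |s - t|) + 2 * L ^ 2 * |s - t| * L) := by gcongr
      _ = _ := by ring

end

/-- Second-order expansion of the empirical kernel along the run. -/
theorem exists_mean_kern_sub_le [IsProbabilityMeasure S.μC] [IsProbabilityMeasure S.μW]
    (hS : S.Regular) {T R L C : ℝ} (hT : 0 ≤ T) (hC : 1 ≤ C) (hB : S.Bound T (R + 1) L) :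
    ∃ D : ℝ, 0 ≤ D ∧ ∀ {N : ℕ} {P : Params d N₁ N} {z} {ω} {ε p : ℝ},
      S.GoodRun T R P z ω ε p → S.StableRun T (R + 1) C P z → ∀ k : ℕ, (k : ℝ) ≤ N * T →
      ∀ i m, |(S.sgd P z k).mean (S.kern (S.x i) (S.x m)) - (S.A P.W1 (S.x i) (S.x m) +
        (N : ℝ) ^ (S.γ₂ - 1) * S.kernRate P.W1 (k / N) (S.x i) (S.x m))| ≤
        D * (ε * (p + (N : ℝ) ^ (S.γ₂ - 1))) +
          D / N * ∑ l ∈ Finset.range k, S.deviation P z l := by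
  have hL := hB.one_le
  have hL0 : 0 ≤ L := by linarith
  have hC0 : 0 ≤ C := by linarith
  -- Sources of error: D1 the Taylor expansion, D2 the sample noise, D3 the Riemann sum, D4 the
  -- distance of the prediction from h.
  set D1 : ℝ := L * C ^ 2 + L * (3 * T * C ^ 2 * L ^ 2)
  set D2 : ℝ := M * (C * L + T * (C * L))
  set D3 : ℝ := 2 * L ^ 3 * T
  set D4 : ℝ := T * (L * (L * (M + 1)))
  have h1 : 0 ≤ D1 := by positivity
  have h2 : 0 ≤ D2 := by positivity
  have h3 : 0 ≤ D3 := by positivity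
  have h4 : 0 ≤ D4 := by positivity
  refine ⟨1 + D1 + T * C + D2 + D3 + D4 + L, by positivity, ?_⟩
  intro N P z ω ε p h hs k hk i m
  have hN := h.N_pos
  have hN' : (0 : ℝ) < N := by exact_mod_cast hN
  have hq0 := h.step_pos
  have hε := h.ε_nonneg
  have hp := h.p_nonneg
  have hq1 : (N : ℝ) ^ (S.γ₂ - 1) ≤ 1 := h.q_le.trans h.ε_le
  have hw : ‖P.W1‖ ≤ R + 1 := h.norm_W1_le.trans (by linarith)
  set w := P.W1 with hw_def
  set q : ℝ := (N : ℝ) ^ (S.γ₂ - 1) with hq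
  set f := S.kern (N₁ := N₁) (S.x i) (S.x m) with hf
  set τ : EuclideanSpace ℝ (Fin d) → ℝ := fun x' => ∫ θ, S.transport f x' θ ∂S.γ₀ w with hτ
  set r : ℕ → EuclideanSpace ℝ (Fin d) × ℝ → ℝ :=
    fun l y => y.2 - S.network (S.sgd P z l) y.1 with hr
  have hle : ∀ l < k, (l : ℝ) ≤ N * T := fun l hl => le_trans (by exact_mod_cast hl.le) hk
  -- `E1` to `E6` replace, in turn: the current mean by its expansion, the initial mean by A, the
  -- empirical transport by its limit, the samples by their average, the residuals by those of h,
  -- and the Riemann sum by `kernRate`.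
  have E1 := abs_mean_expansion_le hS.pos hC hB h hs hT (hB.kern i m) hk
  have E2 := h.kern i m
  rw [← A_eq hS] at E2
  have E3 : |∑ l ∈ Finset.range k, q / N * r l (z l) * P.mean (S.transport f (z l).1) -
      ∑ l ∈ Finset.range k, q / N * r l (z l) * τ (z l).1| ≤ T * C * (q * (ε * p)) := by
    rw [← Finset.sum_sub_distrib]
    refine (abs_sum_range_le (B := q / N * C * (ε * p)) fun l hl => ?_).trans ?_
    · obtain ⟨m', hm'⟩ := h.sample l
      rw [← mul_sub, abs_mul, abs_mul, abs_of_nonneg (by positivity : (0 : ℝ) ≤ q / N)]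
      gcongr
      · exact h.residual_sample hs (hle l hl)
      · rw [hm']; exact h.transport i m m'
    · calc (k : ℝ) * (q / N * C * (ε * p)) ≤ N * T * (q / N * C * (ε * p)) := by gcongr
        _ = _ := by field_simp
  -- Summation by parts applies because the outputs, and so the residuals, change by at most C/N per
  -- step.
  have E4 : |∑ l ∈ Finset.range k, (r l (z l) * τ (z l).1 -
      (M : ℝ)⁻¹ * ∑ m', r l (S.x m', S.y m') * τ (S.x m'))| ≤ D2 * (ε * p * N) := by
    have := h.abs_sum_sample_sub_le (a := fun l y => r l y * τ y.1) (B := C * L) (c := C * L)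
      (by positivity) hk ?_ ?_
    · refine this.trans (le_of_eq ?_)
      simp only [D2]; ring
    · intro l hl m'
      simp only [abs_mul]
      exact mul_le_mul (hs.abs_residual_le l (le_trans (by exact_mod_cast hl) hk) m')
        (hB.integral_transport w hw i m m') (abs_nonneg _) hC0
    · intro l hl m'
      simp only [hr]
      rw [← sub_mul, sub_sub_sub_cancel_left, abs_mul, abs_sub_comm]
      calc _ ≤ C * (1 / N) * L := by
            gcongr
            · exact hs.abs_network_step_le l (le_trans (by exact_mod_cast hl) hk) m'
            · exact hB.integral_transport w hw i m m'
        _ = _ := by ring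
  -- Only here does the deviation from the prediction enter; the outer factor q/N ≤ 1/N gives it the
  -- size needed for Gronwall.
  have E5 : |∑ l ∈ Finset.range k, ((M : ℝ)⁻¹ * ∑ m', r l (S.x m', S.y m') * τ (S.x m') -
      (M : ℝ)⁻¹ * ∑ m', (S.y m' - S.limitOutput w (l / N) m') * τ (S.x m'))| ≤
      L * ∑ l ∈ Finset.range k, S.deviation P z l + N * (D4 * ε) := by
    refine (Finset.abs_sum_le_sum_abs _ _).trans ?_
    have : ∀ l ∈ Finset.range k, |(M : ℝ)⁻¹ * ∑ m', r l (S.x m', S.y m') * τ (S.x m') -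
      (M : ℝ)⁻¹ * ∑ m', (S.y m' - S.limitOutput w (l / N) m') * τ (S.x m')| ≤
        L * S.deviation P z l + L * (L * (M + 1)) * ε := by
      intro l hl
      refine abs_average_sub_average_le i.pos fun m' => ?_
      simp only [hr]
      rw [← sub_mul, sub_sub_sub_cancel_left, abs_mul, abs_sub_comm]
      have hdev := deviation_nonneg (S := S) P z l
      calc _ ≤ (S.deviation P z l + L * (M + 1) * ε) * L := by
            gcongr
            · exact abs_network_sub_limitOutput_le hB h (hle l (Finset.mem_range.1 hl)) m'
            · exact hB.integral_transport w hw i m m'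
        _ = _ := by ring
    refine (Finset.sum_le_sum this).trans ?_
    rw [Finset.sum_add_distrib, ← Finset.mul_sum, Finset.sum_const, Finset.card_range,
      nsmul_eq_mul]
    have : (k : ℝ) * (L * (L * (M + 1)) * ε) ≤ N * (D4 * ε) :=
      calc (k : ℝ) * (L * (L * (M + 1)) * ε) ≤ N * T * (L * (L * (M + 1)) * ε) := by gcongr
        _ = _ := by simp only [D4]; ring
    linarith
  have E6 := hB.abs_kernRate_sub_sum_le hw hN hk i m
  set dev := ∑ l ∈ Finset.range k, S.deviation P z l with hdev
  set s0 := ∑ l ∈ Finset.range k, q / N * r l (z l) * P.mean (S.transport f (z l).1) with hs0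
  have es1 : ∑ l ∈ Finset.range k, q / N * r l (z l) * τ (z l).1 =
      q / N * ∑ l ∈ Finset.range k, r l (z l) * τ (z l).1 := by
    rw [Finset.mul_sum]; exact Finset.sum_congr rfl fun l _ => by ring
  rw [es1] at E3
  rw [Finset.sum_sub_distrib] at E4 E5
  set s1 := ∑ l ∈ Finset.range k, r l (z l) * τ (z l).1
  set s2 := ∑ l ∈ Finset.range k, (M : ℝ)⁻¹ * ∑ m', r l (S.x m', S.y m') * τ (S.x m')
  set s3 := ∑ l ∈ Finset.range k, (M : ℝ)⁻¹ * ∑ m', (S.y m' - S.limitOutput w (l / N) m') *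
    τ (S.x m')
  set X := (S.sgd P z k).mean f
  have e : X - (S.A w (S.x i) (S.x m) + q * S.kernRate w (k / N) (S.x i) (S.x m)) =
      (X - P.mean f - s0) + (P.mean f - S.A w (S.x i) (S.x m)) + (s0 - q / N * s1) +
      q / N * (s1 - s2) + q / N * (s2 - s3) -
      q * (S.kernRate w (k / N) (S.x i) (S.x m) - (N : ℝ)⁻¹ * s3) := by
    field_simp; ring
  have F4 : |q / N * (s1 - s2)| ≤ D2 * (ε * p) := by
    rw [abs_mul, abs_of_nonneg (by positivity : (0 : ℝ) ≤ q / N)]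
    calc _ ≤ q / N * (D2 * (ε * p * N)) := by gcongr
      _ = q * (D2 * (ε * p)) := by field_simp
      _ ≤ 1 * (D2 * (ε * p)) := by gcongr
      _ = _ := one_mul _
  have F5 : |q / N * (s2 - s3)| ≤ L / N * dev + D4 * (q * ε) := by
    rw [abs_mul, abs_of_nonneg (by positivity : (0 : ℝ) ≤ q / N)]
    have hd0 : 0 ≤ dev := Finset.sum_nonneg fun l _ => deviation_nonneg _ _ _
    calc _ ≤ q / N * (L * dev + N * (D4 * ε)) := by gcongr
      _ = q * (L / N * dev) + D4 * (q * ε) := by field_simp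
      _ ≤ 1 * (L / N * dev) + D4 * (q * ε) := by gcongr
      _ = _ := by rw [one_mul]
  have F6 : |q * (S.kernRate w (k / N) (S.x i) (S.x m) - (N : ℝ)⁻¹ * s3)| ≤ D3 * (ε * p) := by
    rw [abs_mul, abs_of_pos hq0]
    calc _ ≤ 1 * (D3 * (1 / N)) := by gcongr
      _ ≤ 1 * (D3 * (ε * p)) := by gcongr; exact h.inv_le
      _ = _ := one_mul _
  have F3 : T * C * (q * (ε * p)) ≤ T * C * (ε * p) := by
    exact mul_le_mul_of_nonneg_left (mul_le_of_le_one_left (by positivity) hq1) (by positivity)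
  rw [e]
  have hd0 : 0 ≤ dev := Finset.sum_nonneg fun l _ => deviation_nonneg _ _ _
  have T1 := abs_sub ((X - P.mean f - s0) + (P.mean f - S.A w (S.x i) (S.x m)) +
    (s0 - q / N * s1) + q / N * (s1 - s2) + q / N * (s2 - s3))
      (q * (S.kernRate w (k / N) (S.x i) (S.x m) - (N : ℝ)⁻¹ * s3))
  have T2 := abs_add_le ((X - P.mean f - s0) + (P.mean f - S.A w (S.x i) (S.x m)) +
    (s0 - q / N * s1) + q / N * (s1 - s2)) (q / N * (s2 - s3))
  have T3 := abs_add_le ((X - P.mean f - s0) + (P.mean f - S.A w (S.x i) (S.x m)) +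
    (s0 - q / N * s1)) (q / N * (s1 - s2))
  have T4 := abs_add_le ((X - P.mean f - s0) + (P.mean f - S.A w (S.x i) (S.x m)))
    (s0 - q / N * s1)
  have T5 := abs_add_le (X - P.mean f - s0) (P.mean f - S.A w (S.x i) (S.x m))
  have hup : ∀ {a c : ℝ}, 0 ≤ a → 0 ≤ c → a ≤ c → a * (ε * p) ≤ c * (ε * p) :=
    fun _ _ hac => mul_le_mul_of_nonneg_right hac (by positivity)
  calc _ ≤ D1 * (q * ε) + ε * p + T * C * (ε * p) + D2 * (ε * p) +
        (L / N * dev + D4 * (q * ε)) + D3 * (ε * p) := by linarith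
    _ = (D1 + D4) * (q * ε) + (1 + T * C + D2 + D3) * (ε * p) + L / N * dev := by ring
    _ ≤ (1 + D1 + T * C + D2 + D3 + D4 + L) * (q * ε) +
        (1 + D1 + T * C + D2 + D3 + D4 + L) * (ε * p) +
        (1 + D1 + T * C + D2 + D3 + D4 + L) / N * dev := by
      have : 0 ≤ T * C := by positivity
      gcongr ?_ * _ + ?_ * _ + ?_ / _ * _ <;> linarith
    _ = _ := by ring

end Setting
end

noncomputable section

namespace Setting

variable {d M N₁ : ℕ} {S : Setting d M N₁}

/-! ### The network outputs follow the prediction -/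

/-- First-order expansion of one step of the network outputs. -/
theorem abs_network_step_sub_le (hσ : ContDiff ℝ (⊤ : ℕ∞) S.σ) (hN₁ : 0 < N₁) {T R L C : ℝ}
    (hC : 1 ≤ C) (hB : S.Bound T R L) {R' : ℝ} {N : ℕ} {P : Params d N₁ N} {z} {ω} {ε p : ℝ}
    (h : S.GoodRun T R' P z ω ε p) (hs : S.StableRun T R C P z) (hT : 0 ≤ T) {l : ℕ}
    (hl : ((l + 1 : ℕ) : ℝ) ≤ N * T) (i : Fin M) :
    |S.network (S.sgd P z (l + 1)) (S.x i) - S.network (S.sgd P z l) (S.x i) -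
      (N : ℝ)⁻¹ * (((z l).2 - S.network (S.sgd P z l) (z l).1) *
        (S.sgd P z l).mean (S.kern (S.x i) (z l).1))| ≤
      (L * C ^ 2 + 3 * C * L * (L * C) ^ 2) / N * (ε * (p + (N : ℝ) ^ (S.γ₂ - 1))) := by
  have hL := hB.one_le
  have hL0 : 0 ≤ L := by linarith
  have hC0 : 0 ≤ C := by linarith
  have hN := h.N_pos
  have hN' : (0 : ℝ) < N := by exact_mod_cast hN
  have hq0 := h.step_pos
  have hε := h.ε_nonneg
  have hp := h.p_nonneg
  have hl' : (l : ℝ) ≤ N * T := le_trans (by push_cast; linarith) hl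
  set q : ℝ := (N : ℝ) ^ (S.γ₂ - 1) with hq
  set Q := S.sgd P z l with hQ
  obtain ⟨m, hm⟩ := h.sample l
  have hr := h.residual_sample hs hl'
  set r := (z l).2 - S.network Q (z l).1 with hr_def
  set ρ : Fin N₁ → ℝ := fun j => Q.mean (S.B3 j (S.x m)) with hρ
  set X := (S.sgd P z (l + 1)) with hX
  have hstep : ∀ n, X.particle n - Q.particle n = (q / N * r) •
      (S.drift (S.x m) (Q.particle n) + S.shift ρ (S.x m)) := by
    intro n
    rw [hX, sgd, particle_sgdStep S hN₁ hN, add_sub_cancel_left, ← hr_def, hm]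
  have e1 : ∀ n, fderiv ℝ (S.unit (S.x i)) (Q.particle n) (X.particle n - Q.particle n) =
      q / N * r * (S.kern (S.x i) (S.x m) (Q.particle n) +
        1 / N₁ * inner ℝ (S.x m) (S.x i) * ∑ j, ρ j * S.B3 j (S.x i) (Q.particle n)) := by
    intro n
    rw [hstep, map_smul, map_add, fderiv_unit_drift S hσ hN₁, fderiv_unit_shift S hσ hN₁,
      smul_eq_mul]
  -- Second-order remainder of a single step, whose length is C q/N.
  have h1 : ∀ n, |S.unit (S.x i) (X.particle n) - S.unit (S.x i) (Q.particle n) -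
      q / N * r * (S.kern (S.x i) (S.x m) (Q.particle n) +
        1 / N₁ * inner ℝ (S.x m) (S.x i) * ∑ j, ρ j * S.B3 j (S.x i) (Q.particle n))| ≤
      L * (C * (q / N)) ^ 2 := by
    intro n
    have := ((hB.unit i) _ _ (hs.norm_le l hl' n) (hs.norm_le (l + 1) hl n)).2.2.2
    rw [e1] at this
    refine this.trans ?_
    gcongr
    exact hs.norm_step_le l hl n
  have h2 := abs_average_le hN h1
  have e2 : (N : ℝ)⁻¹ * ∑ n, (S.unit (S.x i) (X.particle n) - S.unit (S.x i) (Q.particle n) -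
      q / N * r * (S.kern (S.x i) (S.x m) (Q.particle n) +
        1 / N₁ * inner ℝ (S.x m) (S.x i) * ∑ j, ρ j * S.B3 j (S.x i) (Q.particle n))) =
      X.mean (S.unit (S.x i)) - Q.mean (S.unit (S.x i)) -
      q / N * r * (Q.mean (S.kern (S.x i) (S.x m)) + inner ℝ (S.x m) (S.x i) *
        ((N₁ : ℝ)⁻¹ * ∑ j, ρ j * Q.mean (S.B3 j (S.x i)))) := by
    have e3 : ∑ j, ρ j * Q.mean (S.B3 j (S.x i)) =
        (N : ℝ)⁻¹ * ∑ n, ∑ j, ρ j * S.B3 j (S.x i) (Q.particle n) := by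
      simp only [Params.mean, Finset.mul_sum]
      rw [Finset.sum_comm]
      exact Finset.sum_congr rfl fun _ _ => Finset.sum_congr rfl fun _ _ => by ring
    rw [e3, Finset.sum_sub_distrib, Finset.sum_sub_distrib, ← Finset.mul_sum,
      Finset.sum_add_distrib, ← Finset.mul_sum]
    simp only [Params.mean]
    ring
  rw [e2] at h2
  set τ := (N₁ : ℝ)⁻¹ * ∑ j, ρ j * Q.mean (S.B3 j (S.x i)) with hτ
  have hδ : (0 : ℝ) ≤ ε * p + q := by positivity
  -- One factor is the coefficient with which the first layer moves, the other is the response of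
  -- the output; both are small means of B³.
  have h3 : |τ| ≤ (L * C * (ε * p + q)) ^ 2 := by
    refine abs_average_le hN₁ fun j => ?_
    rw [abs_mul, sq]
    exact mul_le_mul (abs_mean_B3_le hC hB h hs hT hl' j m)
      (abs_mean_B3_le hC hB h hs hT hl' j i) (abs_nonneg _) (by positivity)
  -- Expand the square and use ε ≤ 1, p ≤ 1 and q ≤ ε.
  have h4 : (ε * p + q) ^ 2 ≤ 3 * (ε * (p + q)) := by
    have a1 : ε * p * (ε * p) ≤ ε * p * 1 :=
      mul_le_mul_of_nonneg_left (mul_le_one₀ h.ε_le hp h.p_le) (by positivity)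
    have a2 : ε * q * p ≤ ε * q * 1 := mul_le_mul_of_nonneg_left h.p_le (by positivity)
    have a3 : q * q ≤ ε * q := mul_le_mul_of_nonneg_right h.q_le hq0.le
    nlinarith [mul_nonneg hε hp]
  have e4 : S.network X (S.x i) - S.network Q (S.x i) -
      (N : ℝ)⁻¹ * (r * Q.mean (S.kern (S.x i) (z l).1)) =
      q⁻¹ * (X.mean (S.unit (S.x i)) - Q.mean (S.unit (S.x i)) -
      q / N * r * (Q.mean (S.kern (S.x i) (S.x m)) + inner ℝ (S.x m) (S.x i) * τ)) +
      (N : ℝ)⁻¹ * (r * (inner ℝ (S.x m) (S.x i) * τ)) := by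
    rw [network_eq_mean S hN, network_eq_mean S hN, hm]
    field_simp
    ring
  rw [e4]
  refine (abs_add_le _ _).trans ?_
  -- Dividing the remainder of order q²/N² by q leaves q/N², and 1/N ≤ ε p turns this into 1/N times
  -- a small quantity.
  have h5 : |q⁻¹ * (X.mean (S.unit (S.x i)) - Q.mean (S.unit (S.x i)) -
      q / N * r * (Q.mean (S.kern (S.x i) (S.x m)) + inner ℝ (S.x m) (S.x i) * τ))| ≤
      L * C ^ 2 / N * (ε * (p + q)) := by
    rw [abs_mul, abs_of_pos (inv_pos.2 hq0)]
    calc _ ≤ q⁻¹ * (L * (C * (q / N)) ^ 2) := by gcongr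
      _ = L * C ^ 2 / N * (1 / N * q) := by field_simp
      _ ≤ L * C ^ 2 / N * (ε * (p + q)) := by
        refine mul_le_mul_of_nonneg_left ?_ (by positivity)
        have a1 : 1 / (N : ℝ) * q ≤ ε * p * q := mul_le_mul_of_nonneg_right h.inv_le hq0.le
        have a2 : ε * q * p ≤ ε * q * 1 := mul_le_mul_of_nonneg_left h.p_le (by positivity)
        nlinarith [mul_nonneg hε hp]
  have h6 : |(N : ℝ)⁻¹ * (r * (inner ℝ (S.x m) (S.x i) * τ))| ≤
      3 * C * L * (L * C) ^ 2 / N * (ε * (p + q)) := by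
    rw [abs_mul, abs_of_pos (inv_pos.2 hN'), abs_mul, abs_mul]
    calc _ ≤ (N : ℝ)⁻¹ * (C * (L * (L * C * (ε * p + q)) ^ 2)) := by
          gcongr
          exact hB.gram m i
      _ = (N : ℝ)⁻¹ * (C * (L * ((L * C) ^ 2 * (ε * p + q) ^ 2))) := by ring
      _ ≤ (N : ℝ)⁻¹ * (C * (L * ((L * C) ^ 2 * (3 * (ε * (p + q)))))) := by gcongr
      _ = _ := by ring
  calc _ ≤ L * C ^ 2 / N * (ε * (p + q)) + 3 * C * L * (L * C) ^ 2 / N * (ε * (p + q)) :=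
        add_le_add h5 h6
    _ = _ := by ring

/-- The outputs and the prediction satisfy the same recursion up to errors O(ε(p + q)). The
deviation feeds back through the residual and through the empirical kernel, in both cases as an
average over past steps, and Gronwall's inequality closes the estimate. -/
theorem exists_deviation_le [IsProbabilityMeasure S.μC] [IsProbabilityMeasure S.μW]
    (hS : S.Regular) {T R L C : ℝ} (hT : 0 ≤ T) (hC : 1 ≤ C) (hB : S.Bound T (R + 1) L) :
    ∃ D : ℝ, 0 ≤ D ∧ ∀ {N : ℕ} {P : Params d N₁ N} {z} {ω} {ε p : ℝ},
      S.GoodRun T R P z ω ε p → S.StableRun T (R + 1) C P z → ∀ k : ℕ, (k : ℝ) ≤ N * T →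
      S.deviation P z k ≤ D * (ε * (p + (N : ℝ) ^ (S.γ₂ - 1))) := by
  obtain ⟨D', hD', hkern⟩ := exists_mean_kern_sub_le hS hT hC hB
  have hL := hB.one_le
  have hL0 : 0 ≤ L := by linarith
  have hC0 : 0 ≤ C := by linarith
  set D1 : ℝ := T * (L * C ^ 2 + 3 * C * L * (L * C) ^ 2) with hD1
  set D2 : ℝ := T * C * D' with hD2
  set D3 : ℝ := M * (C * (2 * L) + T * (C * (2 * L ^ 2) + C * (2 * L))) with hD3
  set D4 : ℝ := T * (L ^ 2 * (M + 1)) with hD4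
  set D5 : ℝ := L ^ 3 * (M + 11) * T with hD5
  have p1 : 0 ≤ D1 := by positivity
  have p2 : 0 ≤ D2 := by positivity
  have p3 : 0 ≤ D3 := by positivity
  have p4 : 0 ≤ D4 := by positivity
  have p5 : 0 ≤ D5 := by positivity
  set a : ℝ := M * (D1 + D2 + D3 + D4 + D5) with ha
  set b : ℝ := M * (D2 + 2 * L) with hb
  refine ⟨a * Real.exp (b * T), by positivity, ?_⟩
  intro N P z ω ε p h hs K hK
  have hN := h.N_pos
  have hN' : (0 : ℝ) < N := by exact_mod_cast hN
  have hq0 := h.step_pos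
  have hε := h.ε_nonneg
  have hp := h.p_nonneg
  have hq1 : (N : ℝ) ^ (S.γ₂ - 1) ≤ 1 := h.q_le.trans h.ε_le
  have hw : ‖P.W1‖ ≤ R + 1 := h.norm_W1_le.trans (by linarith)
  have hg0 : ‖S.outputVec P‖ ≤ M := h.norm_outputVec_le.trans
    (mul_le_of_le_one_right (by positivity) h.ε_le)
  set w := P.W1 with hw_def
  set q : ℝ := (N : ℝ) ^ (S.γ₂ - 1) with hq
  have hqabs : |q| ≤ 1 := by rwa [abs_of_pos hq0]
  set E : ℝ := ε * (p + q) with hE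
  have hE0 : 0 ≤ E := by positivity
  have hpE : ε * p ≤ E := by rw [hE]; gcongr; linarith
  have hqE : q * ε ≤ E := by rw [hE, mul_comm]; gcongr; linarith
  have hiE : 1 / (N : ℝ) ≤ E := h.inv_le.trans hpE
  set u : ℕ → Fin M → ℝ := fun l i => S.prediction w (S.outputVec P) q (l / N) i with hu
  set g : ℕ → EuclideanSpace ℝ (Fin d) → ℝ := fun l x => S.network (S.sgd P z l) x with hg
  set dev : ℕ → ℝ := fun l => S.deviation P z l with hdev
  have hdev0 : ∀ l, 0 ≤ dev l := fun l => deviation_nonneg _ _ _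
  -- Summing over the data points costs the factor M that is included in `a` and `b`.
  suffices H : ∀ k ≤ K, ∀ i, |g k (S.x i) - u k i| ≤
      (D1 + D2 + D3 + D4 + D5) * E + (D2 + 2 * L) / N * ∑ l ∈ Finset.range k, dev l by
    have := discrete_gronwall_sum (e := dev) (a := a * E) (b := b) hN hK (by positivity)
      (by positivity) ?_ K le_rfl
    · refine this.trans (le_of_eq (by ring))
    · intro k hk
      refine (Finset.sum_le_sum fun i _ => H k hk i).trans (le_of_eq ?_)
      simp only [Finset.sum_const, Finset.card_univ, Fintype.card_fin, nsmul_eq_mul]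
      ring
  intro k hkK i
  have hk : (k : ℝ) ≤ N * T := le_trans (by exact_mod_cast hkK) hK
  have hle : ∀ l < k, (l : ℝ) ≤ N * T := fun l hl => le_trans (by exact_mod_cast hl.le) hk
  set Dsum := ∑ l ∈ Finset.range k, dev l with hDsum
  have hDsum0 : 0 ≤ Dsum := Finset.sum_nonneg fun l _ => hdev0 l
  set r : ℕ → EuclideanSpace ℝ (Fin d) × ℝ → ℝ := fun l y => y.2 - g l y.1 with hr
  -- The predicted kernel at step l.
  set α : ℕ → EuclideanSpace ℝ (Fin d) → ℝ := fun l x' =>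
    S.A w (S.x i) x' + q * S.kernRate w (l / N) (S.x i) x' with hα
  set v : ℕ → ℝ := fun l => (M : ℝ)⁻¹ * ∑ m, ((S.y m - u l m) * S.A w (S.x i) (S.x m) +
        q * ((S.y m - S.limitOutput w (l / N) m) * S.kernRate w (l / N) (S.x i) (S.x m))) with hv
  have hαb : ∀ l : ℕ, (l : ℝ) ≤ N * T → ∀ m, |α l (S.x m)| ≤ 2 * L := by
    intro l hl m
    refine (abs_add_le _ _).trans ?_
    rw [abs_mul]
    calc _ ≤ L + 1 * L := by
          gcongr
          · exact hB.A w hw i m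
          · exact hB.rate w hw _ (div_mem_Icc hN hl) i m
      _ = _ := by ring
  -- The chain of replacements: linearise each step, insert the predicted kernel, average the
  -- samples, insert the predicted residuals, and pass from the Riemann sum to the prediction.
  have E1 : |g k (S.x i) - g 0 (S.x i) - ∑ l ∈ Finset.range k,
      (N : ℝ)⁻¹ * (r l (z l) * (S.sgd P z l).mean (S.kern (S.x i) (z l).1))| ≤ D1 * E := by
    rw [← Finset.sum_range_sub (fun l => g l (S.x i)), ← Finset.sum_sub_distrib]
    refine (abs_sum_range_le fun l hl => abs_network_step_sub_le hS.smooth hS.pos hC hB h hs hT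
      (le_trans (by exact_mod_cast hl) hk) i).trans ?_
    rw [← hE]
    calc _ ≤ N * T * ((L * C ^ 2 + 3 * C * L * (L * C) ^ 2) / N * E) := by gcongr
      _ = _ := by simp only [hD1]; field_simp
  have E2 : |∑ l ∈ Finset.range k,
      (N : ℝ)⁻¹ * (r l (z l) * (S.sgd P z l).mean (S.kern (S.x i) (z l).1)) -
      ∑ l ∈ Finset.range k, (N : ℝ)⁻¹ * (r l (z l) * α l (z l).1)| ≤ D2 * E + D2 / N * Dsum := by
    rw [← Finset.sum_sub_distrib]
    refine (abs_sum_range_le (B := (N : ℝ)⁻¹ * (C * (D' * E + D' / N * Dsum)))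
      fun l hl => ?_).trans ?_
    · obtain ⟨m, hm⟩ := h.sample l
      rw [← mul_sub, ← mul_sub, abs_mul, abs_mul, abs_of_pos (inv_pos.2 hN')]
      gcongr
      · exact h.residual_sample hs (hle l hl)
      · rw [hm]
        refine (hkern h hs l (hle l hl) i m).trans ?_
        gcongr
        -- Deviations are nonnegative, so the sum up to l is at most the sum up to k; this makes the
        -- bound uniform in l.
        exact Finset.sum_le_sum_of_subset_of_nonneg
          (Finset.range_subset_range.2 hl.le) fun l _ _ => hdev0 l
    · calc _ ≤ N * T * ((N : ℝ)⁻¹ * (C * (D' * E + D' / N * Dsum))) := by gcongr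
        _ = _ := by simp only [hD2]; field_simp
  have E3 : |∑ l ∈ Finset.range k, (r l (z l) * α l (z l).1 -
      (M : ℝ)⁻¹ * ∑ m, r l (S.x m, S.y m) * α l (S.x m))| ≤ N * (D3 * E) := by
    have := h.abs_sum_sample_sub_le (a := fun l y => r l y * α l y.1) (B := C * (2 * L))
      (c := C * (2 * L ^ 2) + C * (2 * L)) (by positivity) hk ?_ ?_
    · refine this.trans ?_
      calc _ = N * (D3 * (ε * p)) := by simp only [hD3]; ring
        _ ≤ _ := by gcongr
    · intro l hl m
      have hl' : (l : ℝ) ≤ N * T := le_trans (by exact_mod_cast hl) hk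
      simp only [abs_mul]
      exact mul_le_mul (hs.abs_residual_le l hl' m) (hαb l hl' m) (abs_nonneg _) hC0
    · intro l hl m
      have hl' : (l : ℝ) ≤ N * T := hle l hl
      have hl1 : ((l + 1 : ℕ) : ℝ) ≤ N * T := le_trans (by exact_mod_cast hl) hk
      refine (abs_mul_sub_mul_le (δ := C * (1 / N)) (δ' := 2 * L ^ 2 * (1 / N)) ?_ ?_
        (hs.abs_residual_le (l + 1) hl1 m) (hαb l hl' m)).trans (le_of_eq (by ring))
      · simp only [hr]
        rw [sub_sub_sub_cancel_left, abs_sub_comm]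
        exact hs.abs_network_step_le l hl1 m
      · simp only [hα]
        rw [add_sub_add_left_eq_sub, ← mul_sub, abs_mul]
        refine (mul_le_mul hqabs (hB.abs_kernRate_sub_le hw (div_mem_Icc hN hl1)
          (div_mem_Icc hN hl') i m) (abs_nonneg _) zero_le_one).trans (le_of_eq ?_)
        rw [one_mul, ← sub_div]
        push_cast
        rw [add_sub_cancel_left, abs_of_pos (by positivity)]
  have E4 : |∑ l ∈ Finset.range k, ((M : ℝ)⁻¹ * ∑ m, r l (S.x m, S.y m) * α l (S.x m) - v l)| ≤
      2 * L * Dsum + N * (D4 * E) := by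
    refine (Finset.abs_sum_le_sum_abs _ _).trans ?_
    have : ∀ l ∈ Finset.range k, |(M : ℝ)⁻¹ * ∑ m, r l (S.x m, S.y m) * α l (S.x m) - v l| ≤
        2 * L * dev l + L ^ 2 * (M + 1) * E := by
      intro l hl
      have hl' := hle l (Finset.mem_range.1 hl)
      refine abs_average_sub_average_le i.pos fun m => ?_
      have a1 := abs_network_sub_prediction_le (S := S) P z l m
      have a2 := abs_network_sub_limitOutput_le hB h hl' m
      -- The first difference is the deviation. The second, where `prediction` uses the residual of
      -- h, has the additional factor q and is O(q ε) apart from the deviation.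
      have e : r l (S.x m, S.y m) * α l (S.x m) - ((S.y m - u l m) * S.A w (S.x i) (S.x m) +
          q * ((S.y m - S.limitOutput w (l / N) m) * S.kernRate w (l / N) (S.x i) (S.x m))) =
          -((g l (S.x m) - u l m) * S.A w (S.x i) (S.x m)) -
          q * ((g l (S.x m) - S.limitOutput w (l / N) m) *
            S.kernRate w (l / N) (S.x i) (S.x m)) := by
        simp only [hr, hα]; ring
      rw [e]
      refine (abs_sub _ _).trans ?_
      rw [abs_neg, abs_mul, abs_mul q, abs_mul, abs_of_pos hq0]
      have hd0 := hdev0 l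
      calc _ ≤ dev l * L + q * ((dev l + L * (M + 1) * ε) * L) := by
            gcongr
            · exact hB.A w hw i m
            · exact hB.rate w hw _ (div_mem_Icc hN hl') i m
        _ = dev l * L + q * (dev l * L) + L ^ 2 * (M + 1) * (q * ε) := by ring
        _ ≤ dev l * L + 1 * (dev l * L) + L ^ 2 * (M + 1) * E := by gcongr
        _ = _ := by ring
    refine (Finset.sum_le_sum this).trans ?_
    rw [Finset.sum_add_distrib, ← Finset.mul_sum, Finset.sum_const, Finset.card_range,
      nsmul_eq_mul]
    have : (k : ℝ) * (L ^ 2 * (M + 1) * E) ≤ N * (D4 * E) :=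
      calc (k : ℝ) * (L ^ 2 * (M + 1) * E) ≤ N * T * (L ^ 2 * (M + 1) * E) := by gcongr
        _ = _ := by simp only [hD4]; ring
    linarith
  have E5 : |u k i - g 0 (S.x i) - (N : ℝ)⁻¹ * ∑ l ∈ Finset.range k, v l| ≤ D5 * E := by
    refine (hB.abs_prediction_sub_sum_le hS hw hg0 hqabs hN hk i).trans ?_
    gcongr
  rw [← Finset.mul_sum, ← Finset.mul_sum] at E2
  rw [← Finset.mul_sum] at E1
  rw [Finset.sum_sub_distrib] at E3 E4
  set s1 := ∑ l ∈ Finset.range k, r l (z l) * (S.sgd P z l).mean (S.kern (S.x i) (z l).1)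
  set s2 := ∑ l ∈ Finset.range k, r l (z l) * α l (z l).1
  set s3 := ∑ l ∈ Finset.range k, (M : ℝ)⁻¹ * ∑ m, r l (S.x m, S.y m) * α l (S.x m)
  set s4 := ∑ l ∈ Finset.range k, v l
  have F3 : |(N : ℝ)⁻¹ * (s2 - s3)| ≤ D3 * E := by
    rwa [abs_mul, abs_of_pos (inv_pos.2 hN'), inv_mul_le_iff₀ hN']
  have F4 : |(N : ℝ)⁻¹ * (s3 - s4)| ≤ 2 * L / N * Dsum + D4 * E := by
    rw [abs_mul, abs_of_pos (inv_pos.2 hN'), inv_mul_le_iff₀ hN']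
    refine E4.trans (le_of_eq ?_)
    field_simp
  rw [mul_sub] at F3 F4
  rw [abs_le] at E1 E2 F3 F4 E5 ⊢
  have e : (D1 + D2 + D3 + D4 + D5) * E + (D2 + 2 * L) / N * Dsum =
      D1 * E + (D2 * E + D2 / N * Dsum) + D3 * E + (2 * L / N * Dsum + D4 * E) + D5 * E := by ring
  rw [e]
  constructor <;> linarith [E1.1, E1.2, E2.1, E2.2, F3.1, F3.2, F4.1, F4.2, E5.1, E5.2]

/-- On good runs the network outputs follow the prediction, uniformly on `[0,T]`. -/
theorem exists_network_sub_prediction_le [IsProbabilityMeasure S.μC] [IsProbabilityMeasure S.μW]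
    (hS : S.Regular) {T : ℝ} (hT : 0 ≤ T) (R : ℝ) :
    ∃ D ε₀ : ℝ, 0 ≤ D ∧ 0 < ε₀ ∧ ∀ {N : ℕ} {P : Params d N₁ N} {z} {ω} {ε p : ℝ},
      S.GoodRun T R P z ω ε p → ε ≤ ε₀ → ∀ t ∈ Icc 0 T, ∀ i,
      |S.network (S.sgd P z ⌊(N : ℝ) * t⌋₊) (S.x i) -
        S.prediction P.W1 (S.outputVec P) ((N : ℝ) ^ (S.γ₂ - 1)) t i| ≤
      D * (ε * (p + (N : ℝ) ^ (S.γ₂ - 1))) := by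
  obtain ⟨L, hB⟩ := exists_bound hS T (R + 1)
  obtain ⟨C, ε₀, hC, hε₀, hst⟩ := exists_stableRun hS.pos hT hB
  obtain ⟨D, hD, hdev⟩ := exists_deviation_le hS hT hC hB
  have hL := hB.one_le
  refine ⟨D + L ^ 2 * (M + 5), ε₀, by positivity, hε₀, ?_⟩
  intro N P z ω ε p h hε t ht i
  have hN := h.N_pos
  have hN' : (0 : ℝ) < N := by exact_mod_cast hN
  have hq0 := h.step_pos
  have hε' := h.ε_nonneg
  have hp := h.p_nonneg
  have hq1 : |(N : ℝ) ^ (S.γ₂ - 1)| ≤ 1 := by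
    rw [abs_of_pos hq0]; exact h.q_le.trans h.ε_le
  have hw : ‖P.W1‖ ≤ R + 1 := h.norm_W1_le.trans (by linarith)
  have hg0 : ‖S.outputVec P‖ ≤ M := h.norm_outputVec_le.trans
    (mul_le_of_le_one_right (by positivity) h.ε_le)
  set k := ⌊(N : ℝ) * t⌋₊ with hk_def
  have hNt : 0 ≤ (N : ℝ) * t := mul_nonneg hN'.le ht.1
  have hk1 : (k : ℝ) ≤ N * t := Nat.floor_le hNt
  have hk2 : (N : ℝ) * t < k + 1 := Nat.lt_floor_add_one _
  have hk : (k : ℝ) ≤ N * T := hk1.trans (by gcongr; exact ht.2)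
  have h1 := (abs_network_sub_prediction_le (S := S) P z k i).trans (hdev h (hst h hε) k hk)
  have h2 := hB.abs_prediction_sub_le hS hw hg0 hq1 (div_mem_Icc hN hk) ht i
  -- Rounding t down to the mesh costs 1/N, and 1/N ≤ ε p on a good run.
  have h3 : |(k : ℝ) / N - t| ≤ 1 / N := by
    have e : (k : ℝ) / N - t = (k - N * t) / N := by field_simp
    rw [e, abs_div, abs_of_pos hN']
    gcongr
    rw [abs_le]; constructor <;> linarith
  have h4 : L ^ 2 * (M + 5) * |(k : ℝ) / N - t| ≤
      L ^ 2 * (M + 5) * (ε * (p + (N : ℝ) ^ (S.γ₂ - 1))) := by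
    gcongr
    refine h3.trans (h.inv_le.trans ?_)
    gcongr
    linarith
  refine (abs_sub_le _ _ _).trans ((add_le_add h1 (h2.trans h4)).trans (le_of_eq (by ring)))

end Setting
end

noncomputable section

/-! ### Independent families -/

section

variable {ι α β : Type*} [MeasurableSpace α] [MeasurableSpace β] (μ : Measure α) (ν : Measure β)
  [IsProbabilityMeasure μ] [IsProbabilityMeasure ν]

theorem univ_mem_squareCylinders :
    (univ : Set (ι → α)) ∈ squareCylinders fun _ : ι => {s : Set α | MeasurableSet s} :=
  ⟨∅, fun _ => univ, fun _ _ => MeasurableSet.univ, by simp⟩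

theorem isPiSystem_squareCylinders_measurableSet :
    IsPiSystem (squareCylinders fun _ : ι => {s : Set α | MeasurableSet s}) :=
  isPiSystem_squareCylinders (fun _ => MeasurableSpace.isPiSystem_measurableSet)
    (fun _ => MeasurableSet.univ)

/-- The two measures agree on products of cylinders, and cylinders form a π-system generating each
factor. -/
theorem infinitePi_prod_infinitePi :
    (Measure.infinitePi fun _ : ι => μ).prod (Measure.infinitePi fun _ : ι => ν) =
      (Measure.infinitePi fun _ : ι => μ.prod ν).map
        fun x => (fun i => (x i).1, fun i => (x i).2) := by
  classical
  refine Measure.prod_eq_generateFrom (generateFrom_squareCylinders (α := fun _ : ι => α))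
    (generateFrom_squareCylinders (α := fun _ : ι => β)) isPiSystem_squareCylinders_measurableSet
    isPiSystem_squareCylinders_measurableSet
    ⟨fun _ => univ, fun _ => univ_mem_squareCylinders, fun _ => measure_lt_top _ _, iUnion_const _⟩
    ⟨fun _ => univ, fun _ => univ_mem_squareCylinders, fun _ => measure_lt_top _ _, iUnion_const _⟩ ?_
  rintro _ ⟨s, t, ht, rfl⟩ _ ⟨s', t', ht', rfl⟩
  have ht : ∀ i, MeasurableSet (t i) := fun i => ht i (mem_univ i)
  have ht' : ∀ i, MeasurableSet (t' i) := fun i => ht' i (mem_univ i)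
  rw [Measure.map_apply (by fun_prop) ((MeasurableSet.pi s.countable_toSet fun i _ => ht i).prod
    (MeasurableSet.pi s'.countable_toSet fun i _ => ht' i))]
  -- Cylinders over different index sets are put on the common index set s ∪ s' by padding with the
  -- whole space.
  have e : (fun x : ι → α × β => ((fun i => (x i).1 : ι → α), (fun i => (x i).2 : ι → β))) ⁻¹'
      ((s : Set ι).pi t ×ˢ (s' : Set ι).pi t') =
      ((s ∪ s' : Finset ι) : Set ι).pi fun i =>
        (if i ∈ s then t i else univ) ×ˢ (if i ∈ s' then t' i else univ) := by
    ext x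
    simp only [mem_preimage, mem_prod, Set.mem_pi, Finset.mem_coe, Finset.mem_union]
    constructor
    · rintro ⟨h1, h2⟩ i -
      constructor
      · split_ifs with h
        exacts [h1 i h, mem_univ _]
      · split_ifs with h
        exacts [h2 i h, mem_univ _]
    · intro h
      refine ⟨fun i hi => ?_, fun i hi => ?_⟩
      · simpa [hi] using (h i (Or.inl hi)).1
      · simpa [hi] using (h i (Or.inr hi)).2
  rw [e, Measure.infinitePi_pi _ (fun i _ => ?_), Measure.infinitePi_pi _ (fun i _ => ht i),
    Measure.infinitePi_pi _ (fun i _ => ht' i)]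
  · simp only [Measure.prod_prod, Finset.prod_mul_distrib]
    congr 1
    · rw [← Finset.prod_subset Finset.subset_union_left (fun i _ hi => by simp [hi])]
      exact Finset.prod_congr rfl fun i hi => by simp [hi]
    · rw [← Finset.prod_subset Finset.subset_union_right (fun i _ hi => by simp [hi])]
      exact Finset.prod_congr rfl fun i hi => by simp [hi]
  · refine MeasurableSet.prod ?_ ?_
    · split_ifs
      exacts [ht i, MeasurableSet.univ]
    · split_ifs
      exacts [ht' i, MeasurableSet.univ]

theorem map_zip_infinitePi :
    ((Measure.infinitePi fun _ : ι => μ).prod (Measure.infinitePi fun _ : ι => ν)).map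
      (fun x i => (x.1 i, x.2 i)) = Measure.infinitePi fun _ : ι => μ.prod ν := by
  rw [infinitePi_prod_infinitePi, Measure.map_map (by fun_prop) (by fun_prop)]
  exact Measure.map_id

end

/-- Sums of independent, centred and bounded variables stay below `ε N^β`, for `β > 1/2`, during
`N T` steps. -/
theorem tendsto_measure_exists_lt_abs_sum {α : Type*} [MeasurableSpace α] (μ : Measure α)
    [IsProbabilityMeasure μ] {h : α → ℝ} (hm : Measurable h) {B : ℝ} (hB : ∀ᵐ x ∂μ, |h x| ≤ B)
    (h0 : ∫ x, h x ∂μ = 0) {β ε : ℝ} (hβ : 1 / 2 < β) (hε : 0 < ε) (T : ℝ) :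
    Tendsto (fun N : ℕ => (Measure.infinitePi fun _ : ℕ => μ)
      {x | ∃ k : ℕ, (k : ℝ) ≤ N * T ∧ ε * (N : ℝ) ^ β < |∑ l ∈ Finset.range k, h (x l)|})
      atTop (𝓝 0) := by
  set P := Measure.infinitePi fun _ : ℕ => μ with hP
  -- a larger bound and a larger horizon, to have them positive
  set b : ℝ := max B 1 with hb
  have hb0 : 0 < b := lt_max_of_lt_right one_pos
  set τ : ℝ := max T 1 with hτ
  have hτ0 : 0 < τ := lt_max_of_lt_right one_pos
  -- Hoeffding's variance proxy for a variable with values in [-b, b]; it equals b².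
  set c : NNReal := (‖b - -b‖₊ / 2) ^ 2 with hc
  have hcv : (c : ℝ) = b ^ 2 := by
    simp only [hc, NNReal.coe_pow, NNReal.coe_div, coe_nnnorm, Real.norm_eq_abs, NNReal.coe_ofNat]
    rw [abs_of_pos (by linarith)]; ring
  have key : ∀ g : α → ℝ, Measurable g → (∀ᵐ x ∂μ, |g x| ≤ b) → ∫ x, g x ∂μ = 0 → ∀ k : ℕ,
      ∀ t : ℝ, 0 ≤ t → P.real {x | t ≤ ∑ l ∈ Finset.range k, g (x l)} ≤
        Real.exp (-t ^ 2 / (2 * k * b ^ 2)) := by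
    intro g hg hgb hg0 k t ht
    have hind : iIndepFun (fun (i : ℕ) (x : ℕ → α) => g (x i)) P :=
      iIndepFun_infinitePi (X := fun _ => g) fun _ => hg
    have := HasSubgaussianMGF.measure_sum_range_ge_le_of_iIndepFun (c := c) (n := k) hind (fun i _ => ?_) ht
    · rwa [hcv] at this
    · have hmp := measurePreserving_eval_infinitePi (fun _ : ℕ => μ) i
      refine hasSubgaussianMGF_of_mem_Icc_of_integral_eq_zero
        (hg.comp (measurable_pi_apply i)).aemeasurable ?_ ?_
      · filter_upwards [hmp.quasiMeasurePreserving.ae hgb] with x hx using abs_le.1 hx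
      · rw [← hg0, ← hmp.map_eq, integral_map hmp.measurable.aemeasurable
          (hg.aestronglyMeasurable)]
  have hBb : ∀ᵐ x ∂μ, |h x| ≤ b := hB.mono fun x hx => hx.trans (le_max_left _ _)
  have key2 : ∀ k : ℕ, ∀ t : ℝ, 0 ≤ t → P {x | t < |∑ l ∈ Finset.range k, h (x l)|} ≤
      ENNReal.ofReal (2 * Real.exp (-t ^ 2 / (2 * k * b ^ 2))) := by
    intro k t ht
    have h1 := key h hm hBb h0 k t ht
    have h2 := key (fun x => -h x) hm.neg (by simpa using hBb) (by simp [integral_neg, h0]) k t ht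
    have hsub : {x : ℕ → α | t < |∑ l ∈ Finset.range k, h (x l)|} ⊆
        {x | t ≤ ∑ l ∈ Finset.range k, h (x l)} ∪ {x | t ≤ ∑ l ∈ Finset.range k, -h (x l)} := by
      intro x hx
      have hx : t < |∑ l ∈ Finset.range k, h (x l)| := hx
      rcases lt_abs.1 hx with hx | hx
      · exact Or.inl hx.le
      · refine Or.inr ?_
        change _ ≤ ∑ l ∈ Finset.range k, -h (x l)
        rw [Finset.sum_neg_distrib]
        exact hx.le
    refine (measure_mono hsub).trans ((measure_union_le _ _).trans ?_)
    rw [two_mul, ENNReal.ofReal_add (by positivity) (by positivity)]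
    refine add_le_add ?_ ?_
    · rw [← ofReal_measureReal (measure_ne_top P _)]
      exact ENNReal.ofReal_le_ofReal h1
    · rw [← ofReal_measureReal (measure_ne_top P _)]
      exact ENNReal.ofReal_le_ofReal h2
  set δ : ℝ := 2 * β - 1 with hδ
  have hδ0 : 0 < δ := by linarith
  set a : ℝ := ε ^ 2 / (2 * τ * b ^ 2) with ha
  have ha0 : 0 < a := by positivity
  -- Union bound over the at most Nτ + 1 times k, each with a two-sided Hoeffding estimate.
  have bound : ∀ᶠ N : ℕ in atTop, P {x | ∃ k : ℕ, (k : ℝ) ≤ N * T ∧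
      ε * (N : ℝ) ^ β < |∑ l ∈ Finset.range k, h (x l)|} ≤
      ENNReal.ofReal ((N * τ + 1) * (2 * Real.exp (-(a * (N : ℝ) ^ δ)))) := by
    filter_upwards [eventually_gt_atTop 0] with N hN
    have hN' : (0 : ℝ) < N := by exact_mod_cast hN
    have hsub : {x : ℕ → α | ∃ k : ℕ, (k : ℝ) ≤ N * T ∧
        ε * (N : ℝ) ^ β < |∑ l ∈ Finset.range k, h (x l)|} ⊆
        ⋃ k ∈ Finset.range (⌊N * τ⌋₊ + 1),
          {x | ε * (N : ℝ) ^ β < |∑ l ∈ Finset.range k, h (x l)|} := by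
      rintro x ⟨k, hk, hx⟩
      simp only [Finset.mem_range, mem_iUnion, exists_prop]
      refine ⟨k, Nat.lt_succ_of_le (Nat.le_floor (hk.trans ?_)), hx⟩
      gcongr
      exact le_max_left _ _
    refine (measure_mono hsub).trans ((measure_biUnion_finset_le _ _).trans ?_)
    have hterm : ∀ k ∈ Finset.range (⌊N * τ⌋₊ + 1),
        P {x | ε * (N : ℝ) ^ β < |∑ l ∈ Finset.range k, h (x l)|} ≤
          ENNReal.ofReal (2 * Real.exp (-(a * (N : ℝ) ^ δ))) := by
      intro k hk
      -- At k = 0 the exponent of the Hoeffding bound would be a division by zero; the sum is empty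
      -- there.
      rcases Nat.eq_zero_or_pos k with rfl | hk0
      · have : {x : ℕ → α | ε * (N : ℝ) ^ β < |∑ l ∈ Finset.range 0, h (x l)|} = ∅ := by
          ext x
          simp only [Finset.range_zero, Finset.sum_empty, abs_zero, mem_ofPred_eq, mem_empty_iff_false,
            iff_false, not_lt]
          positivity
        rw [this, measure_empty]
        exact bot_le
      refine (key2 k _ (by positivity)).trans (ENNReal.ofReal_le_ofReal ?_)
      have hk' : (k : ℝ) ≤ N * τ := by
        have := Nat.le_floor_iff (a := N * τ) (n := k) (by positivity)
        exact this.1 (Nat.lt_succ_iff.1 (Finset.mem_range.1 hk))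
      have hk0' : (0 : ℝ) < k := by exact_mod_cast hk0
      refine mul_le_mul_of_nonneg_left (Real.exp_le_exp.2 ?_) (by norm_num)
      rw [neg_div, neg_le_neg_iff]
      -- The worst case k = Nτ gives an exponent of order N^(2β)/N = N^δ, which is where β > 1/2 is
      -- needed.
      have e : a * (N : ℝ) ^ δ = (ε * (N : ℝ) ^ β) ^ 2 / (2 * (N * τ) * b ^ 2) := by
        have : ((N : ℝ) ^ β) ^ 2 = (N : ℝ) ^ δ * N := by
          rw [← Real.rpow_natCast, ← Real.rpow_mul hN'.le]
          nth_rewrite 3 [← Real.rpow_one (N : ℝ)]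
          rw [← Real.rpow_add hN']
          congr 1
          simp only [hδ]; push_cast; ring
        rw [mul_pow, this]
        simp only [ha]
        field_simp
      rw [e]
      gcongr
    refine (Finset.sum_le_sum hterm).trans ?_
    rw [Finset.sum_const, Finset.card_range, nsmul_eq_mul, ← ENNReal.ofReal_natCast,
      ← ENNReal.ofReal_mul (by positivity)]
    refine ENNReal.ofReal_le_ofReal ?_
    push_cast
    gcongr
    exact Nat.floor_le (by positivity)
  have lim : Tendsto (fun N : ℕ => ENNReal.ofReal ((N * τ + 1) *
      (2 * Real.exp (-(a * (N : ℝ) ^ δ))))) atTop (𝓝 0) := by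
    rw [← ENNReal.ofReal_zero]
    refine ENNReal.tendsto_ofReal ?_
    have hy : Tendsto (fun N : ℕ => (N : ℝ) ^ δ) atTop atTop :=
      (tendsto_rpow_atTop hδ0).comp tendsto_natCast_atTop_atTop
    -- With y = N^δ the prefactor N becomes y^(1/δ), and the exponential beats any power.
    have h1 : Tendsto (fun y : ℝ => y ^ δ⁻¹ * Real.exp (-a * y)) atTop (𝓝 0) :=
      tendsto_rpow_mul_exp_neg_mul_atTop_nhds_zero _ _ ha0
    have h2 : Tendsto (fun y : ℝ => Real.exp (-a * y)) atTop (𝓝 0) :=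
      Real.tendsto_exp_atBot.comp (tendsto_id.const_mul_atTop_of_neg (by linarith))
    have h3 := (((h1.comp hy).const_mul (2 * τ)).add ((h2.comp hy).const_mul 2))
    simp only [mul_zero, add_zero] at h3
    refine h3.congr fun N => ?_
    simp only [Function.comp]
    rw [← Real.rpow_mul (Nat.cast_nonneg N), mul_inv_cancel₀ hδ0.ne', Real.rpow_one]
    ring_nf
  exact tendsto_of_tendsto_of_tendsto_of_le_of_le' tendsto_const_nhds lim
    (Eventually.of_forall fun _ => bot_le) bound

end

/-! ### Events of probability tending to one -/

noncomputable section

/-- The events `p N` have probabilities tending to one. -/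
def WithHighProbability {Ω : Type*} [MeasurableSpace Ω] (Q : Measure Ω) (p : ℕ → Ω → Prop) : Prop :=
  Tendsto (fun N => Q {x | ¬ p N x}) atTop (𝓝 0)

namespace WithHighProbability

variable {Ω Ω' : Type*} [MeasurableSpace Ω] [MeasurableSpace Ω'] {Q : Measure Ω} {Q' : Measure Ω'}
  {p q : ℕ → Ω → Prop}

theorem mono (hp : WithHighProbability Q p) (h : ∀ᶠ N in atTop, ∀ x, p N x → q N x) :
    WithHighProbability Q q :=
  tendsto_of_tendsto_of_tendsto_of_le_of_le' tendsto_const_nhds hp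
    (Eventually.of_forall fun _ => bot_le)
    (h.mono fun _ hN => measure_mono fun x hx hpx => hx (hN x hpx))

theorem of_ae (h : ∀ᶠ N in atTop, ∀ᵐ x ∂Q, p N x) : WithHighProbability Q p :=
  tendsto_const_nhds.congr' (h.mono fun _ hN => (ae_iff.1 hN).symm)

theorem and (hp : WithHighProbability Q p) (hq : WithHighProbability Q q) :
    WithHighProbability Q fun N x => p N x ∧ q N x := by
  have := Tendsto.add hp hq
  rw [add_zero] at this
  refine tendsto_of_tendsto_of_tendsto_of_le_of_le tendsto_const_nhds this
    (fun _ => bot_le) fun N => (measure_mono fun x hx => ?_).trans (measure_union_le _ _)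
  exact not_and_or.1 hx

theorem forall_fintype {ι : Type*} [Fintype ι] {p : ι → ℕ → Ω → Prop}
    (h : ∀ i, WithHighProbability Q (p i)) : WithHighProbability Q fun N x => ∀ i, p i N x := by
  have := tendsto_finsetSum Finset.univ fun i _ => h i
  rw [Finset.sum_const_zero] at this
  refine tendsto_of_tendsto_of_tendsto_of_le_of_le tendsto_const_nhds this
    (fun _ => bot_le) fun N => (measure_mono fun x hx => ?_).trans
      (measure_biUnion_finset_le Finset.univ _)
  obtain ⟨i, hi⟩ := not_forall.1 hx
  exact mem_iUnion₂.2 ⟨i, Finset.mem_univ i, hi⟩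

theorem prod_fst [IsProbabilityMeasure Q'] [SFinite Q] (hp : WithHighProbability Q p) :
    WithHighProbability (Q.prod Q') fun N x => p N x.1 := by
  refine hp.congr fun N => ?_
  have : {x : Ω × Ω' | ¬ p N x.1} = {x | ¬ p N x} ×ˢ univ := by ext x; simp
  rw [this, Measure.prod_prod, measure_univ, mul_one]

theorem prod_snd [IsProbabilityMeasure Q'] [SFinite Q] (hp : WithHighProbability Q p) :
    WithHighProbability (Q'.prod Q) fun N x => p N x.2 := by
  refine hp.congr fun N => ?_
  have : {x : Ω' × Ω | ¬ p N x.2} = univ ×ˢ {x | ¬ p N x} := by ext x; simp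
  rw [this, Measure.prod_prod, measure_univ, one_mul]

end WithHighProbability

namespace Setting

variable {d M N₁ : ℕ} {S : Setting d M N₁}

/-! ### The samples -/

theorem dataLaw_apply (s : Set (EuclideanSpace ℝ (Fin d) × ℝ)) (hs : MeasurableSet s) :
    S.dataLaw s = (M : ENNReal)⁻¹ * ∑ i, s.indicator 1 (S.x i, S.y i) := by
  simp [dataLaw, Measure.finsetSum_apply, Measure.dirac_apply' _ hs]

theorem isProbabilityMeasure_dataLaw (hM : 0 < M) : IsProbabilityMeasure S.dataLaw := by
  refine ⟨?_⟩
  rw [dataLaw_apply _ MeasurableSet.univ]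
  simp only [indicator_univ, Pi.one_apply, Finset.sum_const, Finset.card_univ, Fintype.card_fin,
    nsmul_eq_mul, mul_one]
  exact ENNReal.inv_mul_cancel (by exact_mod_cast hM.ne') (ENNReal.natCast_ne_top M)

theorem ae_dataLaw : ∀ᵐ ζ ∂S.dataLaw, ∃ m, ζ = (S.x m, S.y m) := by
  have e : {ζ | ¬ ∃ m, ζ = (S.x m, S.y m)} = (range fun m => (S.x m, S.y m))ᶜ := by
    ext ζ; simp [eq_comm]
  rw [ae_iff, e, dataLaw_apply _ (finite_range _).measurableSet.compl]
  simpa using fun i => ⟨i, rfl, rfl⟩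

theorem integral_dataLaw (f : EuclideanSpace ℝ (Fin d) × ℝ → ℝ) :
    ∫ ζ, f ζ ∂S.dataLaw = (M : ℝ)⁻¹ * ∑ m, f (S.x m, S.y m) := by
  rw [dataLaw, integral_smul_measure, integral_finsetSum_measure fun i _ =>
    integrable_dirac (by simp)]
  simp

open Classical in
/-- The weights that represent a sample by the data points, also when these are repeated. -/
def sampleWeight (S : Setting d M N₁) (ζ : EuclideanSpace ℝ (Fin d) × ℝ) (m : Fin M) : ℝ :=
  if ζ = (S.x m, S.y m) then
    ((Finset.univ.filter fun m' => (S.x m', S.y m') = (S.x m, S.y m)).card : ℝ)⁻¹ else 0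

/-- Each copy of a repeated data point gets the reciprocal of the multiplicity, so the copies
together count once. -/
theorem sum_sampleWeight {ζ : EuclideanSpace ℝ (Fin d) × ℝ} (h : ∃ m, ζ = (S.x m, S.y m))
    (ψ : EuclideanSpace ℝ (Fin d) × ℝ → ℝ) :
    ∑ m, S.sampleWeight ζ m * ψ (S.x m, S.y m) = ψ ζ := by
  classical
  obtain ⟨m₀, rfl⟩ := h
  set c : ℝ := ((Finset.univ.filter fun m' => (S.x m', S.y m') = (S.x m₀, S.y m₀)).card : ℝ) with hc
  have hc0 : c ≠ 0 := by
    rw [hc, Nat.cast_ne_zero]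
    exact Finset.card_ne_zero_of_mem (Finset.mem_filter.2 ⟨Finset.mem_univ m₀, rfl⟩)
  have : ∀ m, S.sampleWeight (S.x m₀, S.y m₀) m * ψ (S.x m, S.y m) =
      if (S.x m, S.y m) = (S.x m₀, S.y m₀) then c⁻¹ * ψ (S.x m₀, S.y m₀) else 0 := by
    intro m
    by_cases hm : (S.x m, S.y m) = (S.x m₀, S.y m₀)
    · simp only [sampleWeight, hm, if_true, hc]
    · rw [sampleWeight, if_neg (fun h => hm h.symm), if_neg hm, zero_mul]
  rw [Finset.sum_congr rfl fun m _ => this m, ← Finset.sum_filter, Finset.sum_const, nsmul_eq_mul,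
    ← hc, ← mul_assoc, mul_inv_cancel₀ hc0, one_mul]

/-- The multiplicity in the empirical law cancels the one in the weight, which makes the noise
centred also when data points coincide. -/
theorem integral_sampleWeight (m : Fin M) : ∫ ζ, S.sampleWeight ζ m ∂S.dataLaw = (M : ℝ)⁻¹ := by
  classical
  rw [integral_dataLaw]
  have hc0 : ((Finset.univ.filter fun m' => (S.x m', S.y m') = (S.x m, S.y m)).card : ℝ) ≠ 0 := by
    rw [Nat.cast_ne_zero]
    exact Finset.card_ne_zero_of_mem (Finset.mem_filter.2 ⟨Finset.mem_univ m, rfl⟩)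
  have : ∑ m', S.sampleWeight (S.x m', S.y m') m = 1 := by
    simp only [sampleWeight]
    rw [← Finset.sum_filter, Finset.sum_const, nsmul_eq_mul, mul_inv_cancel₀]
    convert hc0
  rw [this, mul_one]

theorem abs_sampleWeight_le (ζ : EuclideanSpace ℝ (Fin d) × ℝ) (m : Fin M) :
    |S.sampleWeight ζ m| ≤ 1 := by
  rw [sampleWeight]
  split_ifs
  · rw [abs_of_nonneg (by positivity)]
    exact Nat.cast_inv_le_one _
  · simp

theorem measurable_sampleWeight (m : Fin M) : Measurable fun ζ => S.sampleWeight ζ m :=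
  Measurable.ite (measurableSet_singleton _) measurable_const measurable_const

/-! ### Good runs have high probability -/

/-- The initial parameters with weights `θ i` and first layer `w`. -/
def weightParams (N : ℕ) (w : FirstLayer d N₁) (θ : ℕ → ℝ × (Fin N₁ → ℝ)) : Params d N₁ N :=
  initParams N w (fun i => (θ i).1) (fun i => (θ i).2)

theorem particle_weightParams (N : ℕ) (w : FirstLayer d N₁) (θ : ℕ → ℝ × (Fin N₁ → ℝ)) (i : Fin N) :
    (weightParams N w θ).particle i = mkParticle w (θ i) := rfl

theorem mean_weightParams (N : ℕ) (w : FirstLayer d N₁) (θ : ℕ → ℝ × (Fin N₁ → ℝ))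
    (f : Particle d N₁ → ℝ) :
    (weightParams N w θ).mean f = (N : ℝ)⁻¹ * ∑ l ∈ Finset.range N, f (mkParticle w (θ l)) := by
  rw [Params.mean, Finset.sum_range fun l => f (mkParticle w (θ l))]
  rfl

/-- Concentration at the exponent 3/4 > 1/2, written as N^(-1/4) N. -/
theorem withHighProbability_noise [IsProbabilityMeasure S.dataLaw] (T : ℝ) {ε : ℝ} (hε : 0 < ε)
    (m : Fin M) :
    WithHighProbability (Measure.infinitePi fun _ : ℕ => S.dataLaw) fun N z =>
      ∀ k : ℕ, (k : ℝ) ≤ N * T → |∑ l ∈ Finset.range k, (S.sampleWeight (z l) m - (M : ℝ)⁻¹)| ≤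
        ε * (N : ℝ) ^ (-(1 / 4) : ℝ) * N := by
  have := tendsto_measure_exists_lt_abs_sum S.dataLaw
    (h := fun ζ => S.sampleWeight ζ m - (M : ℝ)⁻¹) ((measurable_sampleWeight m).sub_const _)
    (B := 1 + |(M : ℝ)⁻¹|)
    (Eventually.of_forall fun ζ => (abs_sub _ _).trans (add_le_add_left (abs_sampleWeight_le ζ m) _))
    ?_ (β := 3 / 4) (by norm_num) hε T
  · refine tendsto_of_tendsto_of_tendsto_of_le_of_le' tendsto_const_nhds this
      (Eventually.of_forall fun _ => bot_le) ?_
    filter_upwards [eventually_gt_atTop 0] with N hN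
    have hN' : (0 : ℝ) < N := by exact_mod_cast hN
    refine measure_mono fun z hz => ?_
    obtain ⟨k, hk⟩ := not_forall.1 hz
    obtain ⟨hk, hz⟩ := Classical.not_imp.1 hk
    refine ⟨k, hk, lt_of_eq_of_lt ?_ (not_le.1 hz)⟩
    nth_rewrite 3 [← Real.rpow_one (N : ℝ)]
    rw [mul_assoc, ← Real.rpow_add hN']
    norm_num
  · have hi : Integrable (fun ζ => S.sampleWeight ζ m) S.dataLaw :=
      Integrable.of_bound (C := 1) (measurable_sampleWeight m).aestronglyMeasurable
        (Eventually.of_forall fun ζ => abs_sampleWeight_le ζ m)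
    rw [integral_sub hi (integrable_const _), integral_sampleWeight]
    simp

section

variable [IsProbabilityMeasure S.μC] [IsProbabilityMeasure S.μW]

theorem withHighProbability_sum_le (hS : S.Regular) (w : FirstLayer d N₁)
    {f : Particle d N₁ → ℝ} (hf : Continuous f) {β ε : ℝ} (hβ : 1 / 2 < β) (hε : 0 < ε) :
    WithHighProbability (Measure.infinitePi fun _ : ℕ => S.weightLaw) fun N θ =>
      |∑ l ∈ Finset.range N, (f (mkParticle w (θ l)) - ∫ θ, f θ ∂S.γ₀ w)| ≤ ε * (N : ℝ) ^ β := by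
  obtain ⟨B, hB⟩ := exists_bound_mkParticle hS hf ‖w‖
  have hc : Continuous fun p => f (mkParticle w p) :=
    hf.comp (continuous_mkParticle.comp (Continuous.prodMk_right w))
  have := tendsto_measure_exists_lt_abs_sum S.weightLaw
    (h := fun p => f (mkParticle w p) - ∫ θ, f θ ∂S.γ₀ w) (hc.measurable.sub_const _)
    (B := B + |∫ θ, f θ ∂S.γ₀ w|) ?_ ?_ hβ hε 1
  · refine tendsto_of_tendsto_of_tendsto_of_le_of_le tendsto_const_nhds this
      (fun _ => bot_le) fun N => measure_mono fun θ hθ => ?_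
    exact ⟨N, by simp, not_le.1 hθ⟩
  · filter_upwards [hB] with p hp
    exact (abs_sub _ _).trans (add_le_add_left (hp w le_rfl) _)
  · rw [integral_sub (integrable_mkParticle hS hf w) (integrable_const _), integral_γ₀ w hf]
    simp

theorem withHighProbability_mean_sub_le (hS : S.Regular) (w : FirstLayer d N₁)
    {f : Particle d N₁ → ℝ} (hf : Continuous f) {ε : ℝ} (hε : 0 < ε) :
    WithHighProbability (Measure.infinitePi fun _ : ℕ => S.weightLaw) fun N θ =>
      |(weightParams N w θ).mean f - ∫ θ, f θ ∂S.γ₀ w| ≤ ε * (N : ℝ) ^ (-(1 / 4) : ℝ) := by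
  refine (withHighProbability_sum_le hS w hf (β := 3 / 4) (by norm_num) hε).mono ?_
  filter_upwards [eventually_gt_atTop 0] with N hN θ hθ
  have hN' : (0 : ℝ) < N := by exact_mod_cast hN
  have e : (weightParams N w θ).mean f - ∫ θ, f θ ∂S.γ₀ w =
      (N : ℝ)⁻¹ * ∑ l ∈ Finset.range N, (f (mkParticle w (θ l)) - ∫ θ, f θ ∂S.γ₀ w) := by
    rw [mean_weightParams, Finset.sum_sub_distrib, Finset.sum_const, Finset.card_range, nsmul_eq_mul]
    field_simp
  have e2 : (N : ℝ) * (ε * (N : ℝ) ^ (-(1 / 4) : ℝ)) = ε * (N : ℝ) ^ (3 / 4 : ℝ) := by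
    nth_rewrite 1 [← Real.rpow_one (N : ℝ)]
    rw [mul_left_comm, ← Real.rpow_add hN']
    norm_num
  rw [e, abs_mul, abs_of_pos (inv_pos.2 hN'), inv_mul_le_iff₀ hN', e2]
  exact hθ

theorem integral_unit (hS : S.Regular) (w : FirstLayer d N₁) (x : EuclideanSpace ℝ (Fin d)) :
    ∫ θ, S.unit x θ ∂S.γ₀ w = 0 := by
  rw [integral_γ₀ w (S.contDiff_unit hS.smooth x).continuous, weightLaw]
  simp only [unit, mkParticle, Z]
  rw [integral_prod_mul (fun c : ℝ => c) (fun v : Fin N₁ → ℝ => S.σ (1 / (N₁ : ℝ) ^ S.γ₁ *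
    ∑ j, v j * S.σ (inner ℝ (w j) x))), hS.C_mean, zero_mul]

/-- The initial output is a sum of centred terms divided by N^γ₂, so the concentration bound is used
at the exponent β = γ₂. -/
theorem withHighProbability_network_le (hS : S.Regular) (w : FirstLayer d N₁)
    (x : EuclideanSpace ℝ (Fin d)) {ε : ℝ} (hε : 0 < ε) :
    WithHighProbability (Measure.infinitePi fun _ : ℕ => S.weightLaw) fun N θ =>
      |S.network (weightParams N w θ) x| ≤ ε := by
  refine (withHighProbability_sum_le hS w (S.contDiff_unit hS.smooth x).continuous (β := S.γ₂)
    hS.γ₂_mem.1 hε).mono ?_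
  filter_upwards [eventually_gt_atTop 0] with N hN θ hθ
  have hN' : (0 : ℝ) < N := by exact_mod_cast hN
  have e : S.network (weightParams N w θ) x = ((N : ℝ) ^ S.γ₂)⁻¹ *
      ∑ l ∈ Finset.range N, (S.unit x (mkParticle w (θ l)) - ∫ θ, S.unit x θ ∂S.γ₀ w) := by
    simp only [integral_unit hS, sub_zero]
    rw [network, Finset.sum_range fun l => S.unit x (mkParticle w (θ l)), one_div]
    rfl
  rw [e, abs_mul, abs_of_pos (by positivity), inv_mul_le_iff₀ (by positivity), mul_comm]
  exact hθ

/-- All conditions are almost sure or are finitely many concentration events, taken with p =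
N^(-1/4). The radius does not depend on ε, so the constants of the deterministic estimates can be
fixed before ε is chosen. -/
theorem exists_withHighProbability_goodRun [IsProbabilityMeasure S.dataLaw] (hS : S.Regular)
    (w : FirstLayer d N₁) (T : ℝ) :
    ∃ R, ∀ ε, 0 < ε → ε ≤ 1 →
      WithHighProbability ((Measure.infinitePi fun _ : ℕ => S.weightLaw).prod
        (Measure.infinitePi fun _ : ℕ => S.dataLaw)) fun N x =>
        S.GoodRun T R (weightParams N w x.1) x.2 (fun l => S.sampleWeight (x.2 l)) ε
          ((N : ℝ) ^ (-(1 / 4) : ℝ)) := by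
  obtain ⟨r, hr⟩ := ae_weightLaw_bdd hS
  refine ⟨max r ‖w‖, fun ε hε hε1 => ?_⟩
  have hinit : ∀ᵐ θ ∂(Measure.infinitePi fun _ : ℕ => S.weightLaw), ∀ l, ‖θ l‖ ≤ r :=
    ae_all_iff.2 fun l =>
      (measurePreserving_eval_infinitePi (fun _ : ℕ => S.weightLaw) l).quasiMeasurePreserving.ae hr
  have hsample : ∀ᵐ z ∂(Measure.infinitePi fun _ : ℕ => S.dataLaw), ∀ l,
      ∃ m, z l = (S.x m, S.y m) :=
    ae_all_iff.2 fun l =>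
      (measurePreserving_eval_infinitePi (fun _ : ℕ => S.dataLaw) l).quasiMeasurePreserving.ae
        ae_dataLaw
  have h1 : WithHighProbability (Measure.infinitePi fun _ : ℕ => S.weightLaw) fun _ θ =>
      ∀ l, ‖θ l‖ ≤ r := .of_ae (Eventually.of_forall fun _ => hinit)
  have h2 : WithHighProbability (Measure.infinitePi fun _ : ℕ => S.dataLaw) fun _ z =>
      ∀ l, ∃ m, z l = (S.x m, S.y m) := .of_ae (Eventually.of_forall fun _ => hsample)
  have h3 := WithHighProbability.forall_fintype fun m : Fin M =>
    withHighProbability_noise (S := S) T hε m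
  have h4 := WithHighProbability.forall_fintype fun i : Fin M =>
    withHighProbability_network_le hS w (S.x i) hε
  have h5 := WithHighProbability.forall_fintype fun q : Fin M × Fin M =>
    withHighProbability_mean_sub_le hS w
      (S.contDiff_kern hS.smooth (S.x q.1) (S.x q.2)).continuous hε
  have h6 := WithHighProbability.forall_fintype fun q : Fin M × Fin M × Fin M =>
    withHighProbability_mean_sub_le hS w
      (S.contDiff_transport hS.smooth (S.contDiff_kern hS.smooth (S.x q.1) (S.x q.2.1))
        (S.x q.2.2)).continuous hε
  have h7 := WithHighProbability.forall_fintype fun q : Fin N₁ × Fin M =>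
    withHighProbability_mean_sub_le hS w (S.contDiff_B3 hS.smooth q.1 (S.x q.2)).continuous hε
  refine (((h1.and (h4.and (h5.and (h6.and h7)))).prod_fst).and ((h2.and h3).prod_snd)).mono ?_
  -- Multiplied by N^(-1/4) this becomes the requirement 1/N ≤ ε p.
  have e1 : ∀ᶠ N : ℕ in atTop, (N : ℝ) ^ (-(3 / 4) : ℝ) ≤ ε :=
    ((tendsto_rpow_neg_atTop (by norm_num : (0 : ℝ) < 3 / 4)).comp
      tendsto_natCast_atTop_atTop).eventually (ge_mem_nhds hε)
  have e2 : ∀ᶠ N : ℕ in atTop, (N : ℝ) ^ (S.γ₂ - 1) ≤ ε := by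
    have := ((tendsto_rpow_neg_atTop (by linarith [hS.γ₂_mem.2] : 0 < 1 - S.γ₂)).comp
      tendsto_natCast_atTop_atTop).eventually (ge_mem_nhds hε)
    simpa [Function.comp] using this
  filter_upwards [eventually_gt_atTop 0, e1, e2] with N hN he1 he2
  rintro ⟨θ, z⟩ ⟨⟨g1, g4, g5, g6, g7⟩, g2, g3⟩
  have hN' : (0 : ℝ) < N := by exact_mod_cast hN
  exact {
    N_pos := hN
    ε_nonneg := hε.le
    ε_le := hε1
    p_nonneg := by positivity
    p_le := Real.rpow_le_one_of_one_le_of_nonpos (by exact_mod_cast hN) (by norm_num)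
    inv_le := by
      have : 1 / (N : ℝ) = (N : ℝ) ^ (-(3 / 4) : ℝ) * (N : ℝ) ^ (-(1 / 4) : ℝ) := by
        rw [← Real.rpow_add hN', one_div, ← Real.rpow_neg_one]; norm_num
      rw [this]
      gcongr
    q_le := he2
    start := fun i => by
      rw [particle_weightParams, mkParticle]
      refine max_le ((norm_fst_le (θ i)).trans ((g1 i).trans (le_max_left _ _))) (max_le ?_ ?_)
      · exact (norm_snd_le (θ i)).trans ((g1 i).trans (le_max_left _ _))
      · exact le_max_right _ _
    sample := g2
    rep := fun l ψ => sum_sampleWeight (g2 l) ψ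
    noise := fun m k hk => g3 m k hk
    output := g4
    kern := fun i m => g5 (i, m)
    transport := fun i m m' => g6 (i, m, m')
    B3 := fun j m => by
      have := g7 (j, m)
      simpa only [integral_B3 hS, sub_zero] using this }

end

end Setting
end

noncomputable section

/-! ### The central limit theorem at initialization -/

section Gaussian

variable {n : ℕ}

open scoped MatrixOrder Matrix.Norms.L2Operator in
-- The square root is continuous on positive elements; through it the Gaussian laws depend
-- measurably on their covariance.
theorem continuous_sqrt_of_posSemidef {X : Type*} [TopologicalSpace X]
    {Γ : X → Matrix (Fin n) (Fin n) ℝ} (hc : Continuous Γ) (hp : ∀ x, (Γ x).PosSemidef) :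
    Continuous fun x => CFC.sqrt (Γ x) :=
  CFC.continuousOn_sqrt.comp_continuous hc fun x => (hp x).nonneg

open scoped MatrixOrder in
/-- Centred Gaussian laws, as a kernel in the covariance. -/
theorem exists_kernel_multivariateGaussian {X : Type*} [TopologicalSpace X] [MeasurableSpace X]
    [OpensMeasurableSpace X] [SecondCountableTopology X]
    {Γ : X → Matrix (Fin n) (Fin n) ℝ} (hc : Continuous Γ) (hp : ∀ x, (Γ x).PosSemidef) :
    ∃ κ : Kernel X (EuclideanSpace ℝ (Fin n)), ∀ x, κ x = multivariateGaussian 0 (Γ x) := by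
  have hF : Continuous fun q : X × EuclideanSpace ℝ (Fin n) =>
      Matrix.toEuclideanCLM (𝕜 := ℝ) (CFC.sqrt (Γ q.1)) q.2 := by
    have h1 := (continuous_sqrt_of_posSemidef hc hp).comp (continuous_fst (Y := EuclideanSpace ℝ (Fin n)))
    refine (PiLp.continuous_toLp 2 _).comp (continuous_pi fun i => ?_)
    change Continuous fun q : X × EuclideanSpace ℝ (Fin n) => ∑ j, CFC.sqrt (Γ q.1) i j * q.2 j
    refine continuous_finsetSum _ fun j _ => ?_
    exact ((continuous_apply j).comp ((continuous_apply i).comp h1)).mul (by fun_prop)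
  refine ⟨⟨fun x => multivariateGaussian 0 (Γ x), ?_⟩, fun x => rfl⟩
  refine Measure.measurable_of_measurable_coe _ fun s hs => ?_
  -- The Gaussian law is the image of one fixed standard Gaussian under a map jointly continuous in
  -- x, so its mass on s is the measure of a section of a measurable set.
  have e : ∀ x, multivariateGaussian 0 (Γ x) s = stdGaussian (EuclideanSpace ℝ (Fin n))
      (Prod.mk x ⁻¹' ((fun q : X × EuclideanSpace ℝ (Fin n) =>
        Matrix.toEuclideanCLM (𝕜 := ℝ) (CFC.sqrt (Γ q.1)) q.2) ⁻¹' s)) := by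
    intro x
    rw [multivariateGaussian, Measure.map_apply (by fun_prop) hs]
    simp only [zero_add]
    rfl
  simp_rw [e]
  exact measurable_measure_prodMk_left (hF.measurable hs)

end Gaussian

/-- The multivariate central limit theorem for bounded vectors. -/
theorem tendstoInDistribution_multivariateGaussian {α : Type*} [MeasurableSpace α] (μ : Measure α)
    [IsProbabilityMeasure μ] {n : ℕ} {V : α → EuclideanSpace ℝ (Fin n)} (hm : Measurable V) {B : ℝ}
    (hB : ∀ᵐ x ∂μ, ‖V x‖ ≤ B) (h0 : ∀ i, ∫ x, V x i ∂μ = 0)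
    (hp : (Matrix.of fun i j => ∫ x, V x i * V x j ∂μ).PosSemidef) :
    TendstoInDistribution (fun (N : ℕ) x => (√(N : ℝ))⁻¹ • ∑ l ∈ Finset.range N, V (x l)) atTop id
      (fun _ => Measure.infinitePi fun _ : ℕ => μ)
      (multivariateGaussian 0 (Matrix.of fun i j => ∫ x, V x i * V x j ∂μ)) where
  forall_aemeasurable N := by
    refine Measurable.aemeasurable (Measurable.fun_const_smul ?_ _)
    exact Finset.measurable_fun_sum _ fun l _ => hm.comp (measurable_pi_apply l)
  aemeasurable_limit := aemeasurable_id
  tendsto := by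
    have hVi : ∀ i, Measurable fun x => V x i := fun i => by fun_prop
    have hVb : ∀ i, ∀ᵐ x ∂μ, ‖V x i‖ ≤ B := fun i =>
      hB.mono fun x hx => (PiLp.norm_apply_le (V x) i).trans hx
    have hint : ∀ i, Integrable (fun x => V x i) μ := fun i =>
      Integrable.of_bound (hVi i).aestronglyMeasurable B (hVb i)
    have hint2 : ∀ i j, Integrable (fun x => V x i * V x j) μ := fun i j =>
      (hint j).bdd_mul (hVi i).aestronglyMeasurable (hVb i)
    -- Lévy's continuity theorem, combined with the Cramér–Wold device: for fixed t, the scalar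
    -- central limit theorem is applied to the projections on t.
    refine ProbabilityMeasure.tendsto_iff_tendsto_charFun.2 fun t => ?_
    set X : ℕ → (ℕ → α) → ℝ := fun l x => inner ℝ (V (x l)) t with hX
    have hf : Measurable fun a => inner ℝ (V a) t := by fun_prop
    have hmp := fun l => measurePreserving_eval_infinitePi (fun _ : ℕ => μ) l
    have hinner : ∀ a, inner ℝ (V a) t = ∑ i, t i * V a i := by
      intro a; simp [PiLp.inner_apply]
    have hmean : ∫ a, inner ℝ (V a) t ∂μ = 0 := by
      simp_rw [hinner]
      rw [integral_finsetSum _ fun i _ => (hint i).const_mul _]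
      simp [integral_const_mul, h0]
    have hcomp : ∀ g : α → ℝ, Measurable g →
        ∫ x, g (x 0) ∂(Measure.infinitePi fun _ : ℕ => μ) = ∫ a, g a ∂μ := by
      intro g hg
      have := integral_map (μ := Measure.infinitePi fun _ : ℕ => μ)
        (hmp 0).measurable.aemeasurable (f := g) hg.aestronglyMeasurable
      rw [(hmp 0).map_eq] at this
      exact this.symm
    have hmeanX : ∫ x, X 0 x ∂(Measure.infinitePi fun _ : ℕ => μ) = 0 := (hcomp _ hf).trans hmean
    have hX0 : Measurable (X 0) := hf.comp (measurable_pi_apply 0)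
    have hvar : Var[X 0; Measure.infinitePi fun _ : ℕ => μ] =
        t ⬝ᵥ (Matrix.of fun i j => ∫ x, V x i * V x j ∂μ).mulVec t := by
      rw [variance_of_integral_eq_zero hX0.aemeasurable hmeanX]
      have e : ∀ a, (inner ℝ (V a) t) ^ 2 = ∑ i, ∑ j, t i * t j * (V a i * V a j) := by
        intro a
        rw [hinner, sq, Finset.sum_mul_sum]
        exact Finset.sum_congr rfl fun i _ => Finset.sum_congr rfl fun j _ => by ring
      calc _ = ∫ a, (inner ℝ (V a) t) ^ 2 ∂μ := hcomp _ (hf.pow_const 2)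
        _ = ∑ i, ∑ j, t i * t j * ∫ a, V a i * V a j ∂μ := by
          simp_rw [e]
          rw [integral_finsetSum _ fun i _ => integrable_finsetSum _ fun j _ =>
            (hint2 i j).const_mul _]
          refine Finset.sum_congr rfl fun i _ => ?_
          rw [integral_finsetSum _ fun j _ => (hint2 i j).const_mul _]
          exact Finset.sum_congr rfl fun j _ => integral_const_mul _ _
        _ = _ := by
          simp only [dotProduct, Matrix.mulVec, Matrix.of_apply, Finset.mul_sum]
          exact Finset.sum_congr rfl fun i _ => Finset.sum_congr rfl fun j _ => by ring
    set v := Var[X 0; Measure.infinitePi fun _ : ℕ => μ] with hv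
    have hclt := tendstoInDistribution_inv_sqrt_mul_sum_sub (X := X)
      (P := Measure.infinitePi fun _ : ℕ => μ) (P' := gaussianReal 0 v.toNNReal) (Y := id)
      HasLaw.id ?_ (iIndepFun_infinitePi (X := fun _ a => inner ℝ (V a) t) fun _ => hf) ?_
    -- The characteristic function of the projection at 1 is that of the vector at t.
    · have h1 := ProbabilityMeasure.tendsto_iff_tendsto_charFun.1 hclt.tendsto 1
      have hmS : ∀ N : ℕ, Measurable fun x : ℕ → α =>
          (√(N : ℝ))⁻¹ • ∑ l ∈ Finset.range N, V (x l) := fun N =>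
        Measurable.fun_const_smul (Finset.measurable_fun_sum _ fun l _ =>
          hm.comp (measurable_pi_apply l)) _
      have hmX : ∀ N : ℕ, Measurable fun x : ℕ → α => (√(N : ℝ))⁻¹ *
          (∑ k ∈ Finset.range N, X k x - N * ∫ x, X 0 x ∂(Measure.infinitePi fun _ : ℕ => μ)) := by
        intro N
        refine Measurable.const_mul (Measurable.sub_const (Finset.measurable_fun_sum _ fun l _ =>
          hf.comp (measurable_pi_apply l)) _) _
      refine Eq.subst (motive := fun c => Tendsto _ atTop (𝓝 c)) ?_ (h1.congr fun N => ?_)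
      · simp only [ProbabilityMeasure.coe_mk, Measure.map_id]
        rw [charFun_gaussianReal, charFun_multivariateGaussian hp, ← hvar,
          Real.coe_toNNReal _ (variance_nonneg _ _)]
        simp [hv]
      · simp only [ProbabilityMeasure.coe_mk]
        rw [charFun_apply, charFun_apply, integral_map (hmX N).aemeasurable (by fun_prop),
          integral_map (hmS N).aemeasurable (by fun_prop)]
        refine integral_congr_ae (Eventually.of_forall fun x => ?_)
        simp only [hmeanX, mul_zero, sub_zero]
        congr 2
        rw [real_inner_smul_left, sum_inner]
        simp [hX]
    · refine MemLp.of_bound (C := B * ‖t‖) (hf.comp (measurable_pi_apply 0)).aestronglyMeasurable ?_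
      filter_upwards [(hmp 0).quasiMeasurePreserving.ae hB] with x hx
      refine (norm_inner_le_norm _ _).trans ?_
      gcongr
    · intro l
      refine ⟨(hf.comp (measurable_pi_apply l)).aemeasurable,
        (hf.comp (measurable_pi_apply 0)).aemeasurable, ?_⟩
      have : ∀ l, (Measure.infinitePi fun _ : ℕ => μ).map (X l) = μ.map fun a => inner ℝ (V a) t := by
        intro l
        rw [← (hmp l).map_eq, Measure.map_map hf (hmp l).measurable, (hmp l).map_eq]
        rfl
      rw [this, this]

end

/-! ### Uniform distance and continuous paths in the Skorokhod space -/

noncomputable section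

namespace SkorokhodSpace

variable {T : ℝ} {E : Type*}

/-- Take the identity as time change. All comparisons of paths below are uniform, so no other time
change is needed. -/
theorem edist_le_iSup [PseudoEMetricSpace E] (f g : SkorokhodSpace T E) :
    edist f g ≤ ⨆ t, edist (f t) (g t) := by
  rw [edist_def]
  refine (iInf_le _ (OrderIso.refl _)).trans ?_
  simp

/-- A continuous path as an element of the Skorokhod space. -/
def ofContinuousMap [TopologicalSpace E] (f : C(Icc (0 : ℝ) T, E)) : SkorokhodSpace T E where
  toFun := f
  right_cont _ := f.continuous.continuousWithinAt
  left_lim t := ⟨f t, (f.continuous.tendsto t).mono_left nhdsWithin_le_nhds⟩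

theorem lipschitzWith_ofContinuousMap [PseudoMetricSpace E] :
    LipschitzWith 1 (ofContinuousMap : C(Icc (0 : ℝ) T, E) → SkorokhodSpace T E) := by
  intro f g
  rw [ENNReal.coe_one, one_mul]
  refine (edist_le_iSup _ _).trans (iSup_le fun t => ?_)
  rw [edist_dist, edist_dist]
  exact ENNReal.ofReal_le_ofReal (ContinuousMap.dist_apply_le_dist t)

end SkorokhodSpace

namespace Setting

variable {d M N₁ : ℕ} {S : Setting d M N₁}

/-! ### The paths as elements of the Skorokhod space -/

theorem norm_le_card_mul {n : ℕ} (v : EuclideanSpace ℝ (Fin n)) {b : ℝ} (h : ∀ i, |v i| ≤ b) :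
    ‖v‖ ≤ n * b :=
  (norm_le_sum_abs v).trans ((Finset.sum_le_sum fun i _ => h i).trans (by simp))

/-- The solution is jointly linear in the initial value and the forcing strength, so the factor N^φ
can be moved into both. -/
theorem limitPath_smul (w : FirstLayer d N₁) (c : ℝ) (k₀ : EuclideanSpace ℝ (Fin M)) (b t : ℝ) :
    S.limitPath w (c • k₀) (c * b) t = c • S.limitPath w k₀ b t := by
  rw [limitPath, limitPath, mul_smul, ← smul_add, map_smul]

section

variable [IsProbabilityMeasure S.μC] [IsProbabilityMeasure S.μW]

/-- The limit process as a function of the first layer, of the initial value and of the strength of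
the forcing. -/
def limitTrajectory (hS : S.Regular) (T : ℝ)
    (q : FirstLayer d N₁ × EuclideanSpace ℝ (Fin M) × ℝ) :
    SkorokhodSpace T (EuclideanSpace ℝ (Fin M)) :=
  SkorokhodSpace.ofContinuousMap (ContinuousMap.curry
    (⟨fun p : (FirstLayer d N₁ × EuclideanSpace ℝ (Fin M) × ℝ) × Icc (0 : ℝ) T =>
      S.limitPath p.1.1 p.1.2.1 p.1.2.2 p.2,
      (continuous_limitPath hS).comp (continuous_fst.prodMk (continuous_subtype_val.comp
        continuous_snd))⟩ : C(_, EuclideanSpace ℝ (Fin M))) q)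

/-- Joint continuity in parameters and time gives, on the compact time interval, continuity into the
uniform topology, which dominates the Skorokhod metric. -/
theorem continuous_limitTrajectory (hS : S.Regular) (T : ℝ) : Continuous (limitTrajectory hS T) :=
  SkorokhodSpace.lipschitzWith_ofContinuousMap.continuous.comp (ContinuousMap.continuous _)

theorem limitTrajectory_apply (hS : S.Regular) (T : ℝ)
    (q : FirstLayer d N₁ × EuclideanSpace ℝ (Fin M) × ℝ) (t : Icc (0 : ℝ) T) :
    limitTrajectory hS T q t = S.limitPath q.1 q.2.1 q.2.2 t := rfl

theorem solvesLinear_limitTrajectory (hS : S.Regular) {T : ℝ} (hT : 0 ≤ T) (w : FirstLayer d N₁)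
    (k₀ : EuclideanSpace ℝ (Fin M)) (b : ℝ) :
    S.SolvesLinear hT w (fun s i => b * S.forcing w s i) k₀ (limitTrajectory hS T (w, k₀, b)) := by
  intro t i
  rw [limitTrajectory_apply, limitPath_eq_integral hS]
  congr 1
  refine intervalIntegral.integral_congr fun s hs => ?_
  rw [uIcc_of_le t.2.1] at hs
  have hs' : s ∈ Icc 0 T := ⟨hs.1, hs.2.trans t.2.2⟩
  simp only [IccExtend_of_mem hT _ hs', limitTrajectory_apply]

end

/-- A family of parameters that depends continuously on a point of `X`. -/
def ContinuousParams {X : Type*} [TopologicalSpace X] {N : ℕ} (p : X → Params d N₁ N) : Prop :=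
  (∀ i, Continuous fun x => (p x).C i) ∧ (∀ i, Continuous fun x => (p x).W2 i) ∧
    Continuous fun x => (p x).W1

theorem ContinuousParams.particle {X : Type*} [TopologicalSpace X] {N : ℕ} {p : X → Params d N₁ N}
    (hp : ContinuousParams p) (i : Fin N) : Continuous fun x => (p x).particle i :=
  (hp.1 i).prodMk ((hp.2.1 i).prodMk hp.2.2)

theorem continuous_Z (hσ : ContDiff ℝ (⊤ : ℕ∞) S.σ) {X : Type*} [TopologicalSpace X]
    {θ : X → Particle d N₁} (hθ : Continuous θ) {y : X → EuclideanSpace ℝ (Fin d)}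
    (hy : Continuous y) : Continuous fun x => S.Z (θ x) (y x) := by
  have := hσ.continuous
  unfold Z
  fun_prop

theorem ContinuousParams.network (hσ : ContDiff ℝ (⊤ : ℕ∞) S.σ) {X : Type*} [TopologicalSpace X]
    {N : ℕ} {p : X → Params d N₁ N} (hp : ContinuousParams p) {y : X → EuclideanSpace ℝ (Fin d)}
    (hy : Continuous y) : Continuous fun x => S.network (p x) (y x) := by
  have h1 := hσ.continuous
  have h2 := hp.1
  have h3 := fun i => continuous_Z hσ (hp.particle i) hy
  unfold Setting.network
  fun_prop

theorem ContinuousParams.sgdStep (hσ : ContDiff ℝ (⊤ : ℕ∞) S.σ) {X : Type*} [TopologicalSpace X]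
    {N : ℕ} {p : X → Params d N₁ N} (hp : ContinuousParams p)
    {z : X → EuclideanSpace ℝ (Fin d) × ℝ} (hz : Continuous z) :
    ContinuousParams fun x => S.sgdStep (p x) (z x) := by
  have h0 := hσ.continuous
  have h1 : Continuous (deriv S.σ) := hσ.continuous_deriv (by simp)
  have hn := hp.network hσ hz.fst
  have hZ := fun i => continuous_Z hσ (hp.particle i) hz.fst
  obtain ⟨hC, hW2, hW1⟩ := hp
  refine ⟨fun i => ?_, fun i => continuous_pi fun j => ?_, continuous_pi fun j => ?_⟩
  · have := hZ i
    have := hC i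
    simp only [Setting.sgdStep]
    fun_prop
  · have := hZ i
    have := hC i
    have := hW2 i
    simp only [Setting.sgdStep]
    fun_prop
  · simp only [Setting.sgdStep]
    fun_prop

/-- Each gradient step is continuous in parameters and sample. Continuity serves below to make the
path-valued maps measurable. -/
theorem continuousParams_sgd (hσ : ContDiff ℝ (⊤ : ℕ∞) S.σ) (N k : ℕ) :
    ContinuousParams fun x : FirstLayer d N₁ × (ℕ → ℝ × (Fin N₁ → ℝ)) ×
      (ℕ → EuclideanSpace ℝ (Fin d) × ℝ) => S.sgd (weightParams N x.1 x.2.1) x.2.2 k := by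
  induction k with
  | zero =>
    refine ⟨fun i => ?_, fun i => ?_, ?_⟩ <;> simp only [sgd, weightParams, initParams] <;> fun_prop
  | succ k ih => exact ih.sgdStep hσ (by fun_prop)

theorem continuous_outputs (hσ : ContDiff ℝ (⊤ : ℕ∞) S.σ) (N k : ℕ) :
    Continuous fun x : FirstLayer d N₁ × (ℕ → ℝ × (Fin N₁ → ℝ)) ×
      (ℕ → EuclideanSpace ℝ (Fin d) × ℝ) =>
      S.outputs N x.1 (fun i => (x.2.1 i).1) (fun i => (x.2.1 i).2) x.2.2 k :=
  (PiLp.continuous_toLp 2 _).comp (continuous_pi fun _ =>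
    (continuousParams_sgd hσ N k).network hσ continuous_const)

variable [IsProbabilityMeasure S.μC] [IsProbabilityMeasure S.μW]

/-- The fluctuation path depends continuously on the initial parameters and on the samples. -/
theorem continuous_fluctuation (hS : S.Regular) (T φ : ℝ) (N : ℕ) :
    Continuous fun x : FirstLayer d N₁ × (ℕ → ℝ × (Fin N₁ → ℝ)) ×
      (ℕ → EuclideanSpace ℝ (Fin d) × ℝ) =>
      S.fluctuation T φ N x.1 (fun i => (x.2.1 i).1) (fun i => (x.2.1 i).2) x.2.2 := by
  set X := FirstLayer d N₁ × (ℕ → ℝ × (Fin N₁ → ℝ)) × (ℕ → EuclideanSpace ℝ (Fin d) × ℝ)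
  -- A path on [0,T] uses only the outputs after at most K steps, finitely many continuous
  -- functions.
  set K := ⌊(N : ℝ) * T⌋₊ with hK
  set o : X → Fin (K + 1) → EuclideanSpace ℝ (Fin M) := fun x k =>
    S.outputs N x.1 (fun i => (x.2.1 i).1) (fun i => (x.2.1 i).2) x.2.2 k with ho
  have hoc : Continuous o := continuous_pi fun k => continuous_outputs hS.smooth N k
  set h : X → C(Icc (0 : ℝ) T, EuclideanSpace ℝ (Fin M)) := fun x => ContinuousMap.curry
    (⟨fun p : FirstLayer d N₁ × Icc (0 : ℝ) T => S.limitOutput p.1 p.2,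
      (continuous_limitOutput_uncurry hS).comp (continuous_fst.prodMk
        (continuous_subtype_val.comp continuous_snd))⟩ : C(_, EuclideanSpace ℝ (Fin M))) x.1 with hh
  have hhc : Continuous h := (ContinuousMap.continuous _).comp continuous_fst
  refine continuous_iff_continuousAt.2 fun x₀ => EMetric.tendsto_nhds.2 fun ε hε => ?_
  set c : ℝ := (N : ℝ) ^ φ with hc
  have hc0 : 0 ≤ c := by positivity
  -- All paths jump at the same deterministic times, so they can be compared uniformly.
  have key : ∀ x, edist (S.fluctuation T φ N x.1 (fun i => (x.2.1 i).1) (fun i => (x.2.1 i).2) x.2.2)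
      (S.fluctuation T φ N x₀.1 (fun i => (x₀.2.1 i).1) (fun i => (x₀.2.1 i).2) x₀.2.2) ≤
      ENNReal.ofReal (c * (dist (o x) (o x₀) + dist (h x) (h x₀))) := by
    intro x
    refine (SkorokhodSpace.edist_le_iSup _ _).trans (iSup_le fun t => ?_)
    rw [edist_dist]
    refine ENNReal.ofReal_le_ofReal ?_
    have hk : ⌊(N : ℝ) * (t : ℝ)⌋₊ < K + 1 := Nat.lt_succ_of_le
      (Nat.floor_le_floor (mul_le_mul_of_nonneg_left t.2.2 (Nat.cast_nonneg N)))
    have h1 : dist (o x ⟨_, hk⟩) (o x₀ ⟨_, hk⟩) ≤ dist (o x) (o x₀) := dist_le_pi_dist _ _ _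
    have h2 : dist (h x t) (h x₀ t) ≤ dist (h x) (h x₀) := ContinuousMap.dist_apply_le_dist t
    change dist (c • (o x ⟨_, hk⟩ - h x t)) (c • (o x₀ ⟨_, hk⟩ - h x₀ t)) ≤ _
    rw [dist_smul₀, Real.norm_of_nonneg hc0]
    gcongr
    exact (dist_sub_sub_le _ _ _ _).trans (add_le_add h1 h2)
  have lim : Tendsto (fun x => ENNReal.ofReal (c * (dist (o x) (o x₀) + dist (h x) (h x₀))))
      (𝓝 x₀) (𝓝 0) := by
    have hcont : Continuous fun x => ENNReal.ofReal (c * (dist (o x) (o x₀) + dist (h x) (h x₀))) :=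
      ENNReal.continuous_ofReal.comp (by fun_prop)
    have := hcont.tendsto x₀
    simpa using this
  filter_upwards [lim.eventually (gt_mem_nhds hε)] with x hx using (key x).trans_lt hx

end Setting
end

/-! ### Convergence of the fluctuations for a fixed first layer -/

noncomputable section

/-- Bounded functions that tend to zero in probability have integrals that tend to zero. -/
theorem tendsto_integral_of_withHighProbability {Ω : Type*} [MeasurableSpace Ω] {Q : Measure Ω}
    [IsProbabilityMeasure Q] {u : ℕ → Ω → ℝ} (hu : ∀ N, Measurable (u N)) {B : ℝ}
    (hB : ∀ N x, |u N x| ≤ B) (h : ∀ δ > 0, WithHighProbability Q fun N x => |u N x| ≤ δ) :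
    Tendsto (fun N => ∫ x, u N x ∂Q) atTop (𝓝 0) := by
  rw [Metric.tendsto_nhds]
  intro ε hε
  have h1 := h (ε / 2) (by positivity)
  have h2 : Tendsto (fun N => B * Q.real {x | ¬ |u N x| ≤ ε / 2}) atTop (𝓝 0) := by
    have := ((ENNReal.tendsto_toReal ENNReal.zero_ne_top).comp h1).const_mul B
    rwa [ENNReal.toReal_zero, mul_zero] at this
  filter_upwards [h2.eventually (gt_mem_nhds (by positivity : 0 < ε / 2))] with N hN
  rw [dist_zero_right]
  have hms : MeasurableSet {x | ¬ |u N x| ≤ ε / 2} :=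
    (measurableSet_le (hu N).abs measurable_const).compl
  have hint : Integrable (fun x => ε / 2 + {x | ¬ |u N x| ≤ ε / 2}.indicator (fun _ => B) x) Q :=
    (integrable_const _).add ((integrable_const B).indicator hms)
  calc ‖∫ x, u N x ∂Q‖ ≤ ∫ x, (ε / 2 + {x | ¬ |u N x| ≤ ε / 2}.indicator (fun _ => B) x) ∂Q := by
        refine norm_integral_le_of_norm_le hint (Eventually.of_forall fun x => ?_)
        rw [Real.norm_eq_abs]
        by_cases hx : |u N x| ≤ ε / 2
        · have : x ∉ {x | ¬ |u N x| ≤ ε / 2} := fun h => h hx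
          rwa [indicator_of_notMem this, add_zero]
        · have : x ∈ {x | ¬ |u N x| ≤ ε / 2} := hx
          rw [indicator_of_mem this]
          linarith [hB N x]
    _ = ε / 2 + B * Q.real {x | ¬ |u N x| ≤ ε / 2} := by
        rw [integral_add (integrable_const _) ((integrable_const B).indicator hms),
          integral_indicator_const B hms]
        simp [mul_comm]
    _ < ε := by linarith

theorem tendsto_natCast_rpow_of_nonpos {c : ℝ} (hc : c ≤ 0) :
    Tendsto (fun N : ℕ => (N : ℝ) ^ c) atTop (𝓝 (if c = 0 then 1 else 0)) := by
  split_ifs with h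
  · simp [h]
  · have := (tendsto_rpow_neg_atTop (by
      rcases hc.lt_or_eq with h' | h'
      exacts [neg_pos.2 h', absurd h' h] : 0 < -c)).comp tendsto_natCast_atTop_atTop
    simp only [neg_neg] at this
    exact this

namespace Setting

variable {d M N₁ : ℕ} {S : Setting d M N₁}

/-- The contributions of one particle to the outputs at the data points. -/
def unitVec (S : Setting d M N₁) (w : FirstLayer d N₁) (p : ℝ × (Fin N₁ → ℝ)) :
    EuclideanSpace ℝ (Fin M) :=
  WithLp.toLp 2 fun i => S.unit (S.x i) (mkParticle w p)

theorem continuous_unitVec (hσ : ContDiff ℝ (⊤ : ℕ∞) S.σ) (w : FirstLayer d N₁) :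
    Continuous (S.unitVec w) :=
  (PiLp.continuous_toLp 2 _).comp (continuous_pi fun _ => (S.contDiff_unit hσ _).continuous.comp
    (continuous_mkParticle.comp (Continuous.prodMk_right w)))

/-- The exponent splits as φ - γ₂ = (φ + 1/2 - γ₂) - 1/2, which isolates the normalised sum of the
central limit theorem. -/
theorem smul_outputVec (w : FirstLayer d N₁) (θ : ℕ → ℝ × (Fin N₁ → ℝ)) (φ : ℝ) {N : ℕ}
    (hN : 0 < N) :
    (N : ℝ) ^ φ • S.outputVec (weightParams N w θ) =
      (N : ℝ) ^ (φ + 1 / 2 - S.γ₂) • (√(N : ℝ))⁻¹ • ∑ l ∈ Finset.range N, S.unitVec w (θ l) := by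
  have hN' : (0 : ℝ) < N := by exact_mod_cast hN
  ext i
  simp only [outputVec, unitVec, PiLp.smul_apply, smul_eq_mul, WithLp.ofLp_sum, Finset.sum_apply]
  rw [network, Finset.sum_range fun l => S.unit (S.x i) (mkParticle w (θ l)), ← mul_assoc,
    ← mul_assoc]
  congr 1
  rw [one_div, ← Real.rpow_neg hN'.le, ← Real.rpow_add hN', Real.sqrt_eq_rpow,
    ← Real.rpow_neg hN'.le, ← Real.rpow_add hN']
  congr 1
  ring

section

variable [IsProbabilityMeasure S.μC] [IsProbabilityMeasure S.μW]

theorem gaussCov_eq (hS : S.Regular) (w : FirstLayer d N₁) :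
    S.gaussCov w = Matrix.of fun i j => ∫ p, S.unitVec w p i * S.unitVec w p j ∂S.weightLaw := by
  ext i j
  exact integral_γ₀ w ((S.contDiff_unit hS.smooth (S.x i)).continuous.mul
    (S.contDiff_unit hS.smooth (S.x j)).continuous)

theorem continuous_gaussCov (hS : S.Regular) : Continuous S.gaussCov :=
  continuous_pi fun i => continuous_pi fun j => continuous_integral_γ₀ hS
    ((S.contDiff_unit hS.smooth (S.x i)).continuous.mul
      (S.contDiff_unit hS.smooth (S.x j)).continuous)

/-- The quadratic form at v is the second moment of the combination of the units with coefficients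
v. -/
theorem posSemidef_gaussCov (hS : S.Regular) (w : FirstLayer d N₁) : (S.gaussCov w).PosSemidef := by
  refine Matrix.PosSemidef.of_dotProduct_mulVec_nonneg ?_ fun v => ?_
  · ext i j
    simp only [gaussCov, Matrix.conjTranspose_apply, Matrix.of_apply, star_trivial]
    exact integral_congr_ae (Eventually.of_forall fun θ => mul_comm _ _)
  · have hint : ∀ i j, Integrable (fun θ => S.unit (S.x i) θ * S.unit (S.x j) θ) (S.γ₀ w) :=
      fun i j => integrable_γ₀ hS ((S.contDiff_unit hS.smooth (S.x i)).continuous.mul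
        (S.contDiff_unit hS.smooth (S.x j)).continuous) w
    have e : star v ⬝ᵥ (S.gaussCov w).mulVec v =
        ∫ θ, (∑ i, v i * S.unit (S.x i) θ) ^ 2 ∂S.γ₀ w := by
      have e1 : ∀ θ, (∑ i, v i * S.unit (S.x i) θ) ^ 2 =
          ∑ i, ∑ j, v i * v j * (S.unit (S.x i) θ * S.unit (S.x j) θ) := by
        intro θ
        rw [sq, Finset.sum_mul_sum]
        exact Finset.sum_congr rfl fun i _ => Finset.sum_congr rfl fun j _ => by ring
      simp_rw [e1]
      rw [integral_finsetSum _ fun i _ => integrable_finsetSum _ fun j _ =>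
        (hint i j).const_mul _]
      simp only [dotProduct, Matrix.mulVec, Finset.mul_sum, star_trivial]
      refine Finset.sum_congr rfl fun i _ => ?_
      rw [integral_finsetSum _ fun j _ => (hint i j).const_mul _]
      refine Finset.sum_congr rfl fun j _ => ?_
      rw [integral_const_mul, mul_assoc, mul_comm (v j)]
      rfl
    rw [e]
    exact integral_nonneg fun θ => sq_nonneg _

/-- Convergence of the predicted fluctuations, given the first layer. -/
theorem tendsto_integral_limitTrajectory (hS : S.Regular) (w : FirstLayer d N₁) (T : ℝ) {φ : ℝ}
    (h1 : φ ≤ S.γ₂ - 1 / 2) (h2 : φ ≤ 1 - S.γ₂)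
    {f : SkorokhodSpace T (EuclideanSpace ℝ (Fin M)) → ℝ}
    (hfb : ∃ C : ℝ, ∀ x y, dist (f x) (f y) ≤ C) (hf : ∃ L, LipschitzWith L f) :
    Tendsto (fun N : ℕ => ∫ θ, f (limitTrajectory hS T (w,
        (N : ℝ) ^ φ • S.outputVec (weightParams N w θ), (N : ℝ) ^ (φ + S.γ₂ - 1)))
        ∂(Measure.infinitePi fun _ : ℕ => S.weightLaw)) atTop
      (𝓝 (∫ g, f (limitTrajectory hS T (w, (if φ = S.γ₂ - 1 / 2 then (1 : ℝ) else 0) • g,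
        if φ = 1 - S.γ₂ then 1 else 0)) ∂(multivariateGaussian 0 (S.gaussCov w)))) := by
  obtain ⟨r, hr⟩ := ae_weightLaw_bdd hS
  obtain ⟨B, hB⟩ := (isCompact_closedBall (0 : ℝ × (Fin N₁ → ℝ)) r).exists_bound_of_continuousOn
    (continuous_unitVec hS.smooth w).continuousOn
  have hp := posSemidef_gaussCov hS w
  rw [gaussCov_eq hS] at hp
  have hclt := tendstoInDistribution_multivariateGaussian S.weightLaw
    (continuous_unitVec hS.smooth w).measurable
    (hr.mono fun p hp => hB p (by simpa using hp)) (fun i => ?_) hp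
  · rw [← gaussCov_eq hS] at hclt
    have e1 : (if φ = S.γ₂ - 1 / 2 then (1 : ℝ) else 0) = if φ + 1 / 2 - S.γ₂ = 0 then 1 else 0 :=
      if_congr ⟨fun h => by linarith, fun h => by linarith⟩ rfl rfl
    have e2 : (if φ = 1 - S.γ₂ then (1 : ℝ) else 0) = if φ + S.γ₂ - 1 = 0 then 1 else 0 :=
      if_congr ⟨fun h => by linarith, fun h => by linarith⟩ rfl rfl
    rw [e1, e2]
    have hrate : Tendsto (fun N : ℕ => ((N : ℝ) ^ (φ + 1 / 2 - S.γ₂), (N : ℝ) ^ (φ + S.γ₂ - 1)))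
        atTop (𝓝 ((if φ + 1 / 2 - S.γ₂ = 0 then 1 else 0), if φ + S.γ₂ - 1 = 0 then 1 else 0)) :=
      (tendsto_natCast_rpow_of_nonpos (by linarith)).prodMk_nhds
        (tendsto_natCast_rpow_of_nonpos (by linarith))
    have hg : Continuous fun q : EuclideanSpace ℝ (Fin M) × (ℝ × ℝ) =>
        limitTrajectory hS T (w, q.2.1 • q.1, q.2.2) :=
      (continuous_limitTrajectory hS T).comp (by fun_prop)
    -- Slutsky: a sequence convergent in distribution is paired with deterministic convergent rates,
    -- under a continuous map.
    have hslutsky := hclt.continuous_comp_prodMk_of_tendstoInMeasure_const hg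
      (Y := fun (N : ℕ) _ => ((N : ℝ) ^ (φ + 1 / 2 - S.γ₂), (N : ℝ) ^ (φ + S.γ₂ - 1)))
      (tendstoInMeasure_of_tendsto_ae (fun N => aestronglyMeasurable_const)
        (Eventually.of_forall fun _ => hrate)) (fun N => aemeasurable_const)
    have h3 := tendsto_iff_forall_lipschitz_integral_tendsto.1 hslutsky.tendsto f hfb hf
    have hfm : Measurable f := by
      obtain ⟨L, hL⟩ := hf
      exact hL.continuous.measurable
    simp only [ProbabilityMeasure.coe_mk] at h3
    rw [integral_map hslutsky.aemeasurable_limit hfm.aestronglyMeasurable] at h3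
    refine h3.congr' ?_
    filter_upwards [eventually_gt_atTop 0] with N hN
    rw [integral_map (hslutsky.forall_aemeasurable N) hfm.aestronglyMeasurable]
    refine integral_congr_ae (Eventually.of_forall fun θ => ?_)
    simp only [smul_outputVec w θ φ hN]
  · have := integral_unit hS w (S.x i)
    rwa [integral_γ₀ w (S.contDiff_unit hS.smooth _).continuous] at this

/-- On good runs the fluctuations are close to the predicted ones. -/
theorem exists_edist_fluctuation_le (hS : S.Regular) {T : ℝ} (hT : 0 ≤ T) (R : ℝ) {φ : ℝ}
    (h1 : φ ≤ S.γ₂ - 1 / 2) (h2 : φ ≤ 1 - S.γ₂) :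
    ∃ D ε₀ : ℝ, 0 ≤ D ∧ 0 < ε₀ ∧ ∀ {N : ℕ} {w : FirstLayer d N₁} {θ} {z} {ω} {ε : ℝ},
      S.GoodRun T R (weightParams N w θ) z ω ε ((N : ℝ) ^ (-(1 / 4) : ℝ)) → ε ≤ ε₀ →
      edist (S.fluctuation T φ N w (fun i => (θ i).1) (fun i => (θ i).2) z)
        (limitTrajectory hS T (w, (N : ℝ) ^ φ • S.outputVec (weightParams N w θ),
          (N : ℝ) ^ (φ + S.γ₂ - 1))) ≤ ENNReal.ofReal (D * ε) := by
  obtain ⟨D, ε₀, hD, hε₀, h⟩ := exists_network_sub_prediction_le hS hT R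
  refine ⟨M * (D * 2), ε₀, by positivity, hε₀, ?_⟩
  intro N w θ z ω ε hgood hε
  have hN := hgood.N_pos
  have hN1 : (1 : ℝ) ≤ N := by exact_mod_cast hN
  have hN' : (0 : ℝ) < N := by linarith
  have hε0 := hgood.ε_nonneg
  refine (SkorokhodSpace.edist_le_iSup _ _).trans (iSup_le fun t => ?_)
  rw [edist_dist, dist_eq_norm]
  refine ENNReal.ofReal_le_ofReal ?_
  -- Adding the two constraints on φ gives 2φ ≤ 1/2, so N^φ N^(-1/4) ≤ 1; the second alone gives N^φ
  -- q ≤ 1.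
  have hrate : (N : ℝ) ^ φ * ((N : ℝ) ^ (-(1 / 4) : ℝ) + (N : ℝ) ^ (S.γ₂ - 1)) ≤ 2 := by
    rw [mul_add, ← Real.rpow_add hN', ← Real.rpow_add hN']
    have a1 := Real.rpow_le_one_of_one_le_of_nonpos hN1 (by linarith : φ + -(1 / 4) ≤ 0)
    have a2 := Real.rpow_le_one_of_one_le_of_nonpos hN1 (by linarith : φ + (S.γ₂ - 1) ≤ 0)
    linarith
  -- The rescaled predicted correction is exactly the limit trajectory, so only N^φ times the
  -- distance from the prediction remains.
  have e : S.fluctuation T φ N w (fun i => (θ i).1) (fun i => (θ i).2) z t -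
      limitTrajectory hS T (w, (N : ℝ) ^ φ • S.outputVec (weightParams N w θ),
          (N : ℝ) ^ (φ + S.γ₂ - 1)) t =
      (N : ℝ) ^ φ • (S.outputs N w (fun i => (θ i).1) (fun i => (θ i).2) z ⌊(N : ℝ) * (t : ℝ)⌋₊ -
        S.prediction w (S.outputVec (weightParams N w θ)) ((N : ℝ) ^ (S.γ₂ - 1)) t) := by
    rw [limitTrajectory_apply, add_sub_assoc, Real.rpow_add hN', limitPath_smul, prediction,
      ← sub_sub, smul_sub _ (_ - _)]
    rfl
  rw [e]
  have h3 : M * (D * 2) * ε = M * (D * 2 * ε) := by ring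
  rw [h3]
  refine norm_le_card_mul _ fun i => ?_
  simp only [PiLp.smul_apply, smul_eq_mul, PiLp.sub_apply, abs_mul]
  rw [abs_of_nonneg (by positivity : (0 : ℝ) ≤ (N : ℝ) ^ φ)]
  calc _ ≤ (N : ℝ) ^ φ * (D * (ε * ((N : ℝ) ^ (-(1 / 4) : ℝ) + (N : ℝ) ^ (S.γ₂ - 1)))) :=
        mul_le_mul_of_nonneg_left (h hgood hε t t.2 i) (by positivity)
    _ = D * ε * ((N : ℝ) ^ φ * ((N : ℝ) ^ (-(1 / 4) : ℝ) + (N : ℝ) ^ (S.γ₂ - 1))) := by ring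
    _ ≤ D * ε * 2 := by gcongr
    _ = _ := by ring

/-- Convergence of the fluctuations, given the first layer. -/
theorem tendsto_integral_fluctuation [IsProbabilityMeasure S.dataLaw] (hS : S.Regular)
    (w : FirstLayer d N₁) {T : ℝ} (hT : 0 ≤ T) {φ : ℝ}
    (h1 : φ ≤ S.γ₂ - 1 / 2) (h2 : φ ≤ 1 - S.γ₂)
    {f : SkorokhodSpace T (EuclideanSpace ℝ (Fin M)) → ℝ}
    (hfb : ∃ C : ℝ, ∀ x y, dist (f x) (f y) ≤ C) (hf : ∃ L, LipschitzWith L f) :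
    Tendsto (fun N : ℕ => ∫ x, f (S.fluctuation T φ N w (fun i => (x.1 i).1) (fun i => (x.1 i).2)
        x.2) ∂((Measure.infinitePi fun _ : ℕ => S.weightLaw).prod
          (Measure.infinitePi fun _ : ℕ => S.dataLaw))) atTop
      (𝓝 (∫ g, f (limitTrajectory hS T (w, (if φ = S.γ₂ - 1 / 2 then (1 : ℝ) else 0) • g,
        if φ = 1 - S.γ₂ then 1 else 0)) ∂(multivariateGaussian 0 (S.gaussCov w)))) := by
  obtain ⟨C, hC⟩ := hfb
  obtain ⟨L, hL⟩ := hf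
  have hfm : Measurable f := hL.continuous.measurable
  set Q := (Measure.infinitePi fun _ : ℕ => S.weightLaw).prod
    (Measure.infinitePi fun _ : ℕ => S.dataLaw) with hQ
  set F : ℕ → ((ℕ → ℝ × (Fin N₁ → ℝ)) × (ℕ → EuclideanSpace ℝ (Fin d) × ℝ)) →
      SkorokhodSpace T (EuclideanSpace ℝ (Fin M)) := fun N x =>
    S.fluctuation T φ N w (fun i => (x.1 i).1) (fun i => (x.1 i).2) x.2 with hF
  set G : ℕ → (ℕ → ℝ × (Fin N₁ → ℝ)) → SkorokhodSpace T (EuclideanSpace ℝ (Fin M)) := fun N θ =>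
    limitTrajectory hS T (w, (N : ℝ) ^ φ • S.outputVec (weightParams N w θ),
      (N : ℝ) ^ (φ + S.γ₂ - 1)) with hG
  have hFm : ∀ N, Measurable (F N) := by
    intro N
    have h := (continuous_fluctuation hS T φ N).comp (Continuous.prodMk_right w)
    exact h.measurable
  have hGm : ∀ N, Measurable fun x : (ℕ → ℝ × (Fin N₁ → ℝ)) ×
      (ℕ → EuclideanSpace ℝ (Fin d) × ℝ) => G N x.1 := by
    intro N
    have h := (continuous_outputs hS.smooth N 0).comp (Continuous.prodMk_right w)
    have h' : Continuous fun x : (ℕ → ℝ × (Fin N₁ → ℝ)) × (ℕ → EuclideanSpace ℝ (Fin d) × ℝ) =>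
      S.outputVec (weightParams N w x.1) := h
    have h3 := (continuous_limitTrajectory hS T).comp ((continuous_const (y := w)).prodMk
      ((h'.const_smul ((N : ℝ) ^ φ)).prodMk (continuous_const (y := (N : ℝ) ^ (φ + S.γ₂ - 1)))))
    exact h3.measurable
  have hbd : ∀ x y, ‖f x‖ ≤ ‖f y‖ + C := by
    intro x y
    have := norm_le_norm_add_norm_sub (f y) (f x)
    rw [← dist_eq_norm, dist_comm] at this
    linarith [hC x y]
  set y₀ := limitTrajectory hS T (w, 0, 0)
  have hFi : ∀ N, Integrable (fun x => f (F N x)) Q := fun N =>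
    Integrable.of_bound (hfm.comp (hFm N)).aestronglyMeasurable (‖f y₀‖ + C)
      (Eventually.of_forall fun x => hbd _ _)
  have hGi : ∀ N, Integrable (fun x => f (G N x.1)) Q := fun N =>
    Integrable.of_bound (hfm.comp (hGm N)).aestronglyMeasurable (‖f y₀‖ + C)
      (Eventually.of_forall fun x => hbd _ _)
  obtain ⟨R, hR⟩ := exists_withHighProbability_goodRun hS w T
  obtain ⟨D, ε₀, hD, hε₀, hclose⟩ := exists_edist_fluctuation_le hS hT R h1 h2
  -- On good runs the integrands differ by at most L D ε; elsewhere the difference is bounded by C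
  -- on an event of vanishing probability.
  have hdiff : Tendsto (fun N => ∫ x, (f (F N x) - f (G N x.1)) ∂Q) atTop (𝓝 0) := by
    refine tendsto_integral_of_withHighProbability
      (fun N => (hfm.comp (hFm N)).sub (hfm.comp (hGm N))) (B := C) (fun N x => hC _ _) ?_
    intro δ hδ
    -- The added 1 keeps the denominator positive even if L D = 0.
    set ε : ℝ := min (min 1 ε₀) (δ / (L * D + 1)) with hε
    have hε0 : 0 < ε := by positivity
    refine (hR ε hε0 ((min_le_left _ _).trans (min_le_left _ _))).mono
      (Eventually.of_forall fun N x hx => ?_)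
    have h3 := hclose hx ((min_le_left _ _).trans (min_le_right _ _))
    have h4 := (hL (F N x) (G N x.1)).trans (mul_le_mul_right h3 _)
    rw [edist_dist, ← ENNReal.ofReal_coe_nnreal, ← ENNReal.ofReal_mul (NNReal.coe_nonneg L),
      ENNReal.ofReal_le_ofReal_iff (by positivity)] at h4
    refine (le_of_eq (Real.dist_eq _ _).symm).trans (h4.trans ?_)
    have h5 : ε * (L * D + 1) ≤ δ := by
      rw [← le_div_iff₀ (by positivity)]
      exact min_le_right _ _
    nlinarith
  have hlim := tendsto_integral_limitTrajectory hS w T h1 h2 ⟨C, hC⟩ ⟨L, hL⟩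
  have := hdiff.add hlim
  rw [zero_add] at this
  refine this.congr fun N => ?_
  rw [integral_sub (hFi N) (hGi N), hQ, integral_fun_fst (fun θ => f (G N θ))]
  simp [hF, hG]

end

end Setting
end

/-! ### Random first layer and the main theorem -/

noncomputable section

/-- Independent weights of the particles, listed by kind, have the law of independent particles. -/
theorem measurePreserving_particles {N₁ : ℕ} {X Y : Type*} [MeasurableSpace X] [MeasurableSpace Y]
    (ν : Measure X) (ρ : Measure Y) (μ μ' : Measure ℝ) [IsProbabilityMeasure ν]
    [IsProbabilityMeasure ρ] [IsProbabilityMeasure μ] [IsProbabilityMeasure μ'] :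
    MeasurePreserving
      (fun q : X × (ℕ → ℝ) × (ℕ × Fin N₁ → ℝ) × Y =>
        (q.1, (fun i => (q.2.1 i, fun j => q.2.2.1 (i, j))), q.2.2.2))
      (ν.prod ((Measure.infinitePi fun _ : ℕ => μ).prod
        ((Measure.infinitePi fun _ : ℕ × Fin N₁ => μ').prod ρ)))
      (ν.prod ((Measure.infinitePi fun _ : ℕ => μ.prod (Measure.pi fun _ : Fin N₁ => μ')).prod
        ρ)) := by
  -- Currying the index set ℕ × Fin N₁ gives a product over particles of finite products.
  have h1 : MeasurePreserving (fun v : ℕ × Fin N₁ → ℝ => fun i j => v (i, j))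
      (Measure.infinitePi fun _ : ℕ × Fin N₁ => μ')
      (Measure.infinitePi fun _ : ℕ => Measure.pi fun _ : Fin N₁ => μ') := by
    refine ⟨by fun_prop, ?_⟩
    have := Measure.infinitePi_map_curry fun (_ : ℕ) (_ : Fin N₁) => μ'
    simp only [Measure.infinitePi_eq_pi] at this
    exact this
  have h2 : MeasurePreserving
      (fun x : (ℕ → ℝ) × (ℕ → Fin N₁ → ℝ) => fun i => (x.1 i, x.2 i)) _ _ :=
    ⟨by fun_prop, map_zip_infinitePi μ (Measure.pi fun _ : Fin N₁ => μ')⟩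
  have h3 := h2.comp ((MeasurePreserving.id (Measure.infinitePi fun _ : ℕ => μ)).prod h1)
  have h4 := (h3.prod (MeasurePreserving.id ρ)).comp
    ((measurePreserving_prodAssoc (Measure.infinitePi fun _ : ℕ => μ)
      (Measure.infinitePi fun _ : ℕ × Fin N₁ => μ') ρ).symm _)
  exact (MeasurePreserving.id ν).prod h4

namespace Setting

variable {d M N₁ : ℕ} {S : Setting d M N₁}

/-- Covers the empty data set, for which the paths take values in a one-point space. -/
instance subsingleton_skorokhodSpace {T : ℝ} {E : Type*} [TopologicalSpace E] [Subsingleton E] :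
    Subsingleton (SkorokhodSpace T E) :=
  ⟨fun f g => by
    cases f
    cases g
    congr
    exact Subsingleton.elim _ _⟩

variable [IsProbabilityMeasure S.μC] [IsProbabilityMeasure S.μW]

/-- Convergence in distribution of the fluctuations. -/
theorem tendstoInDistribution_fluctuation [IsProbabilityMeasure S.dataLaw] (hS : S.Regular)
    {Ω : Type*} [MeasurableSpace Ω] {P : Measure Ω} [IsProbabilityMeasure P]
    {ν : Measure (FirstLayer d N₁)} [IsProbabilityMeasure ν]
    {Y : Ω → FirstLayer d N₁ × (ℕ → ℝ × (Fin N₁ → ℝ)) × (ℕ → EuclideanSpace ℝ (Fin d) × ℝ)}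
    (hY : HasLaw Y (ν.prod ((Measure.infinitePi fun _ : ℕ => S.weightLaw).prod
      (Measure.infinitePi fun _ : ℕ => S.dataLaw))) P)
    {T : ℝ} (hT : 0 ≤ T) {φ : ℝ} (h1 : φ ≤ S.γ₂ - 1 / 2) (h2 : φ ≤ 1 - S.γ₂)
    {κ : Kernel (FirstLayer d N₁) (EuclideanSpace ℝ (Fin M))} [IsMarkovKernel κ]
    (hκ : ∀ w, κ w = multivariateGaussian 0 (S.gaussCov w)) :
    TendstoInDistribution
      (fun (N : ℕ) ω => S.fluctuation T φ N (Y ω).1 (fun i => ((Y ω).2.1 i).1)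
        (fun i => ((Y ω).2.1 i).2) (Y ω).2.2) atTop
      (fun x : FirstLayer d N₁ × EuclideanSpace ℝ (Fin M) =>
        limitTrajectory hS T (x.1, (if φ = S.γ₂ - 1 / 2 then (1 : ℝ) else 0) • x.2,
          if φ = 1 - S.γ₂ then 1 else 0)) (fun _ => P) (ν ⊗ₘ κ) := by
  have hFm := fun N : ℕ => (continuous_fluctuation hS T φ N).measurable
  have hm : Measurable (fun x : FirstLayer d N₁ × EuclideanSpace ℝ (Fin M) =>
      limitTrajectory hS T (x.1, (if φ = S.γ₂ - 1 / 2 then (1 : ℝ) else 0) • x.2,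
        if φ = 1 - S.γ₂ then 1 else 0)) := by
    have h := (continuous_limitTrajectory hS T).comp
      ((continuous_fst (X := FirstLayer d N₁) (Y := EuclideanSpace ℝ (Fin M))).prodMk
      ((continuous_snd.const_smul (if φ = S.γ₂ - 1 / 2 then (1 : ℝ) else 0)).prodMk
        (continuous_const (y := if φ = 1 - S.γ₂ then (1 : ℝ) else 0))))
    exact h.measurable
  refine ⟨fun N => (hFm N).comp_aemeasurable hY.aemeasurable, hm.aemeasurable, ?_⟩
  refine tendsto_iff_forall_lipschitz_integral_tendsto.2 fun f hfb hf => ?_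
  have hfm : Measurable f := by
    obtain ⟨L, hL⟩ := hf
    exact hL.continuous.measurable
  obtain ⟨C, hC⟩ := id hfb
  set y₀ := limitTrajectory hS T ((0 : FirstLayer d N₁), 0, 0)
  have hbd : ∀ x, ‖f x‖ ≤ ‖f y₀‖ + C := by
    intro x
    have := norm_le_norm_add_norm_sub (f y₀) (f x)
    rw [← dist_eq_norm, dist_comm] at this
    linarith [hC x y₀]
  simp only [ProbabilityMeasure.coe_mk]
  rw [integral_map hm.aemeasurable hfm.aestronglyMeasurable]
  have hint : Integrable (fun x => f (limitTrajectory hS T (x.1,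
      (if φ = S.γ₂ - 1 / 2 then (1 : ℝ) else 0) • x.2, if φ = 1 - S.γ₂ then 1 else 0))) (ν ⊗ₘ κ) :=
    Integrable.of_bound (hfm.comp hm).aestronglyMeasurable (‖f y₀‖ + C)
      (Eventually.of_forall fun x => hbd _)
  rw [Measure.integral_compProd hint]
  have e : ∀ N : ℕ, ∫ x, f x ∂(P.map fun ω => S.fluctuation T φ N (Y ω).1
      (fun i => ((Y ω).2.1 i).1) (fun i => ((Y ω).2.1 i).2) (Y ω).2.2) =
      ∫ w, ∫ x, f (S.fluctuation T φ N w (fun i => (x.1 i).1) (fun i => (x.1 i).2) x.2)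
        ∂((Measure.infinitePi fun _ : ℕ => S.weightLaw).prod
          (Measure.infinitePi fun _ : ℕ => S.dataLaw)) ∂ν := by
    intro N
    refine (integral_map ((hFm N).comp_aemeasurable hY.aemeasurable)
      hfm.aestronglyMeasurable).trans ?_
    have h3 := hY.integral_comp (f := fun x => f (S.fluctuation T φ N x.1 (fun i => (x.2.1 i).1)
      (fun i => (x.2.1 i).2) x.2.2)) (hfm.comp (hFm N)).aestronglyMeasurable
    refine h3.trans (integral_prod _ ?_)
    exact Integrable.of_bound (hfm.comp (hFm N)).aestronglyMeasurable
      (‖f y₀‖ + C) (Eventually.of_forall fun x => hbd _)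
  simp only [e, hκ]
  -- Test functions are bounded, so pointwise convergence in the first layer suffices; integrating
  -- the limits is integrating against the composed kernel.
  refine tendsto_integral_of_dominated_convergence (fun _ => ‖f y₀‖ + C) (fun N => ?_)
    (integrable_const _) (fun N => Eventually.of_forall fun w => ?_)
    (Eventually.of_forall fun w => tendsto_integral_fluctuation hS w hT h1 h2 hfb hf)
  · exact (hfm.comp (hFm N)).aestronglyMeasurable.integral_prod_right'
  · refine (norm_integral_le_of_norm_le_const (Eventually.of_forall fun x => hbd _)).trans ?_
    simp

end Setting

end

theorem mainTheorem3 {Ω : Type*} [MeasurableSpace Ω] (P : Measure Ω) [IsProbabilityMeasure P]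
    {d M N₁ : ℕ} (hN₁ : 0 < N₁) (S : Setting d M N₁) (T φ : ℝ) (hT : 0 < T)
    (hγ₁ : S.γ₁ ∈ Icc (1 / 2 : ℝ) 1) (hγ₂ : S.γ₂ ∈ Ioo (1 / 2 : ℝ) 1)
    (hσ_smooth : ContDiff ℝ (⊤ : ℕ∞) S.σ) (hσ_bdd : ∃ b, ∀ u, |S.σ u| ≤ b)
    [IsProbabilityMeasure S.μC] [IsProbabilityMeasure S.μW]
    (hC_cpt : ∃ V : Set ℝ, IsCompact V ∧ ∀ᵐ c ∂S.μC, c ∈ V) (hC_mean : ∫ c, c ∂S.μC = 0)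
    (hW_cpt : ∃ V : Set ℝ, IsCompact V ∧ ∀ᵐ v ∂S.μW, v ∈ V) (hW_mean : ∫ v, v ∂S.μW = 0)
    (ν : Measure (FirstLayer d N₁)) [IsProbabilityMeasure ν]
    (hν_cpt : ∃ V : Set (EuclideanSpace ℝ (Fin d)), IsCompact V ∧ ∀ᵐ w ∂ν, ∀ j, w j ∈ V)
    (W₁ : Ω → FirstLayer d N₁) (C : ℕ → Ω → ℝ) (W₂ : ℕ → Fin N₁ → Ω → ℝ)
    (Z : ℕ → Ω → EuclideanSpace ℝ (Fin d) × ℝ)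
    (hlaw : HasLaw
      (fun ω => (W₁ ω, (fun i => C i ω), (fun p : ℕ × Fin N₁ => W₂ p.1 p.2 ω), fun k => Z k ω))
      (ν.prod ((Measure.infinitePi fun _ : ℕ => S.μC).prod
        ((Measure.infinitePi fun _ : ℕ × Fin N₁ => S.μW).prod
          (Measure.infinitePi fun _ : ℕ => S.dataLaw)))) P) :
    ∃ (Ω' : Type) (_ : MeasurableSpace Ω') (P' : Measure Ω') (_ : IsProbabilityMeasure P')
      (W' : Ω' → FirstLayer d N₁) (G : Ω' → EuclideanSpace ℝ (Fin M))
      (κ : Kernel (FirstLayer d N₁) (EuclideanSpace ℝ (Fin M))),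
      HasLaw W' ν P' ∧
      (∀ w, κ w = multivariateGaussian 0 (S.gaussCov w)) ∧
      HasCondDistrib G W' κ P' ∧
      ((S.γ₂ < 3 / 4 ∧ φ ≤ S.γ₂ - 1 / 2 ∨ 3 / 4 ≤ S.γ₂ ∧ φ < 1 - S.γ₂) →
        ∃ K : Ω' → SkorokhodSpace T (EuclideanSpace ℝ (Fin M)),
          (∀ᵐ ω' ∂P', S.SolvesLinear hT.le (W' ω') 0
            (if φ = S.γ₂ - 1 / 2 then G ω' else 0) (K ω')) ∧
          TendstoInDistribution
            (fun (N₂ : ℕ) ω => S.fluctuation T φ N₂ (W₁ ω) (fun i => C i ω)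
              (fun i j => W₂ i j ω) (fun k => Z k ω))
            atTop K (fun _ => P) P') ∧
      ((3 / 4 ≤ S.γ₂ ∧ φ = 1 - S.γ₂) →
        ∃ K : Ω' → SkorokhodSpace T (EuclideanSpace ℝ (Fin M)),
          (∀ᵐ ω' ∂P', S.SolvesLinear hT.le (W' ω') (S.forcing (W' ω'))
            (if S.γ₂ = 3 / 4 then G ω' else 0) (K ω')) ∧
          TendstoInDistribution
            (fun (N₂ : ℕ) ω => S.fluctuation T φ N₂ (W₁ ω) (fun i => C i ω)
              (fun i j => W₂ i j ω) (fun k => Z k ω))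
            atTop K (fun _ => P) P') := by
  have hbdd : ∀ {μ : Measure ℝ}, (∃ V : Set ℝ, IsCompact V ∧ ∀ᵐ c ∂μ, c ∈ V) →
      ∃ r, ∀ᵐ c ∂μ, |c| ≤ r := by
    rintro μ ⟨V, hV, h⟩
    obtain ⟨r, hr⟩ := hV.exists_bound_of_continuousOn continuousOn_id
    exact ⟨r, h.mono fun c hc => hr c hc⟩
  have hS : S.Regular := ⟨hN₁, hγ₂, hσ_smooth, hbdd hC_cpt, hbdd hW_cpt, hC_mean⟩
  obtain ⟨κ, hκ⟩ := exists_kernel_multivariateGaussian (Setting.continuous_gaussCov hS)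
    (Setting.posSemidef_gaussCov hS)
  have hκ' : IsMarkovKernel κ := ⟨fun w => by rw [hκ]; infer_instance⟩
  have hfst : HasLaw Prod.fst ν (ν ⊗ₘ κ) := ⟨by fun_prop, Measure.fst_compProd ν κ⟩
  have hsolves : ∀ (a b : ℝ) (x : FirstLayer d N₁ × EuclideanSpace ℝ (Fin M)),
      S.SolvesLinear hT.le x.1 (fun s i => b * S.forcing x.1 s i) (a • x.2)
        (Setting.limitTrajectory hS T (x.1, a • x.2, b)) := fun a b x =>
    Setting.solvesLinear_limitTrajectory hS hT.le x.1 (a • x.2) b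
  have hconv : φ ≤ S.γ₂ - 1 / 2 → φ ≤ 1 - S.γ₂ → TendstoInDistribution
      (fun (N₂ : ℕ) ω => S.fluctuation T φ N₂ (W₁ ω) (fun i => C i ω)
        (fun i j => W₂ i j ω) (fun k => Z k ω)) atTop
      (fun x : FirstLayer d N₁ × EuclideanSpace ℝ (Fin M) =>
        Setting.limitTrajectory hS T (x.1, (if φ = S.γ₂ - 1 / 2 then (1 : ℝ) else 0) • x.2,
          if φ = 1 - S.γ₂ then 1 else 0)) (fun _ => P) (ν ⊗ₘ κ) := by
    intro h1 h2
    -- Without data points the empirical law is not a probability measure, but then the path space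
    -- is a single point.
    rcases Nat.eq_zero_or_pos M with rfl | hM
    · refine ⟨fun N => (measurable_of_subsingleton_codomain _).aemeasurable,
        (measurable_of_subsingleton_codomain _).aemeasurable, ?_⟩
      refine tendsto_iff_forall_lipschitz_integral_tendsto.2 fun f _ _ => ?_
      set y₀ := Setting.limitTrajectory hS T ((0 : FirstLayer d N₁), 0, 0)
      have hf : ∀ ρ : ProbabilityMeasure (SkorokhodSpace T (EuclideanSpace ℝ (Fin 0))),
          ∫ x, f x ∂(ρ : Measure (SkorokhodSpace T (EuclideanSpace ℝ (Fin 0)))) = f y₀ := fun ρ =>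
        (integral_congr_ae (Eventually.of_forall fun x =>
          congrArg f (Subsingleton.elim x y₀))).trans (by simp)
      refine (tendsto_congr fun N => hf _).2 ?_
      exact tendsto_const_nhds.mono_right (congrArg 𝓝 (hf _).symm).le
    · have := S.isProbabilityMeasure_dataLaw hM
      exact Setting.tendstoInDistribution_fluctuation hS
        ((measurePreserving_particles ν _ S.μC S.μW).comp_hasLaw hlaw) hT.le h1 h2 hκ
  -- The canonical space carries the first layer and, conditionally on it, the Gaussian vector.
  refine ⟨FirstLayer d N₁ × EuclideanSpace ℝ (Fin M), inferInstance, ν ⊗ₘ κ, inferInstance,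
    Prod.fst, Prod.snd, κ, hfst, hκ, ⟨by fun_prop, ?_⟩, ?_, ?_⟩
  · rw [hfst.map_eq]
    exact Measure.map_id
  · intro h
    have h1 : φ ≤ S.γ₂ - 1 / 2 := by rcases h with h | h <;> linarith
    -- In both alternatives φ stays strictly below 1 - γ₂, so the forcing strength N^(φ+γ₂-1) tends
    -- to 0.
    have h2 : φ < 1 - S.γ₂ := by rcases h with h | h <;> linarith
    have h3 := hconv h1 h2.le
    simp only [if_neg h2.ne] at h3
    refine ⟨_, Eventually.of_forall fun x => ?_, h3⟩
    have h4 := hsolves (if φ = S.γ₂ - 1 / 2 then 1 else 0) 0 x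
    simp only [zero_mul, ite_smul, one_smul, zero_smul] at h4 ⊢
    exact h4
  · rintro ⟨h, rfl⟩
    have h3 := hconv (by linarith) le_rfl
    -- Here the forcing has strength 1, and the Gaussian initial value survives exactly when 1 - γ₂
    -- and γ₂ - 1/2 coincide.
    have h5 : (1 - S.γ₂ = S.γ₂ - 1 / 2) = (S.γ₂ = 3 / 4) :=
      propext ⟨fun h => by linarith, fun h => by linarith⟩
    simp only [if_true, h5] at h3
    refine ⟨_, Eventually.of_forall fun x => ?_, h3⟩
    have h4 := hsolves (if S.γ₂ = 3 / 4 then 1 else 0) 1 x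
    simp only [one_mul, ite_smul, one_smul, zero_smul] at h4 ⊢
    exact h4
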